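/- Let $\kappa\in\mathbb R$. Consider the nonlinear Schrödinger equation (NLS) $i u_t+u_{xx}+\kappa|u|^2u=0$, $x\in\mathbb R$, and its hyperbolic approximation (NLSH) with relaxation parameter $\tau>0$, $$\partial_t q_0=i\kappa|q_0|^2q_0+i\,\partial_x q_1,\qquad \partial_t q_1=-i\tau^{-1}(\partial_xq_0-q_1).$$ An ImEx Runge–Kutta method is given by a strictly lower triangular real matrix $\tilde A=(\tilde a_{ij})$, a lower triangular real matrix $A=(a_{ij})$, both $s\times s$, and weights $\tilde b,b\in\mathbb R^s$; applied to $Q_t=f(Q)+g(Q)$ with step $\Delta t$ it reads $$Q^{(i)}=Q^n+\Delta t\Big(\sum_{j<i}\tilde a_{ij}f(Q^{(j)})+\sum_{j\le i}a_{ij}g(Q^{(j)})\Big),\qquad Q^{n+1}=Q^n+\Delta t\sum_{j}\big(\tilde b_jf(Q^{(j)})+b_jg(Q^{(j)})\big).$$ It is of type I if $A$ is invertible; globally stiffly accurate (GSA) if $s\ge1$ and $\tilde a_{si}=\tilde b_i$, $a_{si}=b_i$ for all $i$; of order (at least) $p$ if its one-step error is $O(\Delta t^{p+1})$ for every smooth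 finite-dimensional system $y'=f(y)+g(y)$; and I-stable if $|R(iy)|\le1$ for all $y\in\mathbb R$, where $R(z)=1+zb^T(I-zA)^{-1}(1,\dots,1)^T$. It is applied to NLSH with $f(Q)=(i\kappa|q_0|^2q_0,0)$, $g(Q)=(i\partial_xq_1,-i\tau^{-1}(\partial_xq_0-q_1))$, and to NLS with $f(u)=i\kappa|u|^2u$, $g(u)=iu_{xx}$. Let $H^\infty$ be the space of smooth functions $\mathbb R\to\mathbb C$ all of whose derivatives are in $L^2$; all values and stages of numerical solutions are required to lie in $H^\infty$, and convergence and estimates are in $H^k(\mathbb R)$ for every $k$. **Theorem.** Let the method be of type I. 1. For every $\Delta t>0$ and $\tau>0$ and all initial data in $H^\infty$, the method has exactly one numerical solution for NLS and exactly one for NLSH. 2. (AP for $q_0$.) Fix $\Delta t>0$, let $u^n$ be the numerical solution of NLS with initial value $u^0\in H^\infty$, and let $(q_0^n,q_1^n)$ be numerical solutions of NLSH such that, as $\tau\to0^+$, $q_0^0\to u^0$ in every $H^k$ and $q_1^0$ stays bounded in every $H^k$. Then $q_0^{n+1}\to u^{n+1}$ as $\tau\to0^+$ for every $n\ge0$.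 3. (Accuracy for $q_0$.) Let the method have order $p\ge1$, let $T>0$, and let $u$ be a solution of NLS on $[0,T]$ belonging to $C([0,T];H^k)$ for every $k$. Let the data be as in 2 with $u^0=u(0)$, and $t_n=n\Delta t$. In the stiff limit $\tau\to0$, $$q_0^{n+1}-u(t_{n+1})=O(\Delta t^p)\qquad(\Delta t\to0),$$ that is, $\limsup_{\tau\to0^+}\|q_0^{n+1}-u(t_{n+1})\|_{H^k}\le C\Delta t^p$ for all $0<\Delta t<\Delta t_0$ with $t_{n+1}\le T$. This holds for each fixed $n$, with $C,\Delta t_0$ possibly depending on $n$; if the method is I-stable, it holds uniformly for all $n$ with $t_{n+1}\le T$. The constants depend on neither $\tau$, $\Delta t$ nor the NLSH data. 4. (Auxiliary component.) If the method is moreover GSA, then under the assumptions of 2, $q_1^{n+1}\to\partial_xu^{n+1}$ as $\tau\to0^+$ for every $n\ge0$ (AP for $q_1$), and under those of 3, $q_1^{n+1}-u_x(t_{n+1})=O(\Delta t^p)$ in the stiff limit, in the same sense as in 3: for each fixed $n$, and uniformly for $t_{n+1}\le T$ if the method is I-stable. -/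

import Mathlib

open Filter Topology MeasureTheory
open scoped ContDiff ENNReal

noncomputable section

namespace NLSH

/-! ### Implicit-explicit Runge-Kutta methods -/

/-- The Butcher tableaux of an `s`-stage ImEx Runge-Kutta method. All equations considered are
autonomous, so the abscissae play no role and are not recorded. -/
structure ImExMethod (s : ℕ) where
  /-- explicit coefficients -/
  Aex : Matrix (Fin s) (Fin s) ℝ
  /-- explicit weights -/
  bex : Fin s → ℝ
  /-- implicit coefficients -/
  Aim : Matrix (Fin s) (Fin s) ℝ
  /-- implicit weights -/
  bim : Fin s → ℝ
  /-- the explicit matrix is strictly lower triangular -/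
  explicit_strictLower : ∀ i j, i ≤ j → Aex i j = 0
  /-- the implicit matrix is lower triangular -/
  implicit_lower : ∀ i j, i < j → Aim i j = 0

variable {s : ℕ}

/-- Type I: the implicit matrix is invertible. -/
def ImExMethod.IsTypeI (M : ImExMethod s) : Prop := IsUnit M.Aim

/-- Globally stiffly accurate: the last row of each coefficient matrix is the weight vector. -/
def ImExMethod.IsGSA (M : ImExMethod s) : Prop :=
  ∃ l : Fin s, (l : ℕ) + 1 = s ∧ ∀ i, M.Aex l i = M.bex i ∧ M.Aim l i = M.bim i

/-- One step of size `h` for `y' = f y + g y` (`f` explicit, `g` implicit), from `y` to `y'`,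
with stages `Y`. The sums run over all `j`, but the triangular structure of the tableaux restricts
them to `j < i` and `j ≤ i`. -/
def ImExMethod.IsStep {E : Type*} [AddCommGroup E] [Module ℝ E] (M : ImExMethod s)
    (f g : E → E) (h : ℝ) (y : E) (Y : Fin s → E) (y' : E) : Prop :=
  (∀ i, Y i = y + h • (∑ j, M.Aex i j • f (Y j) + ∑ j, M.Aim i j • g (Y j))) ∧
    y' = y + h • (∑ j, M.bex j • f (Y j) + ∑ j, M.bim j • g (Y j))

/-- A sequence generated by the method with step size `h`, all values and stages lying in `S`. -/
def ImExMethod.IsTrajectory {E : Type*} [AddCommGroup E] [Module ℝ E] (M : ImExMethod s)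
    (f g : E → E) (S : Set E) (h : ℝ) (y : ℕ → E) : Prop :=
  ∀ n, y n ∈ S ∧ ∃ Y : Fin s → E, (∀ i, Y i ∈ S) ∧ M.IsStep f g h (y n) Y (y (n + 1))

/-- The method has order (at least) `p`: for every smooth splitting `y' = f y + g y` in finite
dimension, the error after one step is `O(h ^ (p + 1))`. The implicit stage equations are solved by
the branch that tends to the initial value as `h → 0`. -/
def ImExMethod.HasOrder (M : ImExMethod s) (p : ℕ) : Prop :=
  ∀ (d : ℕ) (f g : EuclideanSpace ℝ (Fin d) → EuclideanSpace ℝ (Fin d)),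
    ContDiff ℝ ∞ f → ContDiff ℝ ∞ g →
    ∀ y : ℝ → EuclideanSpace ℝ (Fin d),
      (∀ᶠ t in 𝓝 0, HasDerivAt y (f (y t) + g (y t)) t) →
    ∀ (Y : ℝ → Fin s → EuclideanSpace ℝ (Fin d)) (y₁ : ℝ → EuclideanSpace ℝ (Fin d)),
      (∀ i, Tendsto (fun h => Y h i) (𝓝[>] 0) (𝓝 (y 0))) →
      (∀ᶠ h in 𝓝[>] 0, M.IsStep f g h (y 0) (Y h) (y₁ h)) →
      (fun h => y₁ h - y h) =O[𝓝[>] 0] fun h : ℝ => h ^ (p + 1)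

/-- The linear stability function `R(z) = 1 + z bᵀ (I - z A)⁻¹ e` of the implicit tableau. -/
def ImExMethod.stabilityFunction (M : ImExMethod s) (z : ℂ) : ℂ :=
  1 + z * ((fun i => (M.bim i : ℂ)) ⬝ᵥ
    ((1 - z • M.Aim.map (fun a : ℝ => (a : ℂ)))⁻¹.mulVec fun _ => 1))

/-- The implicit method is stable on the imaginary axis (for every free Schrödinger mode). -/
def ImExMethod.IsIStable (M : ImExMethod s) : Prop :=
  ∀ y : ℝ, ‖M.stabilityFunction (Complex.I * y)‖ ≤ 1

/-! ### Function spaces -/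

/-- `H^∞(ℝ; ℂ)`: smooth functions all of whose derivatives are square integrable. -/
def HInf : Set (ℝ → ℂ) :=
  {v | ContDiff ℝ ∞ v ∧ ∀ k : ℕ, MemLp (iteratedDeriv k v) 2 volume}

/-- The Sobolev norm of `H^k(ℝ; ℂ)`, as the sum of the `L²` norms of the derivatives up to
order `k`. -/
def hNorm (k : ℕ) (v : ℝ → ℂ) : ℝ≥0∞ :=
  ∑ j ∈ Finset.range (k + 1), eLpNorm (iteratedDeriv j v) 2 volume

/-! ### The equations and their splittings -/

/-- Pairs `(q₀, q₁)`. -/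
abbrev State : Type := (ℝ → ℂ) × (ℝ → ℂ)

/-- Explicit part for NLS: `i κ |u|² u`. -/
def nlsExplicit (κ : ℝ) (u : ℝ → ℂ) : ℝ → ℂ :=
  fun x => Complex.I * κ * (‖u x‖ : ℂ) ^ 2 * u x

/-- Implicit part for NLS: `i u_xx`. -/
def nlsImplicit (u : ℝ → ℂ) : ℝ → ℂ :=
  fun x => Complex.I * deriv (deriv u) x

/-- Explicit part for the hyperbolized system: `(i κ |q₀|² q₀, 0)`. -/
def nlshExplicit (κ : ℝ) (Q : State) : State :=
  (fun x => Complex.I * κ * (‖Q.1 x‖ : ℂ) ^ 2 * Q.1 x, fun _ => 0)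

/-- Implicit part for the hyperbolized system: `(i ∂ₓ q₁, -i τ⁻¹ (∂ₓ q₀ - q₁))`. -/
def nlshImplicit (τ : ℝ) (Q : State) : State :=
  (fun x => Complex.I * deriv Q.2 x,
    fun x => -Complex.I * (τ : ℂ)⁻¹ * (deriv Q.1 x - Q.2 x))

/-- `u` (written `u t x`) solves `i u_t + u_xx + κ |u|² u = 0` on `[0, T] × ℝ` and lies in
`C([0, T]; H^k(ℝ))` for every `k`. -/
structure IsNLSSolution (κ T : ℝ) (u : ℝ → ℝ → ℂ) : Prop where
  mem : ∀ t ∈ Set.Icc 0 T, u t ∈ HInf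
  cont : ∀ k : ℕ, ∀ t ∈ Set.Icc 0 T,
    Tendsto (fun r => hNorm k (u r - u t)) (𝓝[Set.Icc 0 T] t) (𝓝 0)
  eqn : ∀ t ∈ Set.Icc 0 T, ∀ x : ℝ, ∃ ut : ℂ,
    HasDerivWithinAt (fun r => u r x) ut (Set.Icc 0 T) t ∧
      Complex.I * ut + deriv (deriv (u t)) x + κ * (‖u t x‖ : ℂ) ^ 2 * u t x = 0

/-! ### Numerical solutions -/

/-- `u n` is generated by the method applied to the split NLS equation. -/
def IsNLSTrajectory (M : ImExMethod s) (κ h : ℝ) (u : ℕ → ℝ → ℂ) : Prop :=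
  M.IsTrajectory (nlsExplicit κ) nlsImplicit HInf h u

/-- `Q n = (q₀ⁿ, q₁ⁿ)` is generated by the method applied to the split hyperbolized system. -/
def IsNLSHTrajectory (M : ImExMethod s) (κ τ h : ℝ) (Q : ℕ → State) : Prop :=
  M.IsTrajectory (nlshExplicit κ) (nlshImplicit τ) (HInf ×ˢ HInf) h Q

/-- For every `τ > 0`, `Q τ` is a numerical solution of the hyperbolized system with parameter `τ`;
as `τ → 0⁺` the initial values of `q₀` tend to `u₀` and those of `q₁` stay bounded, in every `H^k`.
No relation between the initial values of `q₁` and `∂ₓ u₀` is required. -/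
structure IsNLSHFamily (M : ImExMethod s) (κ h : ℝ) (u₀ : ℝ → ℂ) (Q : ℝ → ℕ → State) :
    Prop where
  scheme : ∀ τ : ℝ, 0 < τ → IsNLSHTrajectory M κ τ h (Q τ)
  init₀ : ∀ k : ℕ, Tendsto (fun τ => hNorm k ((Q τ 0).1 - u₀)) (𝓝[>] 0) (𝓝 0)
  init₁ : ∀ k : ℕ, ∃ B : ℝ, ∀ᶠ τ in 𝓝[>] (0 : ℝ), hNorm k (Q τ 0).2 ≤ ENNReal.ofReal B

/-- Asymptotic preserving with respect to `q₀`: for fixed step size, `q₀ⁿ⁺¹ → uⁿ⁺¹` as `τ → 0⁺`,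
where `u` is the numerical solution of NLS by the same method. -/
def IsAPq0 (M : ImExMethod s) (κ : ℝ) : Prop :=
  ∀ h : ℝ, 0 < h → ∀ u : ℕ → ℝ → ℂ, IsNLSTrajectory M κ h u →
    ∀ Q : ℝ → ℕ → State, IsNLSHFamily M κ h (u 0) Q →
      ∀ n k : ℕ, Tendsto (fun τ => hNorm k ((Q τ (n + 1)).1 - u (n + 1))) (𝓝[>] 0) (𝓝 0)

/-- Asymptotic preserving with respect to `q₁`: for fixed step size, `q₁ⁿ⁺¹ → ∂ₓ uⁿ⁺¹` as
`τ → 0⁺`. -/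
def IsAPq1 (M : ImExMethod s) (κ : ℝ) : Prop :=
  ∀ h : ℝ, 0 < h → ∀ u : ℕ → ℝ → ℂ, IsNLSTrajectory M κ h u →
    ∀ Q : ℝ → ℕ → State, IsNLSHFamily M κ h (u 0) Q →
      ∀ n k : ℕ,
        Tendsto (fun τ => hNorm k ((Q τ (n + 1)).2 - deriv (u (n + 1)))) (𝓝[>] 0) (𝓝 0)

/-- In the limit `τ → 0⁺`, the error `q₀ⁿ⁺¹ - u(tₙ₊₁)`, `tₙ₊₁ = (n + 1) h`, is at most `ε`
in `H^k`. -/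
def StiffLimitErrorQ0 (M : ImExMethod s) (κ : ℝ) (u : ℝ → ℝ → ℂ) (k n : ℕ) (h ε : ℝ) : Prop :=
  ∀ Q : ℝ → ℕ → State, IsNLSHFamily M κ h (u 0) Q →
    limsup (fun τ => hNorm k ((Q τ (n + 1)).1 - u ((n + 1 : ℕ) * h))) (𝓝[>] 0) ≤ ENNReal.ofReal ε

/-- In the limit `τ → 0⁺`, the error `q₁ⁿ⁺¹ - ∂ₓ u(tₙ₊₁)`, `tₙ₊₁ = (n + 1) h`, is at most `ε`
in `H^k`. -/
def StiffLimitErrorQ1 (M : ImExMethod s) (κ : ℝ) (u : ℝ → ℝ → ℂ) (k n : ℕ) (h ε : ℝ) : Prop :=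
  ∀ Q : ℝ → ℕ → State, IsNLSHFamily M κ h (u 0) Q →
    limsup (fun τ => hNorm k ((Q τ (n + 1)).2 - deriv (u ((n + 1 : ℕ) * h)))) (𝓝[>] 0)
      ≤ ENNReal.ofReal ε

/-- `bound n h ε` holds with `ε = C h ^ p`, for `t_{n+1} = (n + 1) h ≤ T` and `h` small: for each
fixed `n`, with constants that may depend on `n`. -/
def FixedStepOrder (p : ℕ) (T : ℝ) (bound : ℕ → ℝ → ℝ → Prop) : Prop :=
  ∀ n : ℕ, ∃ C h₀ : ℝ, 0 < h₀ ∧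
    ∀ h : ℝ, 0 < h → h < h₀ → ((n + 1 : ℕ) : ℝ) * h ≤ T → bound n h (C * h ^ p)

/-- The same with constants independent of `n`: a global error bound on `[0, T]`. -/
def UniformOrder (p : ℕ) (T : ℝ) (bound : ℕ → ℝ → ℝ → Prop) : Prop :=
  ∃ C h₀ : ℝ, 0 < h₀ ∧
    ∀ n : ℕ, ∀ h : ℝ, 0 < h → h < h₀ → ((n + 1 : ℕ) : ℝ) * h ≤ T → bound n h (C * h ^ p)

end NLSH

end

noncomputable section

namespace NLSH

/-! ### The space `H^∞` -/

/-! Everything linear is diagonalized by the Fourier transform. Both tableaux are triangular, so the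
stages are solved one at a time. An NLS stage inverts `1 - β ∂ₓ²` with `β = iα`, where `α = h a_ii`.
Eliminating `q₁` from an NLSH stage leaves the same problem for `q₀` with `β = α²/(τ - iα)`
(`sub_hyperbolic_eq_iff`). In both cases `Re β ≥ 0`, so the symbol `1 + 4π²βξ²` has modulus at least
one. The operator is then a bijection of `H^∞`, and its inverse increases no Sobolev norm, uniformly
in `τ`. This gives well-posedness.

Type I means `α ≠ 0`, and then `β → iα` as `τ → 0`. The previous `q₁` enters a stage only with a
factor `τ/(τ - iα) → 0`, so each stage converges to the NLS stage, with `q₁` tending to its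
derivative (`sobNull_stage`). The stiff term stays bounded, being recoverable from the stage
equation; hence `q₁` stays bounded after the update and the argument can be repeated
(`sobNull_step`). Convergence of the updated `q₁` itself comes from GSA, which makes the update a
stage. Derivatives may be lost freely, since all statements concern every `H^k`.

For accuracy it remains to bound the error of the method for NLS. The order hypothesis speaks only
of finite-dimensional systems, but it amounts to identities between Taylor coefficients. These
transfer to any vector space, because only finitely many vectors occur in them
(`eq_of_isStep_graded`). Inserting the truncated expansions of the stages into the scheme leaves
defects `O(h^(p+1))` in every `H^k`, uniformly in time (`IsCurve.exists_perturbedStep`).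

These defects are propagated by a stability estimate. Frequency by frequency, the difference of two
sets of stages solves the linear stage equations at a point of the imaginary axis, and type I makes
their solution bounded uniformly along that axis. One step therefore amplifies errors by at most `R
+ Ch`, with `R` a bound for the stability function on the imaginary axis
(`exists_perturbedStep_bound`). Some finite `R` always exists and suffices for finitely many steps;
I-stability allows `R = 1`, and a discrete Gronwall argument covers `[0, T]`. -/

/-- The real-valued `L²` norm of a function. -/
def l2 (v : ℝ → ℂ) : ℝ := (eLpNorm v 2 volume).toReal

lemma l2_nonneg (v : ℝ → ℂ) : 0 ≤ l2 v := ENNReal.toReal_nonneg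

lemma integrable_norm_mul_norm {f g : ℝ → ℂ} (hf : MemLp f 2) (hg : MemLp g 2) :
    Integrable fun x => ‖f x‖ * ‖g x‖ := by
  have := (hf.integrable_mul hg).norm
  simpa using this

/-- The Cauchy-Schwarz inequality. -/
lemma integral_norm_mul_norm_le {f g : ℝ → ℂ} (hf : MemLp f 2) (hg : MemLp g 2) :
    ∫ x, ‖f x‖ * ‖g x‖ ≤ l2 f * l2 g := by
  have h0 := integral_norm_eq_lintegral_enorm (f := fun x => f x * g x) (hf.1.mul hg.1)
  have h1 : ∫ x, ‖f x‖ * ‖g x‖ = (eLpNorm (fun x => f x * g x) 1 volume).toReal := by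
    rw [eLpNorm_one_eq_lintegral_enorm, ← h0]
    simp
  rw [h1, l2, l2, ← ENNReal.toReal_mul]
  refine ENNReal.toReal_mono (ENNReal.mul_ne_top hf.2.ne hg.2.ne) ?_
  have := eLpNorm_le_eLpNorm_mul_eLpNorm'_of_norm (p := 2) (q := 2) (r := 1) hf.1 hg.1
    (fun a b => a * b) 1 (Eventually.of_forall fun x => by simp)
  simpa using this

lemma HInf.memLp {v : ℝ → ℂ} (hv : v ∈ HInf) : MemLp v 2 := by
  simpa using hv.2 0

lemma HInf.differentiable {v : ℝ → ℂ} (hv : v ∈ HInf) : Differentiable ℝ v :=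
  (contDiff_infty_iff_deriv.1 hv.1).1

lemma HInf.hasDerivAt {v : ℝ → ℂ} (hv : v ∈ HInf) (x : ℝ) : HasDerivAt v (deriv v x) x :=
  (HInf.differentiable hv x).hasDerivAt

lemma HInf.deriv {v : ℝ → ℂ} (hv : v ∈ HInf) : deriv v ∈ HInf :=
  ⟨(contDiff_infty_iff_deriv.1 hv.1).2, fun k => by
    rw [← iteratedDeriv_succ']
    exact hv.2 (k + 1)⟩

lemma HInf.contDiffAt {v : ℝ → ℂ} (hv : v ∈ HInf) (k : ℕ) (x : ℝ) : ContDiffAt ℝ k v x :=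
  (hv.1.of_le (by exact_mod_cast le_top)).contDiffAt

/-- The function `v v̄` and its derivative are integrable, so `v v̄` vanishes at `+∞`, and `|v x|²`
is the modulus of the integral of the derivative over `(x, ∞)`. -/
lemma HInf.norm_sq_le {v : ℝ → ℂ} (hv : v ∈ HInf) (x : ℝ) :
    ‖v x‖ ^ 2 ≤ 2 * (l2 (_root_.deriv v) * l2 v) := by
  have hL := HInf.memLp hv
  have hL' := HInf.memLp (HInf.deriv hv)
  set g : ℝ → ℂ := fun x => v x * star (v x) with hg
  set g' : ℝ → ℂ := fun x => _root_.deriv v x * star (v x) + v x * star (_root_.deriv v x) with hg'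
  have hd : ∀ x, HasDerivAt g (g' x) x := fun x =>
    (HInf.hasDerivAt hv x).mul (HInf.hasDerivAt hv x).star
  have hi : Integrable g := hL.integrable_mul hL.star
  have hi' : Integrable g' := (hL'.integrable_mul hL.star).add (hL.integrable_mul hL'.star)
  have ht := tendsto_zero_of_hasDerivAt_of_integrableOn_Ioi (a := x) (fun y _ => hd y)
    hi'.integrableOn hi.integrableOn
  have hint := integral_Ioi_of_hasDerivAt_of_tendsto (hd x).continuousAt.continuousWithinAt
    (fun y _ => hd y) hi'.integrableOn ht
  have hn : ‖v x‖ ^ 2 = ‖∫ y in Set.Ioi x, g' y‖ := by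
    rw [hint]; simp [hg, sq]
  rw [hn]
  calc ‖∫ y in Set.Ioi x, g' y‖ ≤ ∫ y in Set.Ioi x, ‖g' y‖ := norm_integral_le_integral_norm _
    _ ≤ ∫ y, ‖g' y‖ := setIntegral_le_integral hi'.norm (Eventually.of_forall fun _ => norm_nonneg _)
    _ ≤ ∫ y, 2 * (‖_root_.deriv v y‖ * ‖v y‖) := by
        refine integral_mono hi'.norm ((integrable_norm_mul_norm hL' hL).const_mul 2) fun y => ?_
        refine (norm_add_le _ _).trans_eq ?_
        simp; ring
    _ ≤ 2 * (l2 (_root_.deriv v) * l2 v) := by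
        rw [integral_const_mul]
        gcongr
        exact integral_norm_mul_norm_le hL' hL

/-- The one-dimensional Sobolev embedding. -/
lemma HInf.norm_le {v : ℝ → ℂ} (hv : v ∈ HInf) (x : ℝ) :
    ‖v x‖ ≤ l2 v + l2 (_root_.deriv v) := by
  refine abs_le_of_sq_le_sq' ?_ (add_nonneg (l2_nonneg _) (l2_nonneg _)) |>.2
  have := HInf.norm_sq_le hv x
  nlinarith [sq_nonneg (l2 v), sq_nonneg (l2 (_root_.deriv v))]

lemma memLp_mul_of_bound {a b : ℝ → ℂ} {C : ℝ} (ha : AEStronglyMeasurable a volume)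
    (hC : ∀ x, ‖a x‖ ≤ C) (hb : MemLp b 2) : MemLp (a * b) 2 := by
  refine MemLp.of_le_mul (c := C) hb (ha.mul hb.1) (Eventually.of_forall fun x => ?_)
  rw [Pi.mul_apply, norm_mul]
  gcongr
  exact hC x

lemma l2_mul_le_of_bound {a b : ℝ → ℂ} {C : ℝ} (hC : ∀ x, ‖a x‖ ≤ C) (hb : MemLp b 2) :
    l2 (a * b) ≤ C * l2 b := by
  have hC0 : 0 ≤ C := (norm_nonneg _).trans (hC 0)
  have h := eLpNorm_le_mul_eLpNorm_of_ae_le_mul (f := a * b) (g := b) (c := C)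
    (Eventually.of_forall fun x => by
      rw [Pi.mul_apply, norm_mul]
      gcongr
      exact hC x) 2 (μ := volume)
  have := ENNReal.toReal_mono (ENNReal.mul_ne_top ENNReal.ofReal_ne_top hb.2.ne) h
  rwa [ENNReal.toReal_mul, ENNReal.toReal_ofReal hC0] at this

lemma HInf.aesm {v : ℝ → ℂ} (hv : v ∈ HInf) : AEStronglyMeasurable v volume :=
  hv.1.continuous.aestronglyMeasurable

lemma HInf.add {a b : ℝ → ℂ} (ha : a ∈ HInf) (hb : b ∈ HInf) : a + b ∈ HInf := by
  refine ⟨ha.1.add hb.1, fun k => ?_⟩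
  have : iteratedDeriv k (a + b) = iteratedDeriv k a + iteratedDeriv k b :=
    funext fun x => iteratedDeriv_add (HInf.contDiffAt ha k x) (HInf.contDiffAt hb k x)
  rw [this]
  exact (ha.2 k).add (hb.2 k)

lemma HInf.const_smul {a : ℝ → ℂ} (c : ℂ) (ha : a ∈ HInf) : c • a ∈ HInf := by
  refine ⟨contDiff_const.smul ha.1, fun k => ?_⟩
  have : iteratedDeriv k (c • a) = c • iteratedDeriv k a :=
    funext fun x => iteratedDeriv_const_smul (HInf.contDiffAt ha k x) c
  rw [this]
  exact (ha.2 k).const_smul c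

lemma HInf.deriv_mul {a b : ℝ → ℂ} (ha : a ∈ HInf) (hb : b ∈ HInf) :
    _root_.deriv (a * b) = _root_.deriv a * b + a * _root_.deriv b :=
  funext fun x => ((HInf.hasDerivAt ha x).mul (HInf.hasDerivAt hb x)).deriv

/-- Induction on the order with both factors generalized: the Leibniz rule trades one derivative for
two products of the same kind, and without derivatives one factor is bounded by the Sobolev
embedding. -/
lemma HInf.mul {a b : ℝ → ℂ} (ha : a ∈ HInf) (hb : b ∈ HInf) : a * b ∈ HInf := by
  refine ⟨ha.1.mul hb.1, fun k => ?_⟩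
  induction k generalizing a b with
  | zero => simpa using memLp_mul_of_bound (HInf.aesm ha) (HInf.norm_le ha) (HInf.memLp hb)
  | succ k ih =>
    rw [iteratedDeriv_succ', HInf.deriv_mul ha hb]
    have : iteratedDeriv k (_root_.deriv a * b + a * _root_.deriv b)
        = iteratedDeriv k (_root_.deriv a * b) + iteratedDeriv k (a * _root_.deriv b) :=
      funext fun x => iteratedDeriv_add
        ((HInf.contDiffAt (HInf.deriv ha) k x).mul (HInf.contDiffAt hb k x))
        ((HInf.contDiffAt ha k x).mul (HInf.contDiffAt (HInf.deriv hb) k x))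
    rw [this]
    exact (ih (HInf.deriv ha) hb).add (ih ha (HInf.deriv hb))

lemma deriv_star' (a : ℝ → ℂ) : _root_.deriv (star a) = star (_root_.deriv a) :=
  funext fun _ => deriv.star

lemma HInf.star {a : ℝ → ℂ} (ha : a ∈ HInf) : star a ∈ HInf := by
  refine ⟨Complex.conjCLE.contDiff.comp ha.1, fun k => ?_⟩
  induction k generalizing a with
  | zero => simpa using (HInf.memLp ha).star
  | succ k ih =>
    rw [iteratedDeriv_succ', deriv_star']
    exact ih (HInf.deriv ha)

lemma HInf.zero : (0 : ℝ → ℂ) ∈ HInf :=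
  ⟨contDiff_const, fun k => by
    have : iteratedDeriv k (0 : ℝ → ℂ) = 0 := funext fun x => by simp
    rw [this]
    exact MemLp.zero⟩

/-! ### The algebra `H^∞` and its derivation -/

/-- `H^∞` as a star-subalgebra of the algebra of all functions. -/
def HInfAlg : NonUnitalStarSubalgebra ℂ (ℝ → ℂ) where
  carrier := HInf
  add_mem' := HInf.add
  zero_mem' := HInf.zero
  mul_mem' := HInf.mul
  smul_mem' c _ h := HInf.const_smul c h
  star_mem' := HInf.star

/-- The derivative on `H^∞`. -/
def D : HInfAlg →ₗ[ℂ] HInfAlg where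
  toFun v := ⟨deriv v.1, HInf.deriv v.2⟩
  map_add' a b := Subtype.ext <| funext fun x =>
    ((HInf.hasDerivAt a.2 x).add (HInf.hasDerivAt b.2 x)).deriv
  map_smul' c a := Subtype.ext <| funext fun x => ((HInf.hasDerivAt a.2 x).const_smul c).deriv

@[simp] lemma coe_D (v : HInfAlg) : (D v : ℝ → ℂ) = deriv v := rfl

lemma D_mul (a b : HInfAlg) : D (a * b) = D a * b + a * D b :=
  Subtype.ext (HInf.deriv_mul a.2 b.2)

lemma D_star (a : HInfAlg) : D (star a) = star (D a) := Subtype.ext (deriv_star' a.1)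

lemma D_real_smul (c : ℝ) (a : HInfAlg) : D (c • a) = c • D a := LinearMap.map_smul_of_tower D c a

lemma coe_D_iterate (v : HInfAlg) (k : ℕ) : ((D^[k] v : HInfAlg) : ℝ → ℂ) = iteratedDeriv k v := by
  induction k generalizing v with
  | zero => simp
  | succ k ih => rw [Function.iterate_succ_apply, ih, iteratedDeriv_succ', coe_D]

lemma D_iterate_add (k : ℕ) (a b : HInfAlg) : D^[k] (a + b) = D^[k] a + D^[k] b :=
  iterate_map_add D k a b

lemma D_iterate_smul (k : ℕ) (c : ℂ) (a : HInfAlg) : D^[k] (c • a) = c • D^[k] a := by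
  simp only [← Module.End.pow_apply, map_smul]

lemma D_iterate_star (k : ℕ) (a : HInfAlg) : D^[k] (star a) = star (D^[k] a) := by
  induction k generalizing a with
  | zero => rfl
  | succ k ih => rw [Function.iterate_succ_apply, D_star, ih, Function.iterate_succ_apply]

lemma memLp (v : HInfAlg) : MemLp v.1 2 := HInf.memLp v.2

lemma l2_add_le (a b : HInfAlg) : l2 (a + b : HInfAlg) ≤ l2 a + l2 b := by
  rw [l2, l2, l2, ← ENNReal.toReal_add (memLp a).2.ne (memLp b).2.ne]
  exact ENNReal.toReal_mono (ENNReal.add_ne_top.2 ⟨(memLp a).2.ne, (memLp b).2.ne⟩)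
    (eLpNorm_add_le (memLp a).1 (memLp b).1 (by norm_num))

lemma l2_smul (c : ℂ) (a : HInfAlg) : l2 (c • a : HInfAlg) = ‖c‖ * l2 a := by
  have h : eLpNorm (c • a.1) 2 volume = ‖c‖ₑ * eLpNorm a.1 2 volume :=
    eLpNorm_const_smul c a.1 2 volume
  change (eLpNorm (c • a.1) 2 volume).toReal = _
  rw [h, ENNReal.toReal_mul, l2, toReal_enorm]

lemma l2_star (a : HInfAlg) : l2 (star a : HInfAlg) = l2 a := by
  have h : ∀ x, ‖(star a : HInfAlg).1 x‖ = ‖a.1 x‖ := fun x => norm_star (a.1 x)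
  rw [l2, l2, eLpNorm_congr_norm_ae (Eventually.of_forall h)]

/-! ### Sobolev norms on `H^∞` -/

/-- The real-valued Sobolev norm on `H^∞`. -/
def sob (k : ℕ) (v : HInfAlg) : ℝ := ∑ j ∈ Finset.range (k + 1), l2 (D^[j] v)

lemma sob_nonneg (k : ℕ) (v : HInfAlg) : 0 ≤ sob k v := Finset.sum_nonneg fun _ _ => l2_nonneg _

lemma hNorm_coe (k : ℕ) (v : HInfAlg) : hNorm k v = ENNReal.ofReal (sob k v) := by
  rw [hNorm, sob, ENNReal.ofReal_sum_of_nonneg fun _ _ => l2_nonneg _]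
  refine Finset.sum_congr rfl fun j _ => ?_
  rw [l2, coe_D_iterate, ENNReal.ofReal_toReal (v.2.2 j).2.ne]

lemma sob_add_le (k : ℕ) (a b : HInfAlg) : sob k (a + b) ≤ sob k a + sob k b := by
  rw [sob, sob, sob, ← Finset.sum_add_distrib]
  refine Finset.sum_le_sum fun j _ => ?_
  rw [D_iterate_add]
  exact l2_add_le _ _

lemma sob_smul (k : ℕ) (c : ℂ) (a : HInfAlg) : sob k (c • a) = ‖c‖ * sob k a := by
  rw [sob, sob, Finset.mul_sum]
  refine Finset.sum_congr rfl fun j _ => ?_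
  rw [D_iterate_smul, l2_smul]

lemma sob_real_smul (k : ℕ) (c : ℝ) (a : HInfAlg) : sob k (c • a) = |c| * sob k a := by
  rw [← Complex.coe_smul, sob_smul, Complex.norm_real, Real.norm_eq_abs]

lemma sob_zero (k : ℕ) : sob k 0 = 0 := by
  simpa using sob_smul k 0 0

lemma sob_neg (k : ℕ) (a : HInfAlg) : sob k (-a) = sob k a := by
  simpa using sob_smul k (-1) a

lemma sob_sub_le (k : ℕ) (a b : HInfAlg) : sob k (a - b) ≤ sob k a + sob k b := by
  rw [sub_eq_add_neg, ← sob_neg k b]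
  exact sob_add_le k a (-b)

lemma sob_sub_comm (k : ℕ) (a b : HInfAlg) : sob k (a - b) = sob k (b - a) := by
  rw [← sob_neg, neg_sub]

lemma sob_sum_le {ι : Type*} (k : ℕ) (s : Finset ι) (f : ι → HInfAlg) :
    sob k (∑ i ∈ s, f i) ≤ ∑ i ∈ s, sob k (f i) :=
  Finset.le_sum_of_subadditive _ (sob_zero k).le (sob_add_le k) _ _

lemma sob_star (k : ℕ) (a : HInfAlg) : sob k (star a) = sob k a := by
  refine Finset.sum_congr rfl fun j _ => ?_
  rw [D_iterate_star, l2_star]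

lemma sob_mono {k l : ℕ} (h : k ≤ l) (a : HInfAlg) : sob k a ≤ sob l a :=
  Finset.sum_le_sum_of_subset_of_nonneg (Finset.range_mono (by omega)) fun _ _ _ => l2_nonneg _

lemma l2_D_iterate_le {j k : ℕ} (h : j ≤ k) (a : HInfAlg) : l2 (D^[j] a) ≤ sob k a :=
  Finset.single_le_sum (f := fun j => l2 (D^[j] a)) (fun _ _ => l2_nonneg _)
    (Finset.mem_range.2 (by omega))

lemma sob_D_le (k : ℕ) (a : HInfAlg) : sob k (D a) ≤ sob (k + 1) a := by
  rw [sob, sob, Finset.sum_range_succ' _ (k + 1)]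
  exact le_add_of_nonneg_right (l2_nonneg _)

lemma norm_apply_le (a : HInfAlg) (x : ℝ) : ‖a.1 x‖ ≤ sob 1 a := by
  simpa [sob, Finset.sum_range_succ] using HInf.norm_le a.2 x

lemma norm_D_iterate_apply_le {j k : ℕ} (h : j < k) (a : HInfAlg) (x : ℝ) :
    ‖(D^[j] a).1 x‖ ≤ sob k a := by
  refine (HInf.norm_le (D^[j] a).2 x).trans ?_
  have h1 : deriv (D^[j] a).1 = (D^[j + 1] a).1 := by
    rw [Function.iterate_succ_apply', coe_D]
  rw [h1]
  have : ({j, j + 1} : Finset ℕ) ⊆ Finset.range (k + 1) := by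
    intro i; simp; omega
  refine le_trans (le_of_eq ?_) (Finset.sum_le_sum_of_subset_of_nonneg this
    fun _ _ _ => l2_nonneg _)
  rw [Finset.sum_pair (by omega)]

lemma eq_zero_of_sob_eq_zero {k : ℕ} {a : HInfAlg} (h : sob (k + 1) a = 0) : a = 0 := by
  refine Subtype.ext (funext fun x => norm_le_zero_iff.1 ?_)
  exact (norm_apply_le a x).trans ((sob_mono (by omega) a).trans h.le)

/-- Each Leibniz step keeps the total order `i + j + n` and doubles the number of terms. At the end
`i + j ≤ k` with `k ≥ 1`, so one factor carries fewer than `k` derivatives and is bounded pointwise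
by its `H^k` norm; the other is measured in `L²`. -/
lemma l2_D_iterate_mul_le {k : ℕ} (hk : 1 ≤ k) (a b : HInfAlg) (n i j : ℕ) (h : i + j + n ≤ k) :
    l2 (D^[n] (D^[i] a * D^[j] b)) ≤ 2 ^ n * (sob k a * sob k b) := by
  induction n generalizing i j with
  | zero =>
    simp only [Function.iterate_zero, id, pow_zero, one_mul]
    rcases lt_or_ge i k with hi | hi
    · exact (l2_mul_le_of_bound (norm_D_iterate_apply_le hi a) (memLp _)).trans
        (mul_le_mul_of_nonneg_left (l2_D_iterate_le (by omega) b) (sob_nonneg _ _))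
    · rw [mul_comm, mul_comm (sob k a)]
      exact (l2_mul_le_of_bound (norm_D_iterate_apply_le (by omega) b) (memLp _)).trans
        (mul_le_mul_of_nonneg_left (l2_D_iterate_le (by omega) a) (sob_nonneg _ _))
  | succ n ih =>
    rw [Function.iterate_succ_apply, D_mul, D_iterate_add, ← Function.iterate_succ_apply' D i,
      ← Function.iterate_succ_apply' D j]
    refine (l2_add_le _ _).trans ?_
    rw [pow_succ]
    linarith [ih (i + 1) j (by omega), ih i (j + 1) (by omega)]

/-- `H^k` is an algebra for `k ≥ 1`. -/
lemma sob_mul_le {k : ℕ} (hk : 1 ≤ k) (a b : HInfAlg) :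
    sob k (a * b) ≤ 2 ^ (k + 1) * (sob k a * sob k b) := by
  have h : ∑ n ∈ Finset.range (k + 1), (2 : ℝ) ^ n ≤ 2 ^ (k + 1) := by
    rw [geom_sum_eq (by norm_num)]
    norm_num
  calc sob k (a * b) ≤ ∑ n ∈ Finset.range (k + 1), 2 ^ n * (sob k a * sob k b) :=
        Finset.sum_le_sum fun n hn => by
          have := l2_D_iterate_mul_le hk a b n 0 0 (by have := Finset.mem_range.1 hn; omega)
          simpa using this
    _ ≤ _ := by
        rw [← Finset.sum_mul]
        exact mul_le_mul_of_nonneg_right h (mul_nonneg (sob_nonneg _ _) (sob_nonneg _ _))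

/-! ### Integration by parts and Schwartz functions -/

lemma integrable_mul (a b : HInfAlg) : Integrable fun x => a.1 x * b.1 x :=
  (memLp a).integrable_mul (memLp b)

lemma integral_mul_D (a b : HInfAlg) : ∫ x, a.1 x * (D b).1 x = -∫ x, (D a).1 x * b.1 x :=
  integral_mul_deriv_eq_deriv_mul_of_integrable (fun x _ => HInf.hasDerivAt a.2 x)
    (fun x _ => HInf.hasDerivAt b.2 x) (integrable_mul a (D b)) (integrable_mul (D a) b)
    (integrable_mul a b)

lemma integral_mul_D_iterate (k : ℕ) (a b : HInfAlg) :
    ∫ x, a.1 x * (D^[k] b).1 x = (-1) ^ k * ∫ x, (D^[k] a).1 x * b.1 x := by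
  induction k generalizing a with
  | zero => simp
  | succ k ih =>
    rw [Function.iterate_succ_apply' D k b, integral_mul_D, ih, Function.iterate_succ_apply, pow_succ]
    ring

lemma norm_integral_mul_le (a b : HInfAlg) : ‖∫ x, a.1 x * b.1 x‖ ≤ l2 a * l2 b := by
  refine (norm_integral_le_integral_norm _).trans ?_
  simpa using integral_norm_mul_norm_le (memLp a) (memLp b)

/-- Schwartz functions lie in `H^∞`. -/
lemma schwartz_mem (φ : SchwartzMap ℝ ℂ) : (φ : ℝ → ℂ) ∈ HInf := by
  refine ⟨φ.smooth', fun k => ?_⟩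
  induction k generalizing φ with
  | zero => simpa using φ.memLp 2
  | succ k ih =>
    rw [iteratedDeriv_succ']
    exact ih (SchwartzMap.derivCLM ℂ ℂ φ)

/-- A Schwartz function as an element of `H^∞`. -/
def ofSchwartz (φ : SchwartzMap ℝ ℂ) : HInfAlg := ⟨φ, schwartz_mem φ⟩

/-! ### The Fourier transform on `H^∞` -/

section Fourier

open FourierTransform SchwartzMap

/-- Square integrable functions with the same pairings with Schwartz functions coincide. -/
lemma ae_eq_of_forall_schwartz {f g : ℝ → ℂ} (hf : LocallyIntegrable f) (hg : LocallyIntegrable g)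
    (h : ∀ φ : SchwartzMap ℝ ℂ, ∫ x, φ x * f x = ∫ x, φ x * g x) : f =ᵐ[volume] g := by
  refine ae_eq_of_integral_contDiff_smul_eq hf hg fun φ hφ hφc => ?_
  have h1 : HasCompactSupport (Complex.ofRealCLM ∘ φ) := hφc.comp_left rfl
  have h2 : ContDiff ℝ ∞ (Complex.ofRealCLM ∘ φ) := Complex.ofRealCLM.contDiff.comp hφ
  simpa using h (h1.toSchwartzMap h2)

/-- The `L²` transform agrees with that of tempered distributions, which is defined by this duality.
-/
lemma integral_fourierInv_mul (U : Lp ℂ 2 (volume : Measure ℝ)) (φ : SchwartzMap ℝ ℂ) :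
    ∫ x, φ x * (𝓕⁻ U : Lp ℂ 2 (volume : Measure ℝ)) x = ∫ x, (𝓕⁻ φ) x * U x := by
  have := congrArg (fun F => F φ) (Lp.fourierInv_toTemperedDistribution_eq U)
  simpa [TemperedDistribution.fourierInv_apply] using this.symm

lemma integral_fourier_mul (U : Lp ℂ 2 (volume : Measure ℝ)) (φ : SchwartzMap ℝ ℂ) :
    ∫ x, φ x * (𝓕 U : Lp ℂ 2 (volume : Measure ℝ)) x = ∫ x, (𝓕 φ) x * U x := by
  have := congrArg (fun F => F φ) (Lp.fourier_toTemperedDistribution_eq U)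
  simpa [TemperedDistribution.fourier_apply] using this.symm

/-- The frequency side of an element of `H^∞`: its inverse Fourier transform. -/
def hat : HInfAlg →ₗ[ℂ] Lp ℂ 2 (volume : Measure ℝ) where
  toFun v := 𝓕⁻ ((memLp v).toLp v.1)
  map_add' a b := by
    rw [← fourierInv_add]
    rfl
  map_smul' c a := by
    rw [RingHom.id_apply, ← fourierInv_smul]
    rfl

lemma norm_hat (v : HInfAlg) : ‖hat v‖ = l2 v := by
  have : ‖hat v‖ = ‖(memLp v).toLp v.1‖ :=
    (Lp.fourierTransformₗᵢ ℝ ℂ).symm.norm_map ((memLp v).toLp v.1)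
  rw [this, Lp.norm_toLp]
  rfl

lemma hat_injective : Function.Injective hat := by
  intro a b h
  have h1 := (Lp.fourierTransformₗᵢ ℝ ℂ).symm.injective h
  have h2 : a.1 =ᵐ[volume] b.1 := (MemLp.toLp_eq_toLp_iff _ _).1 h1
  exact Subtype.ext ((Continuous.ae_eq_iff_eq volume a.2.1.continuous b.2.1.continuous).1 h2)

/-- The symbol of the derivative. -/
def symb (ξ : ℝ) : ℂ := -(2 * Real.pi * Complex.I) * ξ

lemma continuous_symb : Continuous symb := by unfold symb; fun_prop

lemma locallyIntegrable_symb_mul {w : ℝ → ℂ} (hw : MemLp w 2) :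
    LocallyIntegrable fun ξ => symb ξ * w ξ :=
  (hw.locallyIntegrable (by norm_num)).continuous_mul continuous_symb 

/-- Proved by testing against `φ`: the transform moves onto `φ`, the derivative follows by parts,
differentiating `𝓕⁻ φ` multiplies `φ` by `-symb`, and the transform moves back. The two minus signs
cancel. -/
lemma hat_D (v : HInfAlg) : hat (D v) =ᵐ[volume] fun ξ => symb ξ * hat v ξ := by
  refine ae_eq_of_forall_schwartz ((Lp.memLp (hat (D v))).locallyIntegrable (by norm_num))
    (locallyIntegrable_symb_mul (Lp.memLp (hat v))) fun φ => ?_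
  have hL : ∫ x, φ x * hat (D v) x = ∫ x, (𝓕⁻ φ) x * (D v).1 x := by
    refine (integral_fourierInv_mul _ φ).trans (integral_congr_ae ?_)
    filter_upwards [(memLp (D v)).coeFn_toLp] with x hx
    rw [hx]
  have hg : (inner ℝ · (1 : ℝ) : ℝ → ℝ).HasTemperateGrowth := by fun_prop
  set ψ : SchwartzMap ℝ ℂ := (2 * Real.pi * Complex.I) • smulLeftCLM ℂ (inner ℝ · (1 : ℝ)) φ with hψ
  have hψx : ∀ x, ψ x = -symb x * φ x := fun x => by
    rw [hψ, _root_.smul_apply, smulLeftCLM_apply_apply hg]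
    simp [symb, mul_assoc]
  have hd : ∀ x, deriv (𝓕⁻ φ : SchwartzMap ℝ ℂ) x = (𝓕⁻ ψ) x := fun x => by
    have := congrArg (fun F : SchwartzMap ℝ ℂ => F x) (lineDerivOp_fourierInv_eq φ (1 : ℝ))
    rwa [lineDerivOp_apply_eq_fderiv, fderiv_apply_one_eq_deriv] at this
  have h1 : ∫ x, (𝓕⁻ φ) x * (D v).1 x = -∫ x, (𝓕⁻ ψ) x * v.1 x := by
    rw [← funext hd]
    exact integral_mul_D (ofSchwartz (𝓕⁻ φ)) v
  have h2 : ∫ x, (𝓕⁻ ψ) x * v.1 x = ∫ x, ψ x * hat v x := by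
    refine ((integral_fourierInv_mul _ ψ).trans (integral_congr_ae ?_)).symm
    filter_upwards [(memLp v).coeFn_toLp] with x hx
    rw [hx]
  rw [hL, h1, h2, ← integral_neg]
  congr 1 with x
  rw [hψx]
  ring

lemma hat_D_iterate (n : ℕ) (v : HInfAlg) :
    hat (D^[n] v) =ᵐ[volume] fun ξ => symb ξ ^ n * hat v ξ := by
  induction n with
  | zero => simp
  | succ n ih =>
    rw [Function.iterate_succ_apply']
    filter_upwards [hat_D (D^[n] v), ih] with ξ h1 h2
    rw [h1, h2, pow_succ]
    ring

/-- The Fourier integral of an integrable, square integrable function represents its `L²` Fourier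
transform. -/
lemma fourier_toLp_ae_eq {w : ℝ → ℂ} (h1 : Integrable w) (h2 : MemLp w 2) :
    (𝓕 (h2.toLp w) : Lp ℂ 2 (volume : Measure ℝ)) =ᵐ[volume] 𝓕 w := by
  have hc : Continuous (𝓕 w) := VectorFourier.fourierIntegral_continuous
    Real.continuous_fourierChar (L := innerₗ ℝ) continuous_inner h1
  refine ae_eq_of_forall_schwartz ((Lp.memLp _).locallyIntegrable (by norm_num))
    hc.locallyIntegrable fun φ => ?_
  rw [integral_fourier_mul]
  have := VectorFourier.integral_bilin_fourierIntegral_eq_flip (.mul ℂ ℂ) (L := innerₗ ℝ)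
    Real.continuous_fourierChar continuous_inner (φ.integrable (μ := volume)) h1
  rw [flip_innerₗ] at this
  refine (integral_congr_ae ?_).trans this
  filter_upwards [h2.coeFn_toLp] with x hx
  rw [hx]
  rfl

lemma memLp_inv_one_add_sq : MemLp (fun ξ : ℝ => ((1 + ξ ^ 2)⁻¹ : ℝ)) 2 := by
  have hc : Continuous fun ξ : ℝ => ((1 + ξ ^ 2)⁻¹ : ℝ) :=
    Continuous.inv₀ (by fun_prop) fun x => by positivity
  rw [memLp_two_iff_integrable_sq hc.aestronglyMeasurable]
  refine integrable_inv_one_add_sq.mono' (hc.pow 2).aestronglyMeasurable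
    (Eventually.of_forall fun x => ?_)
  rw [Real.norm_of_nonneg (by positivity), sq]
  have : (1 + x ^ 2)⁻¹ ≤ 1 := inv_le_one_of_one_le₀ (by nlinarith [sq_nonneg x])
  exact mul_le_of_le_one_left (by positivity) this

/-- Cauchy-Schwarz for `w = (1 + ξ²)⁻¹ · (1 + ξ²) w`; since `4π² ≥ 1`, the second factor is
dominated by `|w| + |symb² w|`. -/
lemma integrable_of_memLp_sq_mul {w : ℝ → ℂ} (h0 : MemLp w 2)
    (h2 : MemLp (fun ξ => symb ξ ^ 2 * w ξ) 2) : Integrable w := by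
  have h3 : MemLp (fun ξ : ℝ => ‖w ξ‖ + ‖symb ξ ^ 2 * w ξ‖) 2 := h0.norm.add h2.norm
  refine (memLp_inv_one_add_sq.integrable_mul h3).mono' h0.1 (Eventually.of_forall fun ξ => ?_)
  have hs : ‖symb ξ‖ ^ 2 = 4 * Real.pi ^ 2 * ξ ^ 2 := by
    have : ‖symb ξ‖ = 2 * Real.pi * |ξ| := by simp [symb, abs_of_pos Real.pi_pos]
    rw [this, mul_pow, sq_abs]
    ring
  have hpi : 1 ≤ 4 * Real.pi ^ 2 := by nlinarith [Real.pi_gt_three]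
  simp only [Pi.mul_apply, norm_mul, norm_pow, hs]
  rw [← div_eq_inv_mul, le_div_iff₀ (by positivity)]
  have := mul_nonneg (mul_nonneg (sub_nonneg.2 hpi) (sq_nonneg ξ)) (norm_nonneg (w ξ))
  nlinarith

/-- Any measurable function dominated by the frequency side of an element of `H^∞` is the frequency
side of an element of `H^∞`. -/
lemma exists_hat_eq {w : ℝ → ℂ} (hw : AEStronglyMeasurable w volume) (v : HInfAlg) (C : ℝ)
    (h : ∀ᵐ ξ, ‖w ξ‖ ≤ C * ‖hat v ξ‖) : ∃ z : HInfAlg, hat z =ᵐ[volume] w := by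
  have hL : ∀ n : ℕ, MemLp (fun ξ => symb ξ ^ n * w ξ) 2 := fun n => by
    refine (Lp.memLp (hat (D^[n] v))).of_le_mul (c := C)
      ((continuous_symb.pow n).aestronglyMeasurable.mul hw) ?_
    filter_upwards [h, hat_D_iterate n v] with ξ h1 h2
    rw [h2, norm_mul, norm_mul]
    calc _ ≤ ‖symb ξ ^ n‖ * (C * ‖hat v ξ‖) := by gcongr
      _ = _ := by ring
  have h0 : MemLp w 2 := by simpa using hL 0
  -- Two more powers of the symbol in `L²` buy integrability. All moments of `w` being integrable,
  -- its Fourier integral is smooth, and its derivatives are the transforms of `symb ^ n * w`, which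
  -- lie in `L²`. This is why `hat` is the inverse transform: the preimage is an ordinary Fourier
  -- integral.
  have hI : ∀ n : ℕ, Integrable fun ξ => symb ξ ^ n * w ξ := fun n => by
    refine integrable_of_memLp_sq_mul (hL n) ?_
    have h2 : (fun ξ => symb ξ ^ 2 * (symb ξ ^ n * w ξ)) = fun ξ => symb ξ ^ (n + 2) * w ξ := by
      ext ξ; ring
    rw [h2]
    exact hL (n + 2)
  have hI' : ∀ n : ℕ, Integrable fun ξ : ℝ => ξ ^ n • w ξ := fun n => by
    have := (hI n).const_mul ((-(2 * Real.pi * Complex.I)) ^ n)⁻¹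
    refine this.congr (Eventually.of_forall fun ξ => ?_)
    have hne : (-(2 * (Real.pi : ℂ) * Complex.I)) ^ n ≠ 0 := pow_ne_zero _ (by
      simp [Real.pi_ne_zero])
    simp only [symb, mul_pow, Complex.real_smul, Complex.ofReal_pow]
    field_simp
  have hd : ∀ n : ℕ, iteratedDeriv n (𝓕 w) = 𝓕 (fun ξ => symb ξ ^ n * w ξ) := fun n => by
    rw [Real.iteratedDeriv_fourier (N := ⊤) (fun m _ => hI' m) le_top]
    simp [symb, mul_assoc]
  have hmem : (𝓕 w) ∈ HInf := by
    refine ⟨Real.contDiff_fourier (N := ⊤) fun n _ => ?_, fun n => ?_⟩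
    · simpa [norm_smul] using (hI' n).norm
    · rw [hd n]
      exact (Lp.memLp _).ae_eq (fourier_toLp_ae_eq (hI n) (hL n))
  refine ⟨⟨𝓕 w, hmem⟩, ?_⟩
  have : (memLp ⟨𝓕 w, hmem⟩).toLp (𝓕 w) = 𝓕 (h0.toLp w) := by
    refine Lp.ext ((MemLp.coeFn_toLp _).trans (fourier_toLp_ae_eq (by simpa using hI 0) h0).symm)
  have h2 : hat ⟨𝓕 w, hmem⟩ = h0.toLp w := by
    change 𝓕⁻ ((memLp ⟨𝓕 w, hmem⟩).toLp (𝓕 w)) = _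
    rw [this, fourierInv_fourier_eq]
  rw [h2]
  exact h0.coeFn_toLp

lemma hat_add (a b : HInfAlg) : hat (a + b) =ᵐ[volume] fun ξ => hat a ξ + hat b ξ := by
  rw [map_add]; exact Lp.coeFn_add _ _

lemma hat_sub (a b : HInfAlg) : hat (a - b) =ᵐ[volume] fun ξ => hat a ξ - hat b ξ := by
  rw [map_sub]; exact Lp.coeFn_sub _ _

lemma hat_smul (c : ℂ) (a : HInfAlg) : hat (c • a) =ᵐ[volume] fun ξ => c * hat a ξ := by
  rw [map_smul]; exact Lp.coeFn_smul _ _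

lemma hat_real_smul (c : ℝ) (a : HInfAlg) : hat (c • a) =ᵐ[volume] fun ξ => c * hat a ξ := by
  rw [← Complex.coe_smul]; exact hat_smul _ _

lemma coeFn_finset_sum {ι E : Type*} [NormedAddCommGroup E] (s : Finset ι)
    (F : ι → Lp E 2 (volume : Measure ℝ)) :
    (∑ i ∈ s, F i : Lp E 2 (volume : Measure ℝ)) =ᵐ[volume] fun ξ => ∑ i ∈ s, F i ξ := by
  classical
  induction s using Finset.induction_on with
  | empty =>
    simp only [Finset.sum_empty]
    exact Lp.coeFn_zero E 2 (volume : Measure ℝ)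
  | insert a s ha ih =>
    rw [Finset.sum_insert ha]
    filter_upwards [Lp.coeFn_add (F a) (∑ i ∈ s, F i), ih] with ξ h1 h2
    rw [h1, Pi.add_apply, h2, Finset.sum_insert ha]

lemma hat_sum {ι : Type*} (s : Finset ι) (f : ι → HInfAlg) :
    hat (∑ i ∈ s, f i) =ᵐ[volume] fun ξ => ∑ i ∈ s, hat (f i) ξ := by
  rw [map_sum]
  exact coeFn_finset_sum s _

/-- The triangle inequality in real `L²`, applied to the moduli of the transforms, followed by
Plancherel. -/
lemma l2_le_of_hat_le {ι : Type*} (s : Finset ι) (c : ι → ℝ) (hc : ∀ i ∈ s, 0 ≤ c i)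
    (v : ι → HInfAlg) (w : HInfAlg) (h : ∀ᵐ ξ, ‖hat w ξ‖ ≤ ∑ i ∈ s, c i * ‖hat (v i) ξ‖) :
    l2 w ≤ ∑ i ∈ s, c i * l2 (v i) := by
  have hm : ∀ i, MemLp (fun ξ => ‖hat (v i) ξ‖) 2 := fun i => (Lp.memLp (hat (v i))).norm
  set F : ι → Lp ℝ 2 (volume : Measure ℝ) := fun i => c i • (hm i).toLp _ with hF
  have h1 : ‖hat w‖ ≤ ‖∑ i ∈ s, F i‖ := by
    refine Lp.norm_le_norm_of_ae_le ?_
    have hs : ∀ᵐ ξ, (∑ i ∈ s, F i) ξ = ∑ i ∈ s, c i * ‖hat (v i) ξ‖ := by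
      have h2 : ∀ᵐ ξ, ∀ i ∈ s, F i ξ = c i * ‖hat (v i) ξ‖ := by
        rw [Filter.eventually_all_finset]
        intro i _
        filter_upwards [Lp.coeFn_smul (c i) ((hm i).toLp _), (hm i).coeFn_toLp] with ξ h3 h4
        rw [hF, h3, Pi.smul_apply, h4, smul_eq_mul]
      filter_upwards [h2, coeFn_finset_sum s F] with ξ h3 h4
      rw [h4]
      exact Finset.sum_congr rfl h3
    filter_upwards [h, hs] with ξ h3 h4
    rw [h4]
    exact h3.trans (le_abs_self _)
  rw [← norm_hat]
  refine h1.trans ((norm_sum_le _ _).trans (Finset.sum_le_sum fun i hi => ?_))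
  rw [hF, norm_smul, Real.norm_of_nonneg (hc i hi), Lp.norm_toLp, ← norm_hat, Lp.norm_def,
    eLpNorm_norm]

/-- Pointwise domination on the frequency side gives domination of the Sobolev norms. -/
lemma sob_le_of_hat_le {ι : Type*} (s : Finset ι) (c : ι → ℝ) (hc : ∀ i ∈ s, 0 ≤ c i)
    (v : ι → HInfAlg) (w : HInfAlg) (h : ∀ᵐ ξ, ‖hat w ξ‖ ≤ ∑ i ∈ s, c i * ‖hat (v i) ξ‖) (k : ℕ) :
    sob k w ≤ ∑ i ∈ s, c i * sob k (v i) := by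
  -- The domination survives multiplication by `|symb ξ| ^ j`, so it passes to all derivatives with
  -- the same constants.
  have h1 : ∀ j, l2 (D^[j] w) ≤ ∑ i ∈ s, c i * l2 (D^[j] (v i)) := fun j => by
    refine l2_le_of_hat_le s c hc (fun i => D^[j] (v i)) _ ?_
    have h2 : ∀ᵐ ξ, ∀ i ∈ s, hat (D^[j] (v i)) ξ = symb ξ ^ j * hat (v i) ξ := by
      rw [Filter.eventually_all_finset]
      exact fun i _ => hat_D_iterate j (v i)
    filter_upwards [h, h2, hat_D_iterate j w] with ξ h3 h4 h5
    rw [h5, norm_mul]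
    calc _ ≤ ‖symb ξ ^ j‖ * ∑ i ∈ s, c i * ‖hat (v i) ξ‖ := by gcongr
      _ = _ := by
        rw [Finset.mul_sum]
        refine Finset.sum_congr rfl fun i hi => ?_
        rw [h4 i hi, norm_mul]
        ring
  calc sob k w ≤ ∑ j ∈ Finset.range (k + 1), ∑ i ∈ s, c i * l2 (D^[j] (v i)) :=
        Finset.sum_le_sum fun j _ => h1 j
    _ = _ := by
        rw [Finset.sum_comm]
        exact Finset.sum_congr rfl fun i _ => by rw [sob, Finset.mul_sum]

lemma sob_le_of_hat_le_one (v w : HInfAlg) (h : ∀ᵐ ξ, ‖hat w ξ‖ ≤ ‖hat v ξ‖) (k : ℕ) :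
    sob k w ≤ sob k v := by
  simpa using sob_le_of_hat_le {()} (fun _ => 1) (by simp) (fun _ => v) w (by simpa using h) k

lemma hat_ext {a b : HInfAlg} (h : hat a =ᵐ[volume] hat b) : a = b := hat_injective (Lp.ext h)

/-! ### Resolvents of the second derivative -/

lemma symb_sq (ξ : ℝ) : symb ξ ^ 2 = ((-(4 * Real.pi ^ 2 * ξ ^ 2) : ℝ) : ℂ) := by
  simp only [symb, mul_pow, neg_sq, Complex.I_sq]
  push_cast
  ring

lemma hat_D_D (v : HInfAlg) :
    hat (D (D v)) =ᵐ[volume] fun ξ => ((-(4 * Real.pi ^ 2 * ξ ^ 2) : ℝ) : ℂ) * hat v ξ := by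
  have := hat_D_iterate 2 v
  simpa only [Function.iterate_succ_apply, Function.iterate_zero, id, symb_sq] using this

/-- For `Re β ≥ 0` the operator `1 - β ∂ₓ²` is bounded below. -/
lemma hat_sub_smul_D_D (β : ℂ) (v : HInfAlg) : hat (v - β • D (D v)) =ᵐ[volume]
    fun ξ => (1 + β * ((4 * Real.pi ^ 2 * ξ ^ 2 : ℝ) : ℂ)) * hat v ξ := by
  filter_upwards [hat_sub v (β • D (D v)), hat_smul β (D (D v)), hat_D_D v] with ξ h1 h2 h3
  rw [h1, h2, h3]
  push_cast
  ring

/-- The real part alone is at least one. The bound does not depend on `β`, which later gives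
estimates uniform in `τ`. -/
lemma one_le_norm_one_add {β : ℂ} (hβ : 0 ≤ β.re) (ξ : ℝ) :
    1 ≤ ‖1 + β * ((4 * Real.pi ^ 2 * ξ ^ 2 : ℝ) : ℂ)‖ := by
  refine le_trans ?_ (Complex.re_le_norm _)
  simp only [Complex.add_re, Complex.one_re, Complex.re_mul_ofReal]
  have : 0 ≤ β.re * (4 * Real.pi ^ 2 * ξ ^ 2) := by positivity
  linarith

lemma sob_le_sob_sub_smul_D_D {β : ℂ} (hβ : 0 ≤ β.re) (v : HInfAlg) (k : ℕ) :
    sob k v ≤ sob k (v - β • D (D v)) := by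
  refine sob_le_of_hat_le_one _ _ ?_ k
  filter_upwards [hat_sub_smul_D_D β v] with ξ h
  rw [h, norm_mul]
  exact le_mul_of_one_le_left (norm_nonneg _) (one_le_norm_one_add hβ ξ)

/-- For `Re β ≥ 0` the operator `1 - β ∂ₓ²` is onto. -/
lemma exists_sub_smul_D_D_eq {β : ℂ} (hβ : 0 ≤ β.re) (r : HInfAlg) :
    ∃ v : HInfAlg, v - β • D (D v) = r := by
  have hne : ∀ ξ : ℝ, 1 + β * ((4 * Real.pi ^ 2 * ξ ^ 2 : ℝ) : ℂ) ≠ 0 := fun ξ h => by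
    have := one_le_norm_one_add hβ ξ
    rw [h, norm_zero] at this
    linarith
  obtain ⟨v, hv⟩ := exists_hat_eq
    (w := fun ξ => (1 + β * ((4 * Real.pi ^ 2 * ξ ^ 2 : ℝ) : ℂ))⁻¹ * hat r ξ)
    (AEStronglyMeasurable.mul (Continuous.aestronglyMeasurable
      (Continuous.inv₀ (by fun_prop) hne)) (Lp.aestronglyMeasurable _)) r 1
    (Eventually.of_forall fun ξ => by
      rw [norm_mul, norm_inv]
      gcongr
      exact inv_le_one_of_one_le₀ (one_le_norm_one_add hβ ξ))
  refine ⟨v, hat_ext ?_⟩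
  filter_upwards [hat_sub_smul_D_D β v, hv] with ξ h1 h2
  rw [h1, h2, mul_inv_cancel_left₀ (hne ξ)]

lemma eq_zero_of_sub_smul_D_D_eq_zero {β : ℂ} (hβ : 0 ≤ β.re) {v : HInfAlg}
    (h : v - β • D (D v) = 0) : v = 0 := by
  refine eq_zero_of_sob_eq_zero (k := 0) (le_antisymm ?_ (sob_nonneg _ _))
  simpa [h, sob_zero] using sob_le_sob_sub_smul_D_D hβ v (0 + 1)

end Fourier

/-! ### Order conditions for cubic equations in arbitrary vector spaces -/

section Order

variable {s : ℕ} {M : ImExMethod s}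

lemma ImExMethod.IsStep.map {E F : Type*} [AddCommGroup E] [Module ℝ E] [AddCommGroup F]
    [Module ℝ F] (φ : E →ₗ[ℝ] F) {f g : E → E} {f' g' : F → F} (hf : ∀ v, φ (f v) = f' (φ v))
    (hg : ∀ v, φ (g v) = g' (φ v)) {h : ℝ} {y : E} {Y : Fin s → E} {y' : E}
    (H : M.IsStep f g h y Y y') : M.IsStep f' g' h (φ y) (fun i => φ (Y i)) (φ y') := by
  refine ⟨fun i => ?_, ?_⟩
  · refine (congrArg φ (H.1 i)).trans ?_
    simp only [map_add, map_smul, map_sum, hf, hg]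
  · rw [H.2]
    simp only [map_add, map_smul, map_sum, hf, hg]

lemma ImExMethod.IsStep.of_map {E F : Type*} [AddCommGroup E] [Module ℝ E] [AddCommGroup F]
    [Module ℝ F] (φ : E →ₗ[ℝ] F) (hφ : Function.Injective φ) {f g : E → E} {f' g' : F → F}
    (hf : ∀ v, φ (f v) = f' (φ v)) (hg : ∀ v, φ (g v) = g' (φ v)) {h : ℝ} {y : E} {Y : Fin s → E}
    {y' : E} (H : M.IsStep f' g' h (φ y) (fun i => φ (Y i)) (φ y')) : M.IsStep f g h y Y y' := by
  refine ⟨fun i => hφ ?_, hφ ?_⟩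
  · refine (H.1 i).trans ?_
    simp only [map_add, map_smul, map_sum, hf, hg]
  · refine H.2.trans ?_
    simp only [map_add, map_smul, map_sum, hf, hg]

/-- The order of a method may be tested in any finite-dimensional normed space. -/
lemma ImExMethod.HasOrder.isBigO {p : ℕ} (hM : M.HasOrder p) {V : Type*} [NormedAddCommGroup V]
    [NormedSpace ℝ V] [FiniteDimensional ℝ V] {f g : V → V} (hf : ContDiff ℝ ∞ f)
    (hg : ContDiff ℝ ∞ g) {y : ℝ → V} (hy : ∀ t, HasDerivAt y (f (y t) + g (y t)) t)
    {Y : ℝ → Fin s → V} {y₁ : ℝ → V} (hY : ∀ i, Tendsto (fun h => Y h i) (𝓝[>] 0) (𝓝 (y 0)))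
    (hs : ∀ h, M.IsStep f g h (y 0) (Y h) (y₁ h)) :
    (fun h => y₁ h - y h) =O[𝓝[>] 0] fun h : ℝ => h ^ (p + 1) := by
  set e := toEuclidean (E := V) with he
  have h1 : (fun h => e (y₁ h) - e (y h)) =O[𝓝[>] 0] fun h : ℝ => h ^ (p + 1) := by
    refine hM _ (fun v => e (f (e.symm v))) (fun v => e (g (e.symm v)))
      (e.contDiff.comp (hf.comp e.symm.contDiff)) (e.contDiff.comp (hg.comp e.symm.contDiff))
      (fun t => e (y t)) (Eventually.of_forall fun t => ?_) (fun h i => e (Y h i))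
      (fun h => e (y₁ h)) (fun i => (e.continuous.tendsto _).comp (hY i))
      (Eventually.of_forall fun h => ?_)
    · have := e.toContinuousLinearMap.hasFDerivAt.comp_hasDerivAt t (hy t)
      simp only [ContinuousLinearEquiv.symm_apply_apply, ← map_add]
      exact this
    · exact (hs h).map e.toLinearEquiv.toLinearMap (fun v => by simp) (fun v => by simp)
  have h2 := (e.symm : _ →L[ℝ] V).isBigO_comp (fun h => e (y₁ h) - e (y h)) (𝓝[>] (0 : ℝ))
  refine (h2.trans h1).congr_left fun h => ?_
  simp

variable {p : ℕ} {E : Type*} [AddCommGroup E] [Module ℝ E]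

/-- Coefficients of the cubic term of a power series, multiplied by the expansion variable. -/
def gradedExplicit (T : E →ₗ[ℝ] E →ₗ[ℝ] E →ₗ[ℝ] E) (v : Fin (p + 1) → E) : Fin (p + 1) → E :=
  fun n => ∑ x : Fin (p + 1) × Fin (p + 1) × Fin (p + 1),
    if (x.1 : ℕ) + x.2.1 + x.2.2 + 1 = n then T (v x.1) (v x.2.1) (v x.2.2) else 0

/-- Coefficients of the linear term of a power series, multiplied by the expansion variable. -/
def gradedImplicit (L : E →ₗ[ℝ] E) (v : Fin (p + 1) → E) : Fin (p + 1) → E :=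
  fun n => ∑ a : Fin (p + 1), if (a : ℕ) + 1 = n then L (v a) else 0

/-- Substitution of `h` times the variable in a power series. -/
def gradedScale (h : ℝ) : (Fin (p + 1) → E) →ₗ[ℝ] (Fin (p + 1) → E) where
  toFun v n := h ^ (n : ℕ) • v n
  map_add' _ _ := funext fun _ => smul_add _ _ _
  map_smul' _ _ := funext fun _ => smul_comm _ _ _

lemma gradedScale_apply (h : ℝ) (v : Fin (p + 1) → E) (n : Fin (p + 1)) :
    gradedScale h v n = h ^ (n : ℕ) • v n := rfl

/-- The extra factor of the expansion variable in the graded field yields exactly one factor `h`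
under rescaling. A graded step of size one thereby becomes a step of size `h`. -/
lemma gradedScale_explicit (T : E →ₗ[ℝ] E →ₗ[ℝ] E →ₗ[ℝ] E) (h : ℝ) (v : Fin (p + 1) → E) :
    gradedScale h (gradedExplicit T v) = h • gradedExplicit T (gradedScale h v) := by
  ext n
  simp only [gradedScale_apply, gradedExplicit, Pi.smul_apply, Finset.smul_sum]
  refine Finset.sum_congr rfl fun x _ => ?_
  split_ifs with hx
  · simp only [map_smul, LinearMap.smul_apply, smul_smul, ← hx]
    congr 1
    ring
  · simp

lemma gradedScale_implicit (L : E →ₗ[ℝ] E) (h : ℝ) (v : Fin (p + 1) → E) :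
    gradedScale h (gradedImplicit L v) = h • gradedImplicit L (gradedScale h v) := by
  ext n
  simp only [gradedScale_apply, gradedImplicit, Pi.smul_apply, Finset.smul_sum]
  refine Finset.sum_congr rfl fun x _ => ?_
  split_ifs with hx
  · simp only [map_smul, smul_smul, ← hx]
    congr 1
    ring
  · simp

lemma gradedScale_single (h : ℝ) (y : E) :
    gradedScale h (Pi.single (0 : Fin (p + 1)) y) = Pi.single 0 y := by
  ext n
  rw [gradedScale_apply]
  by_cases hn : n = 0
  · subst hn; simp
  · simp [hn]

lemma isStep_gradedScale {T : E →ₗ[ℝ] E →ₗ[ℝ] E →ₗ[ℝ] E} {L : E →ₗ[ℝ] E} {y : E}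
    {Y : Fin s → Fin (p + 1) → E} {c : Fin (p + 1) → E}
    (H : M.IsStep (gradedExplicit T) (gradedImplicit L) 1 (Pi.single 0 y) Y c) (h : ℝ) :
    M.IsStep (gradedExplicit T) (gradedImplicit L) h (Pi.single 0 y)
      (fun i => gradedScale h (Y i)) (gradedScale h c) := by
  refine ⟨fun i => ?_, ?_⟩
  · refine (congrArg (gradedScale h) (H.1 i)).trans ?_
    simp only [map_add, map_smul, map_sum, gradedScale_single, gradedScale_explicit,
      gradedScale_implicit, one_smul, smul_add, Finset.smul_sum, smul_comm h]
  · rw [H.2]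
    simp only [map_add, map_smul, map_sum, gradedScale_single, gradedScale_explicit,
      gradedScale_implicit, one_smul, smul_add, Finset.smul_sum, smul_comm h]

lemma gradedExplicit_zero (T : E →ₗ[ℝ] E →ₗ[ℝ] E →ₗ[ℝ] E) (v : Fin (p + 1) → E) :
    gradedExplicit T v 0 = 0 := by simp [gradedExplicit]

lemma gradedImplicit_zero (L : E →ₗ[ℝ] E) (v : Fin (p + 1) → E) :
    gradedImplicit L v 0 = 0 := by simp [gradedImplicit]

/-- In the standard basis the map is a polynomial in the coordinates of its three arguments. -/
lemma contDiff_trilinear {ι : Type*} [Fintype ι] {V : Type*} [NormedAddCommGroup V]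
    [NormedSpace ℝ V] (T : (ι → ℝ) →ₗ[ℝ] (ι → ℝ) →ₗ[ℝ] (ι → ℝ) →ₗ[ℝ] (ι → ℝ))
    {a b c : V → ι → ℝ} (ha : ContDiff ℝ ∞ a) (hb : ContDiff ℝ ∞ b) (hc : ContDiff ℝ ∞ c) :
    ContDiff ℝ ∞ fun v => T (a v) (b v) (c v) := by
  classical
  have h : (fun v => T (a v) (b v) (c v)) = fun v => ∑ i, ∑ j, ∑ k, (a v i * (b v j * c v k)) •
      T (fun l => if i = l then 1 else 0) (fun l => if j = l then 1 else 0)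
        (fun l => if k = l then 1 else 0) := by
    ext1 v
    rw [LinearMap.pi_apply_eq_sum_univ T (a v), LinearMap.sum_apply, LinearMap.sum_apply]
    refine Finset.sum_congr rfl fun i _ => ?_
    rw [LinearMap.smul_apply, LinearMap.smul_apply, LinearMap.pi_apply_eq_sum_univ (T _) (b v),
      LinearMap.sum_apply, Finset.smul_sum]
    refine Finset.sum_congr rfl fun j _ => ?_
    rw [LinearMap.smul_apply, LinearMap.pi_apply_eq_sum_univ (T _ _) (c v), Finset.smul_sum,
      Finset.smul_sum]
    exact Finset.sum_congr rfl fun k _ => by rw [smul_smul, smul_smul, mul_assoc]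
  rw [h]
  have ha' := contDiff_pi.1 ha
  have hb' := contDiff_pi.1 hb
  have hc' := contDiff_pi.1 hc
  exact ContDiff.sum fun i _ => ContDiff.sum fun j _ => ContDiff.sum fun k _ =>
    ((ha' i).mul ((hb' j).mul (hc' k))).smul contDiff_const

lemma contDiff_gradedExplicit {ι : Type*} [Fintype ι]
    (T : (ι → ℝ) →ₗ[ℝ] (ι → ℝ) →ₗ[ℝ] (ι → ℝ) →ₗ[ℝ] (ι → ℝ)) :
    ContDiff ℝ ∞ (gradedExplicit (p := p) T) := by
  refine contDiff_pi.2 fun n => ContDiff.sum fun x _ => ?_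
  split_ifs
  · exact contDiff_trilinear T (contDiff_apply _ _ _) (contDiff_apply _ _ _) (contDiff_apply _ _ _)
  · exact contDiff_const

lemma contDiff_gradedImplicit {ι : Type*} [Fintype ι] (L : (ι → ℝ) →ₗ[ℝ] (ι → ℝ)) :
    ContDiff ℝ ∞ (gradedImplicit (p := p) L) := by
  refine contDiff_pi.2 fun n => ContDiff.sum fun x _ => ?_
  split_ifs
  · exact (LinearMap.toContinuousLinearMap L).contDiff.comp (contDiff_apply _ _ _)
  · exact contDiff_const

/-- The graded fields form a polynomial system in finite dimension. Starting from `Pi.single 0 y`,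
its exact solution is `t ↦ gradedScale t d`, and `gradedScale h c` is the result of one numerical
step. The order hypothesis gives `h^n (c n - d n) = O(h^(p+1))`; since `n ≤ p`, dividing by `h^n`
forces the constant `c n - d n` to vanish. -/
lemma eq_of_isStep_graded_pi {ι : Type*} [Fintype ι] (hM : M.HasOrder p)
    {T : (ι → ℝ) →ₗ[ℝ] (ι → ℝ) →ₗ[ℝ] (ι → ℝ) →ₗ[ℝ] (ι → ℝ)} {L : (ι → ℝ) →ₗ[ℝ] (ι → ℝ)}
    {y : ι → ℝ} {Y : Fin s → Fin (p + 1) → ι → ℝ} {c d : Fin (p + 1) → ι → ℝ}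
    (hY : M.IsStep (gradedExplicit T) (gradedImplicit L) 1 (Pi.single 0 y) Y c) (hd0 : d 0 = y)
    (hd : ∀ n : Fin (p + 1), ((n : ℕ) : ℝ) • d n = gradedExplicit T d n + gradedImplicit L d n) :
    c = d := by
  have h0 : gradedScale 0 d = Pi.single 0 y := by
    ext1 n
    rw [gradedScale_apply]
    by_cases hn : n = 0
    · subst hn; simp [hd0]
    · have : (n : ℕ) ≠ 0 := fun h => hn (Fin.ext h)
      simp [hn, this]
  have hcont : ∀ (v : Fin (p + 1) → ι → ℝ), Continuous fun h : ℝ => gradedScale h v := fun v =>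
    continuous_pi fun n => ((continuous_pow (n : ℕ)).smul continuous_const : _)
  have hYi : ∀ i, Y i 0 = y := fun i => by
    rw [congrFun (hY.1 i) 0]
    simp [gradedExplicit_zero, gradedImplicit_zero]
  -- The rescaled stages lie on the solution branch required by `HasOrder`: their constant
  -- coefficient is `y`, and the others carry positive powers of `h`.
  have hlim : ∀ i, Tendsto (fun h : ℝ => gradedScale h (Y i)) (𝓝[>] 0) (𝓝 (gradedScale 0 d)) := by
    intro i
    have h1 : gradedScale 0 (Y i) = gradedScale 0 d := by
      ext1 n
      rw [gradedScale_apply, gradedScale_apply]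
      by_cases hn : n = 0
      · subst hn; simp [hd0, hYi]
      · have : (n : ℕ) ≠ 0 := fun h => hn (Fin.ext h)
        simp [this]
    rw [← h1]
    exact ((hcont (Y i)).tendsto 0).mono_left nhdsWithin_le_nhds
  have hder : ∀ t : ℝ, HasDerivAt (fun t => gradedScale t d)
      (gradedExplicit T (gradedScale t d) + gradedImplicit L (gradedScale t d)) t := by
    intro t
    refine hasDerivAt_pi.2 fun n => ?_
    have h1 : HasDerivAt (fun t => gradedScale t d n) _ t :=
      (hasDerivAt_pow (n : ℕ) t).smul_const (d n)
    refine h1.congr_deriv ?_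
    rw [mul_comm, mul_smul, hd n, Pi.add_apply, smul_add]
    congr 1
    · simp only [gradedExplicit, Finset.smul_sum]
      refine Finset.sum_congr rfl fun x _ => ?_
      split_ifs with hx
      · simp only [gradedScale_apply, map_smul, LinearMap.smul_apply, smul_smul, ← hx]
        congr 1
        rw [Nat.add_sub_cancel]
        ring
      · simp
    · simp only [gradedImplicit, Finset.smul_sum]
      refine Finset.sum_congr rfl fun x _ => ?_
      split_ifs with hx
      · simp only [gradedScale_apply, map_smul, ← hx]
        rw [Nat.add_sub_cancel]
      · simp
  have key := hM.isBigO (contDiff_gradedExplicit T) (contDiff_gradedImplicit L) hder hlim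
    (y₁ := fun h => gradedScale h c) (fun h => by
      simp only [h0]
      exact isStep_gradedScale hY h)
  ext1 n
  have hn := (Asymptotics.isBigO_pi.1 key) n
  have h2 : (fun h : ℝ => h ^ (n : ℕ) • (c n - d n)) =O[𝓝[>] 0] fun h : ℝ => h ^ (p + 1) :=
    hn.congr_left fun h => by simp [gradedScale_apply, smul_sub]
  have h3 : (fun _ : ℝ => c n - d n) =O[𝓝[>] 0] fun h : ℝ => h ^ (p + 1 - n) := by
    have h4 := (Asymptotics.isBigO_refl (fun h : ℝ => (h ^ (n : ℕ))⁻¹) (𝓝[>] 0)).smul h2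
    refine (h4.congr' ?_ ?_)
    · filter_upwards [self_mem_nhdsWithin] with h hh
      have : h ^ (n : ℕ) ≠ 0 := pow_ne_zero _ (ne_of_gt hh)
      rw [smul_smul, inv_mul_cancel₀ this, one_smul]
    · filter_upwards [self_mem_nhdsWithin] with h hh
      have : h ^ (n : ℕ) ≠ 0 := pow_ne_zero _ (ne_of_gt hh)
      rw [smul_eq_mul, inv_mul_eq_iff_eq_mul₀ this, ← pow_add]
      congr 1
      omega
  have h5 : Tendsto (fun h : ℝ => h ^ (p + 1 - n)) (𝓝[>] 0) (𝓝 0) := by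
    have : Tendsto (fun h : ℝ => h ^ (p + 1 - n)) (𝓝 0) (𝓝 (0 ^ (p + 1 - n))) :=
      (continuous_pow (p + 1 - n)).tendsto 0
    rw [zero_pow (by omega)] at this
    exact this.mono_left nhdsWithin_le_nhds
  have h6 := h3.trans_tendsto h5
  exact sub_eq_zero.1 (tendsto_nhds_unique tendsto_const_nhds h6)

/-- A method of order `p` reproduces the first `p + 1` Taylor coefficients of the solution of
`y' = T(y, y, y) + L y` in any real vector space. -/
theorem eq_of_isStep_graded (hM : M.HasOrder p)
    {T : E →ₗ[ℝ] E →ₗ[ℝ] E →ₗ[ℝ] E} {L : E →ₗ[ℝ] E} {y : E}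
    {Y : Fin s → Fin (p + 1) → E} {c d : Fin (p + 1) → E}
    (hY : M.IsStep (gradedExplicit T) (gradedImplicit L) 1 (Pi.single 0 y) Y c) (hd0 : d 0 = y)
    (hd : ∀ n : Fin (p + 1), ((n : ℕ) : ℝ) • d n = gradedExplicit T d n + gradedImplicit L d n) :
    c = d := by
  -- All unknowns lie in the finite-dimensional span `W` of `S`. It need not be invariant under `T`
  -- and `L`, so these are compressed by a projection `P` onto `W`. The projected equations still
  -- hold because the arguments of `T` and `L` lie in `W`, and `P` loses nothing on `c` and `d`.
  set S : Set E := Set.range c ∪ Set.range d ∪ Set.range (fun x : Fin s × Fin (p + 1) => Y x.1 x.2)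
    with hS
  have hfin : S.Finite := ((Set.finite_range _).union (Set.finite_range _)).union
    (Set.finite_range _)
  set W := Submodule.span ℝ S with hW
  have : FiniteDimensional ℝ W := FiniteDimensional.span_of_finite ℝ hfin
  obtain ⟨P, hP⟩ := LinearMap.exists_leftInverse_of_injective W.subtype W.ker_subtype
  let b := (Module.finBasis ℝ W).equivFun
  let Q : E →ₗ[ℝ] (Fin (Module.finrank ℝ W) → ℝ) := (b : W →ₗ[ℝ] _) ∘ₗ P
  let J : (Fin (Module.finrank ℝ W) → ℝ) →ₗ[ℝ] E := W.subtype ∘ₗ (b.symm : _ →ₗ[ℝ] W)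
  have hJQ : ∀ w ∈ S, J (Q w) = w := fun w hw => by
    have h1 : P w = ⟨w, Submodule.subset_span hw⟩ :=
      LinearMap.congr_fun hP ⟨w, Submodule.subset_span hw⟩
    simp [J, Q, h1]
  have hc : ∀ n, c n ∈ S := fun n => Or.inl (Or.inl ⟨n, rfl⟩)
  have hdS : ∀ n, d n ∈ S := fun n => Or.inl (Or.inr ⟨n, rfl⟩)
  have hYS : ∀ i n, Y i n ∈ S := fun i n => Or.inr ⟨(i, n), rfl⟩
  let T' : (Fin (Module.finrank ℝ W) → ℝ) →ₗ[ℝ] (Fin (Module.finrank ℝ W) → ℝ) →ₗ[ℝ]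
      (Fin (Module.finrank ℝ W) → ℝ) →ₗ[ℝ] (Fin (Module.finrank ℝ W) → ℝ) :=
    LinearMap.mk₂ ℝ (fun u v => Q ∘ₗ (T (J u) (J v)) ∘ₗ J)
      (fun a b c => by ext; simp) (fun a b c => by ext; simp)
      (fun a b c => by ext; simp) (fun a b c => by ext; simp)
  let L' : (Fin (Module.finrank ℝ W) → ℝ) →ₗ[ℝ] (Fin (Module.finrank ℝ W) → ℝ) := Q ∘ₗ L ∘ₗ J
  have hT' : ∀ v : Fin (p + 1) → E, (∀ n, v n ∈ S) → ∀ n,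
      gradedExplicit T' (fun m => Q (v m)) n = Q (gradedExplicit T v n) := fun v hv n => by
    simp only [gradedExplicit, map_sum]
    refine Finset.sum_congr rfl fun x _ => ?_
    split_ifs
    · simp [T', hJQ _ (hv _)]
    · simp
  have hL' : ∀ v : Fin (p + 1) → E, (∀ n, v n ∈ S) → ∀ n,
      gradedImplicit L' (fun m => Q (v m)) n = Q (gradedImplicit L v n) := fun v hv n => by
    simp only [gradedImplicit, map_sum]
    refine Finset.sum_congr rfl fun x _ => ?_
    split_ifs
    · simp [L', hJQ _ (hv _)]
    · simp
  have hs : ∀ n, Q ((Pi.single 0 y : Fin (p + 1) → E) n)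
      = (Pi.single 0 (Q y) : Fin (p + 1) → Fin (Module.finrank ℝ W) → ℝ) n := fun n => by
    by_cases hn : n = 0
    · subst hn; simp
    · simp [hn]
  have key : (fun n => Q (c n)) = fun n => Q (d n) := by
    refine eq_of_isStep_graded_pi hM (T := T') (L := L') (y := Q y)
      (Y := fun i n => Q (Y i n)) ⟨fun i => ?_, ?_⟩ (by rw [hd0]) fun n => ?_
    · ext1 n
      simp only [Pi.add_apply, Pi.smul_apply, Finset.sum_apply, hT' _ (hYS _), hL' _ (hYS _), ← hs]
      conv_lhs => rw [congrFun (hY.1 i) n]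
      simp
    · ext1 n
      simp only [Pi.add_apply, Pi.smul_apply, Finset.sum_apply, hT' _ (hYS _), hL' _ (hYS _), ← hs]
      conv_lhs => rw [congrFun hY.2 n]
      simp
    · rw [hT' d hdS, hL' d hdS, ← map_add, ← hd n, map_smul]
  ext1 n
  rw [← hJQ _ (hc n), ← hJQ _ (hdS n)]
  exact congrArg J (congrFun key n)

/-! ### Recursive construction of stages and formal series -/

/-- A map on finite sequences each of whose components depends only on the preceding ones has a
fixed point. -/
lemma exists_fixedPoint_of_causal {m : ℕ} {Z : Type*} [Zero Z] (Φ : (Fin m → Z) → Fin m → Z)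
    (hΦ : ∀ A B n, (∀ k < n, A k = B k) → Φ A n = Φ B n) : ∃ A, A = Φ A := by
  -- After `r` iterations the first `r` entries are stationary.
  have h : ∀ r : ℕ, ∀ n : Fin m, (n : ℕ) < r → (Φ^[r] 0) n = (Φ^[r + 1] 0) n := by
    intro r
    induction r with
    | zero => intro n hn; omega
    | succ r ih =>
      intro n hn
      rw [Function.iterate_succ_apply', Function.iterate_succ_apply' Φ (r + 1)]
      exact hΦ _ _ _ fun k hk => ih k (by have : (k : ℕ) < n := hk; omega)
  exact ⟨Φ^[m] 0, funext fun n => by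
    rw [← Function.iterate_succ_apply' Φ]
    exact h m n n.2⟩

lemma fixedPoint_unique_of_causal {m : ℕ} {Z : Type*} {Φ : (Fin m → Z) → Fin m → Z}
    (hΦ : ∀ A B n, (∀ k < n, A k = B k) → Φ A n = Φ B n) {A B : Fin m → Z} (hA : A = Φ A)
    (hB : B = Φ B) : A = B := by
  ext1 n
  induction n using WellFoundedLT.induction with
  | ind n ih =>
    rw [hA, hB]
    exact hΦ _ _ _ ih

/-- The shift by one in the index is what makes formal expansions recursive: coefficient `n` sees
only lower ones. -/
lemma gradedExplicit_congr (T : E →ₗ[ℝ] E →ₗ[ℝ] E →ₗ[ℝ] E) {A B : Fin (p + 1) → E}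
    {n : Fin (p + 1)} (h : ∀ k < n, A k = B k) : gradedExplicit T A n = gradedExplicit T B n := by
  refine Finset.sum_congr rfl fun x _ => ?_
  split_ifs with hx
  · rw [h x.1 (Fin.lt_def.2 (by omega)), h x.2.1 (Fin.lt_def.2 (by omega)),
      h x.2.2 (Fin.lt_def.2 (by omega))]
  · rfl

lemma gradedImplicit_congr (L : E →ₗ[ℝ] E) {A B : Fin (p + 1) → E}
    {n : Fin (p + 1)} (h : ∀ k < n, A k = B k) : gradedImplicit L A n = gradedImplicit L B n := by
  refine Finset.sum_congr rfl fun x _ => ?_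
  split_ifs with hx
  · rw [h x (Fin.lt_def.2 (by omega))]
  · rfl

/-- The stages of a method have formal expansions in powers of the step size. -/
lemma exists_isStep_graded (M : ImExMethod s) (p : ℕ) (T : E →ₗ[ℝ] E →ₗ[ℝ] E →ₗ[ℝ] E)
    (L : E →ₗ[ℝ] E) (y : E) : ∃ (Y : Fin s → Fin (p + 1) → E) (c : Fin (p + 1) → E),
      M.IsStep (gradedExplicit T) (gradedImplicit L) 1 (Pi.single 0 y) Y c := by
  -- The recursion runs over powers of the step size, with all stages treated at once; implicitness
  -- is no obstacle, since no operator has to be inverted.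
  obtain ⟨A, hA⟩ := exists_fixedPoint_of_causal (m := p + 1) (Z := Fin s → E)
    (fun A n i => ((Pi.single 0 y : Fin (p + 1) → E) + (1 : ℝ) •
      (∑ j, M.Aex i j • gradedExplicit T (fun m => A m j) +
        ∑ j, M.Aim i j • gradedImplicit L (fun m => A m j))) n) (by
    intro A B n h
    ext1 i
    simp only [Pi.add_apply, Pi.smul_apply, Finset.sum_apply]
    simp only [gradedExplicit_congr T (fun k hk => congrFun (h k hk) _),
      gradedImplicit_congr L (fun k hk => congrFun (h k hk) _)])
  exact ⟨fun i n => A n i, _, fun i => funext fun n => congrFun (congrFun hA n) i, rfl⟩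

/-- Formal solution of the differential equation. -/
lemma exists_graded_solution (p : ℕ) (T : E →ₗ[ℝ] E →ₗ[ℝ] E →ₗ[ℝ] E)
    (L : E →ₗ[ℝ] E) (y : E) : ∃ d : Fin (p + 1) → E, d 0 = y ∧
      ∀ n : Fin (p + 1), ((n : ℕ) : ℝ) • d n = gradedExplicit T d n + gradedImplicit L d n := by
  -- At `n = 0` the convention `0⁻¹ = 0` leaves only the initial value `y`.
  obtain ⟨d, hd⟩ := exists_fixedPoint_of_causal (m := p + 1) (Z := E)
    (fun A n => (Pi.single 0 y : Fin (p + 1) → E) n + (((n : ℕ) : ℝ)⁻¹) •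
      (gradedExplicit T A n + gradedImplicit L A n)) (by
    intro A B n h
    simp only [gradedExplicit_congr T h, gradedImplicit_congr L h])
  refine ⟨d, ?_, fun n => ?_⟩
  · rw [congrFun hd 0]; simp
  · by_cases hn : n = 0
    · subst hn; simp [gradedExplicit_zero, gradedImplicit_zero]
    · have h0 : ((n : ℕ) : ℝ) ≠ 0 := Nat.cast_ne_zero.2 fun h => hn (Fin.ext h)
      conv_lhs => rw [congrFun hd n]
      simp [hn, smul_smul, h0]

end Order

/-! ### The splittings on `H^∞` -/

/-- The nonlinearity of NLS as a trilinear map: `i κ a b c̄`. -/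
def tri (κ : ℝ) : HInfAlg →ₗ[ℝ] HInfAlg →ₗ[ℝ] HInfAlg →ₗ[ℝ] HInfAlg :=
  LinearMap.mk₂ ℝ (fun a b =>
      { toFun := fun c => (Complex.I * κ) • (a * b * star c)
        map_add' := fun x y => by rw [star_add, mul_add, smul_add]
        map_smul' := fun r x => by
          rw [star_smul, star_trivial, mul_smul_comm, smul_comm, RingHom.id_apply] })
    (fun a b c => LinearMap.ext fun x => by
      change (Complex.I * κ) • ((a + b) * c * star x) =
        (Complex.I * κ) • (a * c * star x) + (Complex.I * κ) • (b * c * star x)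
      rw [← smul_add, add_mul, add_mul])
    (fun r a b => LinearMap.ext fun x => by
      change (Complex.I * κ) • (r • a * b * star x) = r • (Complex.I * κ) • (a * b * star x)
      rw [smul_mul_assoc, smul_mul_assoc, smul_comm])
    (fun a b c => LinearMap.ext fun x => by
      change (Complex.I * κ) • (a * (b + c) * star x) =
        (Complex.I * κ) • (a * b * star x) + (Complex.I * κ) • (a * c * star x)
      rw [← smul_add, mul_add, add_mul])
    (fun r a b => LinearMap.ext fun x => by
      change (Complex.I * κ) • (a * r • b * star x) = r • (Complex.I * κ) • (a * b * star x)
      rw [mul_smul_comm, smul_mul_assoc, smul_comm])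

lemma tri_apply (κ : ℝ) (a b c : HInfAlg) : tri κ a b c = (Complex.I * κ) • (a * b * star c) := rfl

/-- The implicit part `i ∂ₓ²` of NLS. -/
def schrodinger : HInfAlg →ₗ[ℝ] HInfAlg :=
  ((Complex.I • (D ∘ₗ D) : HInfAlg →ₗ[ℂ] HInfAlg)).restrictScalars ℝ

lemma schrodinger_apply (v : HInfAlg) : schrodinger v = Complex.I • D (D v) := rfl

/-- The implicit part of the hyperbolized system. -/
def hyperbolic (τ : ℝ) : HInfAlg × HInfAlg →ₗ[ℝ] HInfAlg × HInfAlg where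
  toFun Q := (Complex.I • D Q.2, (-Complex.I * (τ : ℂ)⁻¹) • (D Q.1 - Q.2))
  map_add' P Q := by
    refine Prod.ext ?_ ?_
    · simp
    · simp only [Prod.fst_add, Prod.snd_add, map_add]
      module
  map_smul' c P := by
    refine Prod.ext ?_ ?_
    · simp only [Prod.smul_snd, Prod.smul_fst, D_real_smul, RingHom.id_apply]
      rw [smul_comm]
    · simp only [Prod.smul_snd, Prod.smul_fst, D_real_smul, RingHom.id_apply, ← smul_sub]
      rw [smul_comm]

lemma hyperbolic_fst (τ : ℝ) (Q : HInfAlg × HInfAlg) :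
    (hyperbolic τ Q).1 = Complex.I • D Q.2 := rfl

lemma hyperbolic_snd (τ : ℝ) (Q : HInfAlg × HInfAlg) :
    (hyperbolic τ Q).2 = (-Complex.I * (τ : ℂ)⁻¹) • (D Q.1 - Q.2) := rfl

/-- The inclusion of `H^∞` into all functions. -/
def incl : HInfAlg →ₗ[ℝ] (ℝ → ℂ) where
  toFun v := v.1
  map_add' _ _ := rfl
  map_smul' _ _ := rfl

lemma incl_injective : Function.Injective incl := Subtype.coe_injective

lemma range_incl : Set.range incl = HInf := Subtype.range_coe

/-- The inclusion of pairs of elements of `H^∞` into all states. -/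
def incl₂ : HInfAlg × HInfAlg →ₗ[ℝ] State := incl.prodMap incl

lemma incl₂_injective : Function.Injective incl₂ := incl_injective.prodMap incl_injective

lemma range_incl₂ : Set.range incl₂ = HInf ×ˢ HInf := by
  change Set.range (Prod.map incl incl) = _
  rw [Set.range_prodMap, range_incl]

lemma incl_tri (κ : ℝ) (v : HInfAlg) : incl (tri κ v v v) = nlsExplicit κ (incl v) := by
  ext x
  change (Complex.I * κ) * (v.1 x * v.1 x * star (v.1 x)) = Complex.I * κ * (‖v.1 x‖ : ℂ) ^ 2 * v.1 x
  rw [← Complex.mul_conj', starRingEnd_apply]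
  ring

lemma incl_schrodinger (v : HInfAlg) : incl (schrodinger v) = nlsImplicit (incl v) := rfl

lemma incl₂_tri (κ : ℝ) (Q : HInfAlg × HInfAlg) :
    incl₂ (tri κ Q.1 Q.1 Q.1, 0) = nlshExplicit κ (incl₂ Q) :=
  Prod.ext (incl_tri κ Q.1) rfl

lemma incl₂_hyperbolic (τ : ℝ) (Q : HInfAlg × HInfAlg) :
    incl₂ (hyperbolic τ Q) = nlshImplicit τ (incl₂ Q) := rfl

/-! ### Well-posedness of the schemes -/

section Stages

variable {s : ℕ} {M : ImExMethod s}

/-- The determinant of a triangular matrix is the product of its diagonal entries. This is the only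
form in which type I enters the proof. -/
lemma ImExMethod.IsTypeI.diag_ne_zero (hA : M.IsTypeI) (i : Fin s) : M.Aim i i ≠ 0 := by
  have h1 : M.Aim.det ≠ 0 := ((Matrix.isUnit_iff_isUnit_det _).1 hA).ne_zero
  have h2 : M.Aim.BlockTriangular OrderDual.toDual := fun i j hij => M.implicit_lower i j hij
  rw [Matrix.det_of_isLowerTriangular _ h2] at h1
  exact Finset.prod_ne_zero_iff.1 h1 i (Finset.mem_univ i)

variable {E : Type*} [AddCommGroup E] [Module ℝ E]

/-- With the diagonal implicit term moved to the left, stage `i` is the preimage under a bijection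
of data depending on earlier stages only. The stages are thus the fixed point of a causal map,
whatever the explicit field `f`. -/
lemma existsUnique_stages {f : E → E} {g : E →ₗ[ℝ] E} {h : ℝ}
    (hb : ∀ i, Function.Bijective fun v => v - (h * M.Aim i i) • g v) (y : E) :
    ∃! Y : Fin s → E, ∀ i, Y i = y + h • (∑ j, M.Aex i j • f (Y j) + ∑ j, M.Aim i j • g (Y j)) := by
  choose r hr using fun i => (hb i).2
  simp only at hr
  let Φ : (Fin s → E) → Fin s → E := fun Y i =>
    r i (y + h • (∑ j, M.Aex i j • f (Y j) + ∑ j ∈ Finset.univ.erase i, M.Aim i j • g (Y j)))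
  have hc : ∀ A B n, (∀ k < n, A k = B k) → Φ A n = Φ B n := by
    intro A B n hAB
    simp only [Φ]
    congr 4
    · refine Finset.sum_congr rfl fun j _ => ?_
      rcases lt_or_ge j n with hj | hj
      · rw [hAB j hj]
      · rw [M.explicit_strictLower n j hj, zero_smul, zero_smul]
    · refine Finset.sum_congr rfl fun j hj => ?_
      rcases lt_or_gt_of_ne (Finset.ne_of_mem_erase hj) with hj | hj
      · rw [hAB j hj]
      · rw [M.implicit_lower n j hj, zero_smul, zero_smul]
  have hiff : ∀ Y : Fin s → E, (Y = Φ Y) ↔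
      ∀ i, Y i = y + h • (∑ j, M.Aex i j • f (Y j) + ∑ j, M.Aim i j • g (Y j)) := by
    intro Y
    rw [funext_iff]
    refine forall_congr' fun i => ?_
    rw [← Finset.add_sum_erase Finset.univ (fun j => M.Aim i j • g (Y j)) (Finset.mem_univ i)]
    have h1 : Y i = Φ Y i ↔ Y i - (h * M.Aim i i) • g (Y i) = y + h • (∑ j, M.Aex i j • f (Y j) +
        ∑ j ∈ Finset.univ.erase i, M.Aim i j • g (Y j)) := by
      rw [← (hb i).1.eq_iff]
      simp only [Φ, hr]
    rw [h1, sub_eq_iff_eq_add]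
    refine Eq.congr_right ?_
    module
  obtain ⟨Y, hY⟩ := exists_fixedPoint_of_causal Φ hc
  exact ⟨Y, (hiff Y).1 hY, fun Z hZ => fixedPoint_unique_of_causal hc ((hiff Z).2 hZ) hY⟩

variable {F : Type*} [AddCommGroup F] [Module ℝ F]

lemma ImExMethod.IsTrajectory.exists_lift {φ : E →ₗ[ℝ] F} (hφ : Function.Injective φ) {f g : E → E}
    {f' g' : F → F} (hf : ∀ v, φ (f v) = f' (φ v)) (hg : ∀ v, φ (g v) = g' (φ v)) {h : ℝ}
    {u : ℕ → F} (H : M.IsTrajectory f' g' (Set.range φ) h u) :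
    ∃ v : ℕ → E, (∀ n, φ (v n) = u n) ∧ ∀ n, ∃ Y, M.IsStep f g h (v n) Y (v (n + 1)) := by
  choose v hv using fun n => (H n).1
  refine ⟨v, hv, fun n => ?_⟩
  obtain ⟨Y, hY, hs⟩ := (H n).2
  choose Z hZ using hY
  refine ⟨Z, ImExMethod.IsStep.of_map φ hφ hf hg ?_⟩
  simpa only [hv, hZ] using hs

lemma ImExMethod.isTrajectory_of_lift {φ : E →ₗ[ℝ] F} {f g : E → E}
    {f' g' : F → F} (hf : ∀ v, φ (f v) = f' (φ v)) (hg : ∀ v, φ (g v) = g' (φ v)) {h : ℝ}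
    {v : ℕ → E} (H : ∀ n, ∃ Y, M.IsStep f g h (v n) Y (v (n + 1))) :
    M.IsTrajectory f' g' (Set.range φ) h fun n => φ (v n) := by
  intro n
  obtain ⟨Y, hY⟩ := H n
  exact ⟨⟨_, rfl⟩, fun i => φ (Y i), fun i => ⟨_, rfl⟩, hY.map φ hf hg⟩

lemma existsUnique_trajectory {φ : E →ₗ[ℝ] F} (hφ : Function.Injective φ) {f : E → E}
    {g : E →ₗ[ℝ] E} {f' g' : F → F} (hf : ∀ v, φ (f v) = f' (φ v)) (hg : ∀ v, φ (g v) = g' (φ v))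
    {h : ℝ} (hb : ∀ i, Function.Bijective fun v => v - (h * M.Aim i i) • g v) {u₀ : F}
    (hu₀ : u₀ ∈ Set.range φ) :
    ∃! u : ℕ → F, u 0 = u₀ ∧ M.IsTrajectory f' g' (Set.range φ) h u := by
  obtain ⟨v₀, rfl⟩ := hu₀
  have hst : ∀ y, ∃ y', ∃ Y, M.IsStep f g h y Y y' := fun y => by
    obtain ⟨Y, hY, -⟩ := existsUnique_stages (f := f) hb y
    exact ⟨_, Y, hY, rfl⟩
  have huniq : ∀ y Y Y' y' y'', M.IsStep f g h y Y y' → M.IsStep f g h y Y' y'' → y' = y'' := by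
    intro y Y Y' y' y'' h1 h2
    have : Y = Y' := (existsUnique_stages (f := f) hb y).unique h1.1 h2.1
    rw [h1.2, h2.2, this]
  choose Ψ hΨ using hst
  refine ⟨fun n => φ (Ψ^[n] v₀), ⟨rfl, ?_⟩, ?_⟩
  · refine ImExMethod.isTrajectory_of_lift hf hg (v := fun n => Ψ^[n] v₀) fun n => ?_
    obtain ⟨Y, hY⟩ := hΨ (Ψ^[n] v₀)
    exact ⟨Y, by rwa [Function.iterate_succ_apply']⟩
  · rintro u ⟨h0, hu⟩
    obtain ⟨w, hw, hs⟩ := hu.exists_lift hφ hf hg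
    ext1 n
    rw [← hw]
    congr 1
    induction n with
    | zero => exact hφ (by rw [hw, h0]; rfl)
    | succ n ih =>
      obtain ⟨Y, hY⟩ := hs n
      obtain ⟨Y', hY'⟩ := hΨ (Ψ^[n] v₀)
      rw [Function.iterate_succ_apply']
      rw [ih] at hY
      exact huniq _ _ _ _ _ hY hY'

end Stages

/-- The borderline case `β = iα` with `Re β = 0`, so the sign of `α` is irrelevant. -/
lemma bijective_sub_schrodinger (α : ℝ) :
    Function.Bijective fun v => v - α • schrodinger v := by
  have hre : 0 ≤ ((α : ℂ) * Complex.I).re := by simp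
  have he : ∀ v, v - α • schrodinger v = v - ((α : ℂ) * Complex.I) • D (D v) := fun v => by
    rw [schrodinger_apply, ← Complex.coe_smul, smul_smul]
  simp only [he]
  refine ⟨fun v w hvw => ?_, fun r => exists_sub_smul_D_D_eq hre r⟩
  refine sub_eq_zero.1 (eq_zero_of_sub_smul_D_D_eq_zero hre ?_)
  simp only [map_sub]
  linear_combination (norm := module) hvw

/-- Elimination of the auxiliary component from an implicit stage. -/
lemma sub_hyperbolic_eq_iff {α τ : ℝ} (hτ : 0 < τ) (Q r : HInfAlg × HInfAlg) :
    Q - α • hyperbolic τ Q = r ↔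
      Q.1 - ((α : ℂ) ^ 2 / (τ - α * Complex.I)) • D (D Q.1) =
        r.1 + (α * Complex.I * τ / (τ - α * Complex.I)) • D r.2 ∧
      Q.2 = (τ / (τ - α * Complex.I) : ℂ) • r.2
        - (α * Complex.I / (τ - α * Complex.I)) • D Q.1 := by
  have hτ' : (τ : ℂ) ≠ 0 := by exact_mod_cast hτ.ne'
  have hc : (τ : ℂ) - α * Complex.I ≠ 0 := fun h => hτ.ne' (by simpa using congrArg Complex.re h)
  have hI : Complex.I ^ 2 = -1 := Complex.I_sq
  have h1 : Q - α • hyperbolic τ Q = r ↔ Q.1 - ((α : ℂ) * Complex.I) • D Q.2 = r.1 ∧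
      Q.2 + ((α : ℂ) * Complex.I * (τ : ℂ)⁻¹) • (D Q.1 - Q.2) = r.2 := by
    rw [Prod.ext_iff]
    simp only [Prod.fst_sub, Prod.snd_sub, Prod.smul_fst, Prod.smul_snd, hyperbolic_fst,
      hyperbolic_snd, ← Complex.coe_smul, smul_smul]
    refine and_congr Iff.rfl (Eq.congr_left ?_)
    module
  -- The second equation is algebraic in `Q.2`: its coefficient `1 - iα/τ` never vanishes for `τ >
  -- 0`. Substituting the result into the first equation produces the second derivative of `Q.1`.
  have h2 : Q.2 + ((α : ℂ) * Complex.I * (τ : ℂ)⁻¹) • (D Q.1 - Q.2) = r.2 ↔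
      Q.2 = (τ / (τ - α * Complex.I) : ℂ) • r.2
        - (α * Complex.I / (τ - α * Complex.I)) • D Q.1 := by
    constructor
    · intro h
      rw [← h]
      match_scalars <;> field_simp <;> ring
    · intro h
      rw [h]
      match_scalars <;> field_simp
      all_goals ring
  rw [h1, h2]
  refine and_congr_left fun h3 => ?_
  have h4 : D Q.2 = (τ / (τ - α * Complex.I) : ℂ) • D r.2
        - (α * Complex.I / (τ - α * Complex.I)) • D (D Q.1) := by
    rw [h3, map_sub, map_smul, map_smul]
  rw [h4, sub_eq_iff_eq_add, sub_eq_iff_eq_add]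
  refine Eq.congr_right ?_
  match_scalars <;> field_simp <;> linear_combination (-(α : ℂ) ^ 2) * hI

/-- The real part is `α²τ/(τ² + α²)`, so the bounds for `1 - β ∂ₓ²` apply for either sign of `α`. -/
lemma re_div_nonneg {α τ : ℝ} (hτ : 0 < τ) : 0 ≤ ((α : ℂ) ^ 2 / (τ - α * Complex.I)).re := by
  rw [Complex.div_re]
  have h1 : ((α : ℂ) ^ 2).re = α ^ 2 := by norm_cast
  have h2 : ((α : ℂ) ^ 2).im = 0 := by norm_cast
  rw [h1, h2]
  simp only [Complex.sub_re, Complex.ofReal_re, Complex.mul_re, Complex.I_re, mul_zero,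
    Complex.ofReal_im, Complex.I_im, zero_mul, sub_zero, zero_div, add_zero]
  exact div_nonneg (by positivity) (Complex.normSq_nonneg _)

lemma bijective_sub_hyperbolic {α τ : ℝ} (hτ : 0 < τ) :
    Function.Bijective fun Q => Q - α • hyperbolic τ Q := by
  constructor
  · intro P Q hPQ
    refine sub_eq_zero.1 ?_
    have h0 : (P - Q) - α • hyperbolic τ (P - Q) = 0 := by
      rw [map_sub]
      linear_combination (norm := module) hPQ
    obtain ⟨h1, h2⟩ := (sub_hyperbolic_eq_iff hτ _ _).1 h0
    have h3 : (P - Q).1 = 0 := eq_zero_of_sub_smul_D_D_eq_zero (re_div_nonneg hτ) (by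
      simpa using h1)
    refine Prod.ext h3 ?_
    rw [h2, h3]
    simp
  · intro r
    obtain ⟨v, hv⟩ := exists_sub_smul_D_D_eq (re_div_nonneg (α := α) hτ)
      (r.1 + (α * Complex.I * τ / (τ - α * Complex.I)) • D r.2)
    exact ⟨(v, (τ / (τ - α * Complex.I) : ℂ) • r.2 - (α * Complex.I / (τ - α * Complex.I)) • D v),
      (sub_hyperbolic_eq_iff hτ _ _).2 ⟨hv, rfl⟩⟩

section WellPosed

variable {s : ℕ} {M : ImExMethod s}

theorem existsUnique_nlsTrajectory (κ h : ℝ) {u₀ : ℝ → ℂ} (hu₀ : u₀ ∈ HInf) :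
    ∃! u : ℕ → ℝ → ℂ, u 0 = u₀ ∧ IsNLSTrajectory M κ h u := by
  rw [← range_incl] at hu₀
  have := existsUnique_trajectory (M := M) incl_injective (incl_tri κ) incl_schrodinger
    (fun i => bijective_sub_schrodinger (h * M.Aim i i)) hu₀
  rwa [range_incl] at this

theorem existsUnique_nlshTrajectory (κ h : ℝ) {τ : ℝ} (hτ : 0 < τ)
    {Q₀ : State} (hQ₀ : Q₀ ∈ HInf ×ˢ HInf) :
    ∃! Q : ℕ → State, Q 0 = Q₀ ∧ IsNLSHTrajectory M κ τ h Q := by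
  rw [← range_incl₂] at hQ₀
  have := existsUnique_trajectory (M := M) (h := h) incl₂_injective (incl₂_tri κ) (incl₂_hyperbolic τ)
    (fun _ => bijective_sub_hyperbolic hτ) hQ₀
  rwa [range_incl₂] at this

end WellPosed

/-! ### Asymptotics of families in `H^∞` -/

section Asymptotic

open Asymptotics

variable {ι : Type*} {l : Filter ι}

/-- A family in `H^∞` that is `O(ρ)` in every Sobolev norm. -/
def SobO (l : Filter ι) (v : ι → HInfAlg) (ρ : ι → ℝ) : Prop :=
  ∀ k, (fun i => sob k (v i)) =O[l] ρ

/-- A family in `H^∞` that tends to zero in every Sobolev norm. -/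
def SobNull (l : Filter ι) (v : ι → HInfAlg) : Prop :=
  ∀ k, Tendsto (fun i => sob k (v i)) l (𝓝 0)

lemma isBigO_of_sob_le {k : ℕ} {v : ι → HInfAlg} {g : ι → ℝ} (h : ∀ i, sob k (v i) ≤ g i) :
    (fun i => sob k (v i)) =O[l] g :=
  IsBigO.of_norm_le fun i => by
    rw [Real.norm_of_nonneg (sob_nonneg _ _)]
    exact h i

lemma SobO.congr {v w : ι → HInfAlg} {ρ : ι → ℝ} (h : SobO l v ρ) (hvw : ∀ i, v i = w i) :
    SobO l w ρ := by
  rwa [← funext hvw]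

lemma SobO.add {v w : ι → HInfAlg} {ρ : ι → ℝ} (hv : SobO l v ρ) (hw : SobO l w ρ) :
    SobO l (fun i => v i + w i) ρ := fun k =>
  (isBigO_of_sob_le fun i => sob_add_le k (v i) (w i)).trans ((hv k).add (hw k))

lemma SobO.sub {v w : ι → HInfAlg} {ρ : ι → ℝ} (hv : SobO l v ρ) (hw : SobO l w ρ) :
    SobO l (fun i => v i - w i) ρ := fun k =>
  (isBigO_of_sob_le fun i => sob_sub_le k (v i) (w i)).trans ((hv k).add (hw k))

lemma SobO.zero {ρ : ι → ℝ} : SobO l (fun _ => 0) ρ := fun k => by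
  simp only [sob_zero]
  exact isBigO_zero _ _

lemma SobO.sum {J : Type*} {s : Finset J} {v : J → ι → HInfAlg} {ρ : ι → ℝ}
    (h : ∀ j ∈ s, SobO l (v j) ρ) : SobO l (fun i => ∑ j ∈ s, v j i) ρ := fun k =>
  (isBigO_of_sob_le fun i => sob_sum_le k s fun j => v j i).trans
    (IsBigO.fun_sum fun j hj => h j hj k)

lemma SobO.smul {c ρ₁ ρ₂ : ι → ℝ} {v : ι → HInfAlg} (hc : c =O[l] ρ₁) (hv : SobO l v ρ₂) :
    SobO l (fun i => c i • v i) fun i => ρ₁ i * ρ₂ i := fun k => by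
  simp only [sob_real_smul]
  exact hc.abs_left.mul (hv k)

lemma SobO.const_smul (c : ℝ) {ρ : ι → ℝ} {v : ι → HInfAlg} (hv : SobO l v ρ) :
    SobO l (fun i => c • v i) ρ := fun k => by
  simp only [sob_real_smul]
  exact (hv k).const_mul_left _

lemma SobO.D {ρ : ι → ℝ} {v : ι → HInfAlg} (hv : SobO l v ρ) : SobO l (fun i => D (v i)) ρ :=
  fun k => (isBigO_of_sob_le fun i => sob_D_le k (v i)).trans (hv (k + 1))

lemma sob_schrodinger_le (k : ℕ) (v : HInfAlg) : sob k (schrodinger v) ≤ sob (k + 2) v := by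
  rw [schrodinger_apply, sob_smul, Complex.norm_I, one_mul]
  exact (sob_D_le k _).trans (sob_D_le (k + 1) _)

lemma SobO.schrodinger {ρ : ι → ℝ} {v : ι → HInfAlg} (hv : SobO l v ρ) :
    SobO l (fun i => schrodinger (v i)) ρ :=
  fun k => (isBigO_of_sob_le fun i => sob_schrodinger_le k (v i)).trans (hv (k + 2))

lemma SobO.trans {ρ₁ ρ₂ : ι → ℝ} {v : ι → HInfAlg} (hv : SobO l v ρ₁) (h : ρ₁ =O[l] ρ₂) :
    SobO l v ρ₂ := fun k => (hv k).trans h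

/-- The constant in the trilinear estimate. -/
def triConst (k : ℕ) (κ : ℝ) : ℝ := |κ| * 4 ^ (k + 1)

lemma triConst_nonneg (k : ℕ) (κ : ℝ) : 0 ≤ triConst k κ := by unfold triConst; positivity

lemma sob_tri_le {k : ℕ} (hk : 1 ≤ k) (κ : ℝ) (a b c : HInfAlg) :
    sob k (tri κ a b c) ≤ triConst k κ * (sob k a * sob k b * sob k c) := by
  rw [tri_apply, sob_smul, norm_mul, Complex.norm_I, one_mul, Complex.norm_real, Real.norm_eq_abs,
    triConst, mul_assoc |κ|]
  refine mul_le_mul_of_nonneg_left ?_ (abs_nonneg κ)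
  refine (sob_mul_le hk (a * b) (star c)).trans ?_
  rw [sob_star]
  have h1 := mul_le_mul_of_nonneg_right (sob_mul_le hk a b) (sob_nonneg k c)
  have h2 : (4 : ℝ) ^ (k + 1) = 2 ^ (k + 1) * 2 ^ (k + 1) := by
    rw [← mul_pow]; norm_num
  rw [h2]
  have h3 : (0 : ℝ) < 2 ^ (k + 1) := by positivity
  calc _ ≤ 2 ^ (k + 1) * (2 ^ (k + 1) * (sob k a * sob k b) * sob k c) := by gcongr
    _ = _ := by ring

lemma SobO.tri (κ : ℝ) {ρ₁ ρ₂ ρ₃ : ι → ℝ} {a b c : ι → HInfAlg} (ha : SobO l a ρ₁)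
    (hb : SobO l b ρ₂) (hc : SobO l c ρ₃) :
    SobO l (fun i => tri κ (a i) (b i) (c i)) fun i => ρ₁ i * ρ₂ i * ρ₃ i := fun k =>
  (isBigO_of_sob_le fun i => (sob_mono (Nat.le_succ k) _).trans
    (sob_tri_le (k := k + 1) (by omega) κ (a i) (b i) (c i))).trans
    ((((ha (k + 1)).mul (hb (k + 1))).mul (hc (k + 1))).const_mul_left _)

lemma tri_sub_tri (κ : ℝ) (a b : HInfAlg) : tri κ a a a - tri κ b b b =
    tri κ (a - b) a a + tri κ b (a - b) a + tri κ b b (a - b) := by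
  simp only [tri_apply, star_sub, sub_mul, mul_sub, smul_sub]
  abel

lemma SobO.tri_sub_tri (κ : ℝ) {ρ : ι → ℝ} {a b : ι → HInfAlg} (ha : SobO l a fun _ => 1)
    (hb : SobO l b fun _ => 1) (h : SobO l (fun i => a i - b i) ρ) :
    SobO l (fun i => NLSH.tri κ (a i) (a i) (a i) - NLSH.tri κ (b i) (b i) (b i)) ρ := by
  have h1 := ((h.tri κ ha ha).congr fun _ => rfl)
  have h2 := hb.tri κ h ha
  have h3 := hb.tri κ hb h
  simp only [mul_one, one_mul] at h1 h2 h3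
  exact ((h1.add h2).add h3).congr fun i => (NLSH.tri_sub_tri κ (a i) (b i)).symm

lemma SobO.const (v : HInfAlg) : SobO l (fun _ => v) fun _ => 1 := fun _ =>
  isBigO_const_const _ one_ne_zero _

lemma SobNull.sobO {v : ι → HInfAlg} (h : SobNull l v) : SobO l v fun _ => 1 := fun k =>
  (h k).isBigO_one ℝ

lemma SobNull.of_le {v : ι → HInfAlg} {g : ℕ → ι → ℝ} (hg : ∀ k, Tendsto (g k) l (𝓝 0))
    (h : ∀ k, ∀ᶠ i in l, sob k (v i) ≤ g k i) : SobNull l v := fun k =>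
  squeeze_zero' (Eventually.of_forall fun _ => sob_nonneg _ _) (h k) (hg k)

lemma SobNull.congr' {v w : ι → HInfAlg} (h : SobNull l v) (hvw : ∀ᶠ i in l, v i = w i) :
    SobNull l w := fun k => (h k).congr' (hvw.mono fun i hi => by simp only [hi])

lemma SobNull.add {v w : ι → HInfAlg} (hv : SobNull l v) (hw : SobNull l w) :
    SobNull l (fun i => v i + w i) :=
  SobNull.of_le (fun k => by simpa using (hv k).add (hw k))
    fun k => Eventually.of_forall fun _ => sob_add_le k _ _

lemma SobNull.sub {v w : ι → HInfAlg} (hv : SobNull l v) (hw : SobNull l w) :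
    SobNull l (fun i => v i - w i) :=
  SobNull.of_le (fun k => by simpa using (hv k).add (hw k))
    fun k => Eventually.of_forall fun _ => sob_sub_le k _ _

lemma SobNull.sum {J : Type*} {s : Finset J} {v : J → ι → HInfAlg}
    (h : ∀ j ∈ s, SobNull l (v j)) : SobNull l (fun i => ∑ j ∈ s, v j i) :=
  SobNull.of_le (fun k => by simpa using tendsto_finsetSum s fun j hj => h j hj k)
    fun k => Eventually.of_forall fun i => sob_sum_le k s fun j => v j i

lemma SobNull.zero : SobNull l (fun _ => 0) := fun k => by
  simp only [sob_zero]
  exact tendsto_const_nhds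

lemma SobNull.const_smul (c : ℝ) {v : ι → HInfAlg} (hv : SobNull l v) :
    SobNull l (fun i => c • v i) := fun k => by
  simp only [sob_real_smul]
  simpa using (hv k).const_mul |c|

lemma SobNull.smul_sobO {c : ι → ℂ} {v : ι → HInfAlg} (hc : Tendsto c l (𝓝 0))
    (hv : SobO l v fun _ => 1) : SobNull l (fun i => c i • v i) := fun k => by
  simp only [sob_smul]
  have h1 : (fun i => ‖c i‖) =o[l] fun _ => (1 : ℝ) :=
    (isLittleO_one_iff ℝ).2 (by simpa using hc.norm)
  have := (h1.mul_isBigO (hv k))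
  simpa using this

lemma SobNull.D {v : ι → HInfAlg} (hv : SobNull l v) : SobNull l (fun i => D (v i)) :=
  SobNull.of_le (fun k => hv (k + 1)) fun k => Eventually.of_forall fun _ => sob_D_le k _

lemma SobNull.I_smul {v : ι → HInfAlg} (hv : SobNull l v) :
    SobNull l (fun i => Complex.I • v i) := fun k => by
  simpa only [sob_smul, Complex.norm_I, one_mul] using hv k

lemma SobO.of_sub_null {v : ι → HInfAlg} {w : HInfAlg} (h : SobNull l fun i => v i - w) :
    SobO l v fun _ => 1 :=
  (h.sobO.add (SobO.const w)).congr fun i => by abel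

lemma sob_tri_sub_tri_le {k : ℕ} (hk : 1 ≤ k) (κ : ℝ) (a b : HInfAlg) :
    sob k (tri κ a a a - tri κ b b b) ≤
      triConst k κ * (sob k a + sob k b) ^ 2 * sob k (a - b) := by
  rw [tri_sub_tri]
  have h1 := sob_tri_le hk κ (a - b) a a
  have h2 := sob_tri_le hk κ b (a - b) a
  have h3 := sob_tri_le hk κ b b (a - b)
  have h4 := sob_add_le k (tri κ (a - b) a a + tri κ b (a - b) a) (tri κ b b (a - b))
  have h5 := sob_add_le k (tri κ (a - b) a a) (tri κ b (a - b) a)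
  -- Telescoping gives `a² + ab + b²`, which falls short of `(a + b)²` by the nonnegative term `ab`.
  have h6 : 0 ≤ triConst k κ * (sob k a * sob k b * sob k (a - b)) :=
    mul_nonneg (triConst_nonneg k κ)
      (mul_nonneg (mul_nonneg (sob_nonneg k a) (sob_nonneg k b)) (sob_nonneg k _))
  nlinarith

lemma SobNull.tri_sub_tri (κ : ℝ) {a : ι → HInfAlg} {b : HInfAlg}
    (h : SobNull l (fun i => a i - b)) :
    SobNull l (fun i => tri κ (a i) (a i) (a i) - tri κ b b b) := by
  refine SobNull.of_le (g := fun k i => triConst (k + 1) κ *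
    (sob (k + 1) (a i) + sob (k + 1) b) ^ 2 * sob (k + 1) (a i - b)) (fun k => ?_)
    fun k => Eventually.of_forall fun i =>
      (sob_mono (Nat.le_succ k) _).trans (sob_tri_sub_tri_le (by omega) κ _ _)
  have h1 : (fun i => (sob (k + 1) (a i) + sob (k + 1) b) ^ 2) =O[l] fun _ => (1 : ℝ) := by
    simpa using ((SobO.of_sub_null h (k + 1)).add (SobO.const b (k + 1))).pow 2
  have h2 := (h1.const_mul_left (triConst (k + 1) κ)).mul_isLittleO
    ((isLittleO_one_iff ℝ).2 (h (k + 1)))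
  simpa using h2

end Asymptotic

/-! ### Asymptotic preservation -/

section AP

open Asymptotics

variable {s : ℕ} {M : ImExMethod s}

lemma isStep_stage {E : Type*} [AddCommGroup E] [Module ℝ E] {f g : E → E} {h : ℝ} {y y' : E}
    {Y : Fin s → E} (H : M.IsStep f g h y Y y') (i : Fin s) :
    Y i - (h * M.Aim i i) • g (Y i) = y + h • (∑ j, M.Aex i j • f (Y j) +
      ∑ j ∈ Finset.univ.erase i, M.Aim i j • g (Y j)) := by
  rw [sub_eq_iff_eq_add]
  refine (H.1 i).trans ?_
  rw [← Finset.add_sum_erase Finset.univ (fun j => M.Aim i j • g (Y j)) (Finset.mem_univ i)]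
  module

lemma tendsto_sub_mul_I {α : ℝ} :
    Tendsto (fun τ : ℝ => (τ : ℂ) - α * Complex.I) (𝓝[>] 0) (𝓝 (-(α * Complex.I))) := by
  have : Tendsto (fun τ : ℝ => (τ : ℂ) - α * Complex.I) (𝓝 0) (𝓝 (((0 : ℝ) : ℂ) - α * Complex.I)) :=
    Continuous.tendsto (by fun_prop) 0
  rw [Complex.ofReal_zero, zero_sub] at this
  exact this.mono_left nhdsWithin_le_nhds

/-- Convergence of one implicit stage in the stiff limit. -/
lemma sobNull_stage {α : ℝ} (hα : α ≠ 0) {Q r : ℝ → HInfAlg × HInfAlg} {U R : HInfAlg}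
    (hQ : ∀ τ > 0, Q τ - α • hyperbolic τ (Q τ) = r τ) (hU : U - α • schrodinger U = R)
    (h0 : SobNull (𝓝[>] 0) fun τ => (r τ).1 - R) (h1 : SobO (𝓝[>] 0) (fun τ => (r τ).2) fun _ => 1) :
    SobNull (𝓝[>] 0) (fun τ => (Q τ).1 - U) ∧ SobNull (𝓝[>] 0) (fun τ => (Q τ).2 - D U) ∧
      SobO (𝓝[>] 0) (fun τ => (hyperbolic τ (Q τ)).2) fun _ => 1 := by
  have hα' : -((α : ℂ) * Complex.I) ≠ 0 := by simp [hα]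
  have hpos : ∀ᶠ τ : ℝ in 𝓝[>] 0, 0 < τ := self_mem_nhdsWithin
  have ht0 : Tendsto (fun τ : ℝ => (τ : ℂ)) (𝓝[>] 0) (𝓝 0) := by
    have : Tendsto (fun τ : ℝ => (τ : ℂ)) (𝓝 0) (𝓝 ((0 : ℝ) : ℂ)) :=
      Complex.continuous_ofReal.tendsto 0
    exact (by simpa using this : Tendsto _ _ (𝓝 (0 : ℂ))).mono_left nhdsWithin_le_nhds
  have hc0 : Tendsto (fun τ : ℝ => (τ / (τ - α * Complex.I) : ℂ)) (𝓝[>] 0) (𝓝 0) := by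
    have := ht0.div tendsto_sub_mul_I hα'
    rw [zero_div] at this
    exact this
  have hc1 : Tendsto (fun τ : ℝ => (α * Complex.I * τ / (τ - α * Complex.I) : ℂ)) (𝓝[>] 0) (𝓝 0) := by
    simpa [mul_div_assoc] using hc0.const_mul ((α : ℂ) * Complex.I)
  have hU' : U - ((α : ℂ) * Complex.I) • D (D U) = R := by
    rw [← hU, schrodinger_apply, ← Complex.coe_smul, smul_smul]
  have hne : ∀ τ : ℝ, 0 < τ → (τ : ℂ) - α * Complex.I ≠ 0 := fun τ hτ h =>
    hτ.ne' (by simpa using congrArg Complex.re h)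
  -- With `c = iατ/(τ - iα)` one has `β = iα - c`. Applying `1 - β ∂ₓ²` to the difference gives
  -- `(r.1 - R) + c (∂ₓ r.2 - ∂ₓ² U)`, which is null, and the operator is bounded below uniformly in
  -- `τ`.
  have A : SobNull (𝓝[>] 0) fun τ => (Q τ).1 - U := by
    have h2 : SobNull (𝓝[>] 0) fun τ => ((r τ).1 - R) +
        (α * Complex.I * τ / (τ - α * Complex.I) : ℂ) • (D (r τ).2 - D (D U)) :=
      h0.add (SobNull.smul_sobO hc1 (h1.D.sub (SobO.const _)))
    refine SobNull.of_le h2 fun k => ?_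
    filter_upwards [hpos] with τ hτ
    have h3 := ((sub_hyperbolic_eq_iff hτ _ _).1 (hQ τ hτ)).1
    refine (sob_le_sob_sub_smul_D_D (re_div_nonneg (α := α) hτ) _ k).trans (le_of_eq ?_)
    congr 1
    have h4 : (α : ℂ) ^ 2 / (τ - α * Complex.I) =
        α * Complex.I - α * Complex.I * τ / (τ - α * Complex.I) := by
      have := hne τ hτ
      field_simp
      linear_combination ((α : ℂ) ^ 2) * Complex.I_sq
    simp only [map_sub]
    rw [← hU']
    linear_combination (norm := skip) h3
    rw [h4]
    module
  -- Since `iα/(τ - iα) = τ/(τ - iα) - 1`, the component `Q.2` equals `∂ₓ Q.1` up to a bounded term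
  -- with a vanishing factor; the data `r.2` are forgotten in the limit.
  have B : SobNull (𝓝[>] 0) fun τ => (Q τ).2 - D U := by
    have h2 : SobNull (𝓝[>] 0) fun τ : ℝ => (τ / (τ - α * Complex.I) : ℂ) • ((r τ).2 - D (Q τ).1) +
        (D ((Q τ).1 - U)) :=
      (SobNull.smul_sobO hc0 (h1.sub (SobO.of_sub_null A).D)).add A.D
    refine h2.congr' ?_
    filter_upwards [hpos] with τ hτ
    rw [((sub_hyperbolic_eq_iff hτ _ _).1 (hQ τ hτ)).2, map_sub]
    have h4 : α * Complex.I / (τ - α * Complex.I) = τ / (τ - α * Complex.I) - 1 := by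
      have := hne τ hτ
      field_simp
      ring
    rw [h4]
    module
  refine ⟨A, B, fun k => ?_⟩
  -- The stiff term carries `τ⁻¹`, but by the stage equation it equals `(Q.2 - r.2)/α`.
  have h2 := (((SobO.of_sub_null B).sub h1).const_smul α⁻¹) k
  refine h2.congr' ?_ EventuallyEq.rfl
  filter_upwards [hpos] with τ hτ
  have h3 := congrArg Prod.snd (hQ τ hτ)
  rw [← h3]
  simp [hα]

/-- Convergence of one step, including its stages, in the stiff limit. -/
theorem sobNull_step (hA : M.IsTypeI) {κ h : ℝ} (hh : h ≠ 0) {q q' : ℝ → HInfAlg × HInfAlg}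
    {Q : ℝ → Fin s → HInfAlg × HInfAlg} {u u' : HInfAlg} {U : Fin s → HInfAlg}
    (hQ : ∀ τ > 0, M.IsStep (fun P => (tri κ P.1 P.1 P.1, 0)) (hyperbolic τ) h (q τ) (Q τ) (q' τ))
    (hU : M.IsStep (fun v => tri κ v v v) schrodinger h u U u')
    (h0 : SobNull (𝓝[>] 0) fun τ => (q τ).1 - u) (h1 : SobO (𝓝[>] 0) (fun τ => (q τ).2) fun _ => 1) :
    (SobNull (𝓝[>] 0) fun τ => (q' τ).1 - u') ∧
      SobO (𝓝[>] 0) (fun τ => (q' τ).2) (fun _ => 1) ∧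
      ∀ i, SobNull (𝓝[>] 0) fun τ => (Q τ i).2 - D (U i) := by
  have hpos : ∀ᶠ τ : ℝ in 𝓝[>] 0, 0 < τ := self_mem_nhdsWithin
  -- The three claims close the induction over the stages: the first two give convergence of the
  -- `q₀` data of the next stage, the third boundedness of its `q₁` data.
  have key : ∀ i, SobNull (𝓝[>] 0) (fun τ => (Q τ i).1 - U i) ∧
      SobNull (𝓝[>] 0) (fun τ => (Q τ i).2 - D (U i)) ∧
      SobO (𝓝[>] 0) (fun τ => (hyperbolic τ (Q τ i)).2) fun _ => 1 := by
    intro i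
    induction i using WellFoundedLT.induction with
    | ind i ih =>
    refine sobNull_stage (mul_ne_zero hh (hA.diag_ne_zero i)) (fun τ hτ => isStep_stage (hQ τ hτ) i)
      (isStep_stage hU i) ?_ ?_
    · have h2 : SobNull (𝓝[>] 0) fun τ => ((q τ).1 - u) + h • (∑ j, M.Aex i j •
          (tri κ (Q τ j).1 (Q τ j).1 (Q τ j).1 - tri κ (U j) (U j) (U j)) +
          ∑ j ∈ Finset.univ.erase i, M.Aim i j • (Complex.I • D ((Q τ j).2 - D (U j)))) := by
        refine h0.add (SobNull.const_smul h (SobNull.add (SobNull.sum fun j _ => ?_)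
          (SobNull.sum fun j hj => ?_)))
        · rcases lt_or_ge j i with hj | hj
          · exact SobNull.const_smul _ (SobNull.tri_sub_tri κ (ih j hj).1)
          · simp only [M.explicit_strictLower i j hj, zero_smul]
            exact SobNull.zero
        · rcases lt_or_gt_of_ne (Finset.ne_of_mem_erase hj) with hj | hj
          · exact SobNull.const_smul _ (ih j hj).2.1.D.I_smul
          · simp only [M.implicit_lower i j hj, zero_smul]
            exact SobNull.zero
      refine h2.congr' (Eventually.of_forall fun τ => ?_)
      simp only [Prod.fst_add, Prod.smul_fst, Prod.fst_sum, hyperbolic_fst, schrodinger_apply,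
        smul_sub, map_sub, Finset.sum_sub_distrib]
      module
    · have h2 : SobO (𝓝[>] 0) (fun τ => (q τ).2 + h • (∑ j ∈ Finset.univ.erase i, M.Aim i j •
          (hyperbolic τ (Q τ j)).2)) fun _ => 1 := by
        refine h1.add (SobO.const_smul h (SobO.sum fun j hj => ?_))
        rcases lt_or_gt_of_ne (Finset.ne_of_mem_erase hj) with hj | hj
        · exact SobO.const_smul _ (ih j hj).2.2
        · simp only [M.implicit_lower i j hj, zero_smul]
          exact SobO.zero
      refine h2.congr fun τ => ?_
      simp [Prod.snd_sum]
  refine ⟨?_, ?_, fun i => (key i).2.1⟩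
  · have h2 : SobNull (𝓝[>] 0) fun τ => ((q τ).1 - u) + h • (∑ j, M.bex j •
        (tri κ (Q τ j).1 (Q τ j).1 (Q τ j).1 - tri κ (U j) (U j) (U j)) +
        ∑ j, M.bim j • (Complex.I • D ((Q τ j).2 - D (U j)))) :=
      h0.add (SobNull.const_smul h (SobNull.add
        (SobNull.sum fun j _ => SobNull.const_smul _ (SobNull.tri_sub_tri κ (key j).1))
        (SobNull.sum fun j _ => SobNull.const_smul _ (key j).2.1.D.I_smul)))
    refine h2.congr' (hpos.mono fun τ hτ => ?_)
    rw [(hQ τ hτ).2, hU.2]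
    simp only [Prod.fst_add, Prod.smul_fst, Prod.fst_sum, hyperbolic_fst, schrodinger_apply,
      smul_sub, map_sub, Finset.sum_sub_distrib]
    module
  -- Only boundedness of `q₁` is claimed after the update; the next step needs no more.
  · have h2 : SobO (𝓝[>] 0) (fun τ => (q τ).2 + h • (∑ j, M.bim j • (hyperbolic τ (Q τ j)).2))
        fun _ => 1 :=
      h1.add (SobO.const_smul h (SobO.sum fun j _ => SobO.const_smul _ (key j).2.2))
    intro k
    refine (h2 k).congr' (hpos.mono fun τ hτ => ?_) EventuallyEq.rfl
    change _ = sob k (q' τ).2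
    rw [(hQ τ hτ).2]
    simp [Prod.snd_sum]

/-- The update and the last stage are the same combination. The index is chosen before the space, so
that the same stage serves NLS and NLSH. -/
lemma ImExMethod.IsGSA.exists_stage_eq (hG : M.IsGSA) : ∃ i : Fin s, ∀ {E : Type} [AddCommGroup E]
    [Module ℝ E] {f g : E → E} {h : ℝ} {y y' : E} {Y : Fin s → E}, M.IsStep f g h y Y y' →
    y' = Y i := by
  obtain ⟨i, -, hi⟩ := hG
  refine ⟨i, fun H => ?_⟩
  rw [H.1 i, H.2]
  simp only [(hi _).1, (hi _).2]

/-- The stiff limit of a family of trajectories of the hyperbolized system. -/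
theorem IsNLSHFamily.sobNull (hA : M.IsTypeI) {κ h : ℝ} (hh : h ≠ 0) {u : ℕ → HInfAlg}
    (hu : ∀ n, ∃ U, M.IsStep (fun v => tri κ v v v) schrodinger h (u n) U (u (n + 1)))
    {Q : ℝ → ℕ → State} (hQ : IsNLSHFamily M κ h (u 0) Q) :
    ∃ q : ℝ → ℕ → HInfAlg × HInfAlg, (∀ τ > 0, ∀ n, incl₂ (q τ n) = Q τ n) ∧
      (∀ n, SobNull (𝓝[>] 0) fun τ => (q τ n).1 - u n) ∧
      (M.IsGSA → ∀ n, SobNull (𝓝[>] 0) fun τ => (q τ (n + 1)).2 - D (u (n + 1))) := by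
  have hpos : ∀ᶠ τ : ℝ in 𝓝[>] 0, 0 < τ := self_mem_nhdsWithin
  have hl : ∀ τ : ℝ, 0 < τ → ∃ v : ℕ → HInfAlg × HInfAlg, (∀ n, incl₂ (v n) = Q τ n) ∧
      ∀ n, ∃ Y, M.IsStep (fun P => (tri κ P.1 P.1 P.1, 0)) (hyperbolic τ) h (v n) Y (v (n + 1)) := by
    intro τ hτ
    have := hQ.scheme τ hτ
    rw [IsNLSHTrajectory, ← range_incl₂] at this
    exact this.exists_lift incl₂_injective (incl₂_tri κ) (incl₂_hyperbolic τ)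
  choose! q hq Y hY using hl
  choose U hU using hu
  have key : ∀ n, SobNull (𝓝[>] 0) (fun τ => (q τ n).1 - u n) ∧
      SobO (𝓝[>] 0) (fun τ => (q τ n).2) fun _ => 1 := by
    intro n
    induction n with
    | zero =>
      refine ⟨fun k => ?_, fun k => ?_⟩
      · have h1 := (ENNReal.tendsto_toReal ENNReal.zero_ne_top).comp (hQ.init₀ k)
        refine Tendsto.congr' ?_ h1
        filter_upwards [hpos] with τ hτ
        have h2 : (Q τ 0).1 - (u 0).1 = ((q τ 0).1 - u 0 : HInfAlg).1 := by
          rw [← hq τ hτ 0]; rfl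
        rw [Function.comp_apply, h2, hNorm_coe, ENNReal.toReal_ofReal (sob_nonneg _ _)]
      · obtain ⟨B, hB⟩ := hQ.init₁ k
        -- The given bound `B` may be negative, in which case `ENNReal.ofReal` reads it as zero.
        refine IsBigO.of_bound (max B 0) ?_
        filter_upwards [hpos, hB] with τ hτ hB
        have h2 : (Q τ 0).2 = (q τ 0).2.1 := by
          rw [← hq τ hτ 0]; rfl
        rw [h2, hNorm_coe] at hB
        rw [Real.norm_of_nonneg (sob_nonneg _ _), norm_one, mul_one]
        by_contra hcon
        rw [not_le, max_lt_iff] at hcon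
        exact absurd hB (not_le.2 ((ENNReal.ofReal_lt_ofReal_iff hcon.2).2 hcon.1))
    | succ n ih =>
      have := sobNull_step hA hh (fun τ hτ => hY τ hτ n) (hU n) ih.1 ih.2
      exact ⟨this.1, this.2.1⟩
  refine ⟨q, hq, fun n => (key n).1, fun hG n => ?_⟩
  obtain ⟨i, hi⟩ := hG.exists_stage_eq
  have := (sobNull_step hA hh (fun τ hτ => hY τ hτ n) (hU n) (key n).1 (key n).2).2.2 i
  refine this.congr' (hpos.mono fun τ hτ => ?_)
  rw [hi (hY τ hτ n), hi (hU n)]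

lemma exists_lift_nls {κ h : ℝ} {u : ℕ → ℝ → ℂ} (hu : IsNLSTrajectory M κ h u) :
    ∃ v : ℕ → HInfAlg, (∀ n, (v n).1 = u n) ∧
      ∀ n, ∃ U, M.IsStep (fun v => tri κ v v v) schrodinger h (v n) U (v (n + 1)) := by
  rw [IsNLSTrajectory, ← range_incl] at hu
  exact hu.exists_lift incl_injective (incl_tri κ) incl_schrodinger

theorem isAPq0 (hA : M.IsTypeI) (κ : ℝ) : IsAPq0 M κ := by
  intro h hh u hu Q hQ n k
  obtain ⟨v, hv, hs⟩ := exists_lift_nls hu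
  simp only [← hv] at hQ ⊢
  obtain ⟨q, hq, h0, -⟩ := hQ.sobNull hA hh.ne' hs
  have h1 := ENNReal.tendsto_ofReal (h0 (n + 1) k)
  rw [ENNReal.ofReal_zero] at h1
  refine h1.congr' ?_
  filter_upwards [self_mem_nhdsWithin] with τ hτ
  rw [← hNorm_coe, ← hq τ hτ]
  rfl

theorem isAPq1 (hA : M.IsTypeI) (hG : M.IsGSA) (κ : ℝ) : IsAPq1 M κ := by
  intro h hh u hu Q hQ n k
  obtain ⟨v, hv, hs⟩ := exists_lift_nls hu
  simp only [← hv] at hQ ⊢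
  obtain ⟨q, hq, -, h0⟩ := hQ.sobNull hA hh.ne' hs
  have h1 := ENNReal.tendsto_ofReal (h0 hG n k)
  rw [ENNReal.ofReal_zero] at h1
  refine h1.congr' ?_
  filter_upwards [self_mem_nhdsWithin] with τ hτ
  rw [← hNorm_coe, ← hq τ hτ]
  rfl

end AP

/-! ### Stability of the linear stage equations on the imaginary axis -/

section Stability

variable {s : ℕ} {M : ImExMethod s}

/-- Comparison with the imaginary part. For `a ≠ 0` this bounds `ζ/(1 - aζ)` uniformly for `ζ` on
the imaginary axis, hence at all frequencies. -/
lemma norm_mul_le_norm_one_sub (a y : ℝ) : |a| * ‖Complex.I * y‖ ≤ ‖1 - a * (Complex.I * y)‖ := by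
  have h : (1 - a * (Complex.I * y)).im = -(a * y) := by simp
  have := Complex.abs_im_le_norm (1 - a * (Complex.I * y))
  rw [h, abs_neg, abs_mul] at this
  simpa using this

/-- The scaled derivative `ζ z` of a solution of the linear stage equations is bounded by the data,
uniformly for `ζ` on the imaginary axis. -/
lemma exists_stage_deriv_bound (hA : M.IsTypeI) : ∃ C : ℝ, 0 ≤ C ∧ ∀ (y : ℝ) (r z : Fin s → ℂ),
    (∀ i, z i = r i + ∑ j, (M.Aim i j : ℂ) * (Complex.I * y * z j)) →
    ∀ i, ‖Complex.I * y * z i‖ ≤ C * ∑ j ∈ Finset.Iic i, ‖r j‖ := by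
  have key : ∀ i, ∃ C : ℝ, 0 ≤ C ∧ ∀ (y : ℝ) (r z : Fin s → ℂ),
      (∀ i, z i = r i + ∑ j, (M.Aim i j : ℂ) * (Complex.I * y * z j)) →
      ‖Complex.I * y * z i‖ ≤ C * ∑ j ∈ Finset.Iic i, ‖r j‖ := by
    intro i
    induction i using WellFoundedLT.induction with
    | ind i ih =>
    choose! C hC0 hC using ih
    -- Absolute values are taken because the sign of the chosen `C j` is known only for `j < i`.
    refine ⟨|M.Aim i i|⁻¹ * (1 + ∑ j, |M.Aim i j| * |C j|), by positivity, fun y r z hz => ?_⟩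
    set S := ∑ j ∈ Finset.Iic i, ‖r j‖ with hS
    have ha := hA.diag_ne_zero i
    have hS0 : 0 ≤ S := Finset.sum_nonneg fun _ _ => norm_nonneg _
    -- The stage equation is multiplied by `ζ = iy`; the bound `|a_ii||ζ| ≤ |1 - a_ii ζ|` then
    -- allows `|ζ|` to be cancelled when it is nonzero.
    have h1 : (1 - M.Aim i i * (Complex.I * y)) * (Complex.I * y * z i) = Complex.I * y *
        (r i + ∑ j ∈ Finset.univ.erase i, (M.Aim i j : ℂ) * (Complex.I * y * z j)) := by
      have := hz i
      rw [← Finset.add_sum_erase Finset.univ _ (Finset.mem_univ i)] at this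
      linear_combination (Complex.I * y) * this
    have h2 : ‖r i + ∑ j ∈ Finset.univ.erase i, (M.Aim i j : ℂ) * (Complex.I * y * z j)‖ ≤
        (1 + ∑ j, |M.Aim i j| * |C j|) * S := by
      refine (norm_add_le _ _).trans ?_
      rw [add_mul, one_mul, Finset.sum_mul]
      have hri : ‖r i‖ ≤ S := Finset.single_le_sum (f := fun j => ‖r j‖)
        (fun j _ => norm_nonneg (r j)) (Finset.mem_Iic.2 le_rfl)
      refine add_le_add hri ?_
      refine (norm_sum_le _ _).trans ((Finset.sum_le_sum fun j hj => ?_).trans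
        (Finset.sum_le_sum_of_subset_of_nonneg (Finset.erase_subset i _) fun _ _ _ => by positivity))
      rw [norm_mul, Complex.norm_real, Real.norm_eq_abs, mul_assoc |M.Aim i j|]
      rcases lt_or_gt_of_ne (Finset.ne_of_mem_erase hj) with hj | hj
      · refine mul_le_mul_of_nonneg_left ?_ (abs_nonneg _)
        refine (hC j hj y r z hz).trans (mul_le_mul (le_abs_self _) ?_
          (Finset.sum_nonneg fun _ _ => norm_nonneg _) (abs_nonneg _))
        exact Finset.sum_le_sum_of_subset_of_nonneg (Finset.Iic_subset_Iic.2 hj.le)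
          fun _ _ _ => norm_nonneg _
      · simp [M.implicit_lower i j hj]
    by_cases hy : Complex.I * (y : ℂ) = 0
    · rw [hy, zero_mul, norm_zero]
      positivity
    have hy' : 0 < ‖Complex.I * (y : ℂ)‖ := norm_pos_iff.2 hy
    have h3 := congrArg norm h1
    rw [norm_mul (1 - _) (Complex.I * y * z i), norm_mul (Complex.I * (y : ℂ)) (_ + _)] at h3
    have h4 : |M.Aim i i| * ‖Complex.I * y * z i‖ ≤ (1 + ∑ j, |M.Aim i j| * |C j|) * S := by
      refine le_of_mul_le_mul_left ?_ hy'
      calc ‖Complex.I * (y : ℂ)‖ * (|M.Aim i i| * ‖Complex.I * y * z i‖)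
          = |M.Aim i i| * ‖Complex.I * (y : ℂ)‖ * ‖Complex.I * y * z i‖ := by ring
        _ ≤ ‖1 - M.Aim i i * (Complex.I * (y : ℂ))‖ * ‖Complex.I * y * z i‖ := by
            gcongr
            exact norm_mul_le_norm_one_sub _ _
        _ ≤ _ := by
            rw [h3]
            gcongr
    rw [mul_assoc |M.Aim i i|⁻¹, ← div_eq_inv_mul, le_div_iff₀ (abs_pos.2 ha), mul_comm]
    exact h4
  choose C hC0 hC using key
  refine ⟨∑ i, C i, Finset.sum_nonneg fun i _ => hC0 i, fun y r z hz i => (hC i y r z hz).trans ?_⟩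
  exact mul_le_mul_of_nonneg_right (Finset.single_le_sum (fun i _ => hC0 i) (Finset.mem_univ i))
    (Finset.sum_nonneg fun _ _ => norm_nonneg _)

/-- The solution of the linear stage equations is bounded by the data, uniformly for `ζ` on the
imaginary axis. -/
lemma exists_stage_bound (hA : M.IsTypeI) : ∃ C : ℝ, 0 ≤ C ∧ ∀ (y : ℝ) (r z : Fin s → ℂ),
    (∀ i, z i = r i + ∑ j, (M.Aim i j : ℂ) * (Complex.I * y * z j)) →
    ∀ i, ‖z i‖ ≤ C * ∑ j ∈ Finset.Iic i, ‖r j‖ := by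
  obtain ⟨C, hC0, hC⟩ := exists_stage_deriv_bound hA
  refine ⟨1 + ∑ i, ∑ j, |M.Aim i j| * C, by positivity, fun y r z hz i => ?_⟩
  set S := ∑ j ∈ Finset.Iic i, ‖r j‖ with hS
  have hS0 : 0 ≤ S := Finset.sum_nonneg fun _ _ => norm_nonneg _
  rw [hz i]
  refine (norm_add_le _ _).trans ?_
  rw [add_mul, one_mul]
  have hri : ‖r i‖ ≤ S := Finset.single_le_sum (f := fun j => ‖r j‖)
    (fun j _ => norm_nonneg (r j)) (Finset.mem_Iic.2 le_rfl)
  refine add_le_add hri ?_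
  have h1 : ∑ j, |M.Aim i j| * C ≤ ∑ i, ∑ j, |M.Aim i j| * C :=
    Finset.single_le_sum (f := fun i => ∑ j, |M.Aim i j| * C)
      (fun _ _ => Finset.sum_nonneg fun _ _ => by positivity) (Finset.mem_univ i)
  refine le_trans ?_ (mul_le_mul_of_nonneg_right h1 hS0)
  rw [Finset.sum_mul]
  refine (norm_sum_le _ _).trans (Finset.sum_le_sum fun j _ => ?_)
  rw [norm_mul, Complex.norm_real, Real.norm_eq_abs, mul_assoc |M.Aim i j|]
  rcases le_or_gt j i with hj | hj
  · refine mul_le_mul_of_nonneg_left ((hC y r z hz j).trans ?_) (abs_nonneg _)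
    refine mul_le_mul_of_nonneg_left ?_ hC0
    exact Finset.sum_le_sum_of_subset_of_nonneg (Finset.Iic_subset_Iic.2 hj)
      fun _ _ _ => norm_nonneg _
  · simp [M.implicit_lower i j hj]

/-- The stages of the linear test equation. -/
lemma exists_test_stages (M : ImExMethod s) (y : ℝ) : ∃ m : Fin s → ℂ,
    (∀ i, m i = 1 + ∑ j, (M.Aim i j : ℂ) * (Complex.I * y * m j)) ∧
    M.stabilityFunction (Complex.I * y) = 1 + ∑ j, (M.bim j : ℂ) * (Complex.I * y * m j) := by
  set ζ : ℂ := Complex.I * y with hζ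
  set B : Matrix (Fin s) (Fin s) ℂ := 1 - ζ • M.Aim.map (fun a : ℝ => (a : ℂ)) with hB
  have hBij : ∀ i j, B i j = (1 : Matrix (Fin s) (Fin s) ℂ) i j - ζ * M.Aim i j := fun i j => rfl
  have hlow : B.BlockTriangular OrderDual.toDual := fun i j hij => by
    have hij' : i < j := hij
    rw [hBij, M.implicit_lower i j hij', Matrix.one_apply_ne hij'.ne]
    simp
  -- The matrix is triangular with diagonal entries of real part one.
  have hdet : IsUnit B.det := by
    rw [Matrix.det_of_isLowerTriangular _ hlow, isUnit_iff_ne_zero]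
    refine Finset.prod_ne_zero_iff.2 fun i _ h => ?_
    rw [hBij, Matrix.one_apply_eq] at h
    have := congrArg Complex.re h
    simp [hζ] at this
  refine ⟨B⁻¹.mulVec fun _ => 1, fun i => ?_, ?_⟩
  · have h1 : B.mulVec (B⁻¹.mulVec fun _ => 1) = fun _ => 1 := by
      rw [Matrix.mulVec_mulVec, Matrix.mul_nonsing_inv _ hdet, Matrix.one_mulVec]
    have h2 := congrFun h1 i
    set m := B⁻¹.mulVec fun _ => (1 : ℂ)
    rw [hB, Matrix.sub_mulVec, Matrix.one_mulVec, Matrix.smul_mulVec] at h2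
    simp only [Pi.sub_apply, Pi.smul_apply, Matrix.mulVec, dotProduct, Matrix.map_apply,
      smul_eq_mul, Finset.mul_sum] at h2
    have h3 : ∑ j, (M.Aim i j : ℂ) * (ζ * m j) = ∑ j, ζ * ((M.Aim i j : ℂ) * m j) :=
      Finset.sum_congr rfl fun j _ => by ring
    rw [h3]
    linear_combination h2
  · rw [ImExMethod.stabilityFunction, dotProduct, Finset.mul_sum]
    congr 1
    exact Finset.sum_congr rfl fun j _ => by ring

/-- The scaled test stages `ζ m` are bounded on the imaginary axis. This replaces I-stability when
the number of steps is fixed. -/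
lemma exists_stabilityFunction_bound (hA : M.IsTypeI) :
    ∃ R : ℝ, 0 ≤ R ∧ ∀ y : ℝ, ‖M.stabilityFunction (Complex.I * y)‖ ≤ R := by
  obtain ⟨C, hC0, hC⟩ := exists_stage_deriv_bound hA
  refine ⟨1 + ∑ j, |M.bim j| * (C * s), by positivity, fun y => ?_⟩
  obtain ⟨m, hm, hR⟩ := exists_test_stages M y
  rw [hR]
  refine (norm_add_le _ _).trans (add_le_add (by simp) ((norm_sum_le _ _).trans
    (Finset.sum_le_sum fun j _ => ?_)))
  rw [norm_mul, Complex.norm_real, Real.norm_eq_abs]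
  refine mul_le_mul_of_nonneg_left ((hC y (fun _ => 1) m hm j).trans ?_) (abs_nonneg _)
  refine mul_le_mul_of_nonneg_left ?_ hC0
  simp only [norm_one, Finset.sum_const, nsmul_eq_mul, mul_one]
  exact_mod_cast (Finset.card_le_univ _).trans (by simp)

/-- Propagation of an initial perturbation `e` and of stage perturbations `σ`. -/
lemma exists_update_bound (hA : M.IsTypeI) : ∃ C : ℝ, 0 ≤ C ∧ ∀ (R : ℝ),
    (∀ y : ℝ, ‖M.stabilityFunction (Complex.I * y)‖ ≤ R) → ∀ (y : ℝ) (e : ℂ) (σ z : Fin s → ℂ),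
    (∀ i, z i = e + σ i + ∑ j, (M.Aim i j : ℂ) * (Complex.I * y * z j)) →
    ‖e + ∑ j, (M.bim j : ℂ) * (Complex.I * y * z j)‖ ≤ R * ‖e‖ + C * ∑ j, ‖σ j‖ := by
  obtain ⟨C, hC0, hC⟩ := exists_stage_deriv_bound hA
  refine ⟨∑ j, |M.bim j| * C, by positivity, fun R hR y e σ z hz => ?_⟩
  obtain ⟨m, hm, hS⟩ := exists_test_stages M y
  -- Subtracting `e` times the test stages leaves the stage perturbations as the only data, so `e`
  -- is multiplied by exactly the stability function.
  have h1 : ∀ i, z i - e * m i = σ i + ∑ j, (M.Aim i j : ℂ) * (Complex.I * y * (z j - e * m j)) := by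
    intro i
    have h2 : ∑ j, (M.Aim i j : ℂ) * (Complex.I * y * (z j - e * m j)) =
        ∑ j, (M.Aim i j : ℂ) * (Complex.I * y * z j)
          - e * ∑ j, (M.Aim i j : ℂ) * (Complex.I * y * m j) := by
      rw [Finset.mul_sum, ← Finset.sum_sub_distrib]
      exact Finset.sum_congr rfl fun j _ => by ring
    rw [h2]
    linear_combination hz i - e * hm i
  have h3 : e + ∑ j, (M.bim j : ℂ) * (Complex.I * y * z j) = M.stabilityFunction (Complex.I * y) * e
      + ∑ j, (M.bim j : ℂ) * (Complex.I * y * (z j - e * m j)) := by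
    have h2 : ∑ j, (M.bim j : ℂ) * (Complex.I * y * (z j - e * m j)) =
        ∑ j, (M.bim j : ℂ) * (Complex.I * y * z j)
          - e * ∑ j, (M.bim j : ℂ) * (Complex.I * y * m j) := by
      rw [Finset.mul_sum, ← Finset.sum_sub_distrib]
      exact Finset.sum_congr rfl fun j _ => by ring
    rw [h2, hS]
    ring
  rw [h3]
  refine (norm_add_le _ _).trans (add_le_add ?_ ?_)
  · rw [norm_mul]
    gcongr
    exact hR y
  · rw [Finset.sum_mul]
    refine (norm_sum_le _ _).trans (Finset.sum_le_sum fun j _ => ?_)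
    rw [norm_mul, Complex.norm_real, Real.norm_eq_abs, mul_assoc |M.bim j|]
    refine mul_le_mul_of_nonneg_left ((hC y σ _ h1 j).trans ?_) (abs_nonneg _)
    refine mul_le_mul_of_nonneg_left ?_ hC0
    exact Finset.sum_le_sum_of_subset_of_nonneg (Finset.subset_univ _) fun _ _ _ => norm_nonneg _

/-! ### Stability of the method in the Sobolev norms -/

lemma hat_schrodinger (h : ℝ) (v : HInfAlg) : hat (h • schrodinger v) =ᵐ[volume]
    fun ξ => Complex.I * ((-(4 * Real.pi ^ 2 * ξ ^ 2) * h : ℝ) : ℂ) * hat v ξ := by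
  rw [schrodinger_apply]
  filter_upwards [hat_real_smul h (Complex.I • D (D v)), hat_smul Complex.I (D (D v)),
    hat_D_D v] with ξ h1 h2 h3
  rw [h1, h2, h3]
  push_cast
  ring

lemma hat_sum_schrodinger (h : ℝ) (c : Fin s → ℝ) (v : Fin s → HInfAlg) :
    hat (∑ j, c j • h • schrodinger (v j)) =ᵐ[volume] fun ξ => ∑ j, (c j : ℂ) *
      (Complex.I * ((-(4 * Real.pi ^ 2 * ξ ^ 2) * h : ℝ) : ℂ) * hat (v j) ξ) := by
  have h1 : ∀ᵐ ξ, ∀ j, hat (h • schrodinger (v j)) ξ =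
      Complex.I * ((-(4 * Real.pi ^ 2 * ξ ^ 2) * h : ℝ) : ℂ) * hat (v j) ξ :=
    ae_all_iff.2 fun j => hat_schrodinger h (v j)
  have h2 : ∀ᵐ ξ, ∀ j, hat (c j • h • schrodinger (v j)) ξ =
      c j * hat (h • schrodinger (v j)) ξ := ae_all_iff.2 fun j => hat_real_smul _ _
  filter_upwards [h1, h2, hat_sum Finset.univ fun j => c j • h • schrodinger (v j)] with ξ h1 h2 h3
  rw [h3]
  exact Finset.sum_congr rfl fun j _ => by rw [h2, h1]

/-- At frequency `ξ` these are the scalar stage equations with `y = -4π²ξ²h`. The scalar bound is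
uniform in `y`, so the constant depends on neither `h` nor `k`. -/
lemma exists_sob_stage_bound (hA : M.IsTypeI) : ∃ C : ℝ, 0 ≤ C ∧ ∀ (h : ℝ)
    (r z : Fin s → HInfAlg), (∀ i, z i = r i + ∑ j, M.Aim i j • h • schrodinger (z j)) →
    ∀ i k, sob k (z i) ≤ C * ∑ j ∈ Finset.Iic i, sob k (r j) := by
  obtain ⟨C, hC0, hC⟩ := exists_stage_bound hA
  refine ⟨C, hC0, fun h r z hz i k => ?_⟩
  rw [Finset.mul_sum]
  refine sob_le_of_hat_le _ (fun _ => C) (fun _ _ => hC0) r (z i) ?_ k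
  have h1 : ∀ᵐ ξ, ∀ i, hat (z i) ξ = hat (r i) ξ + ∑ j, (M.Aim i j : ℂ) *
      (Complex.I * ((-(4 * Real.pi ^ 2 * ξ ^ 2) * h : ℝ) : ℂ) * hat (z j) ξ) :=
    ae_all_iff.2 fun i => by
      filter_upwards [hat_add (r i) (∑ j, M.Aim i j • h • schrodinger (z j)),
        hat_sum_schrodinger h (M.Aim i) z] with ξ h1 h2
      conv_lhs => rw [hz i]
      rw [h1, h2]
  filter_upwards [h1] with ξ h1
  rw [← Finset.mul_sum]
  exact hC _ (fun j => hat (r j) ξ) (fun j => hat (z j) ξ) h1 i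

lemma exists_sob_update_bound (hA : M.IsTypeI) : ∃ C : ℝ, 0 ≤ C ∧ ∀ (R : ℝ),
    (∀ y : ℝ, ‖M.stabilityFunction (Complex.I * y)‖ ≤ R) → ∀ (h : ℝ) (e : HInfAlg)
    (σ z : Fin s → HInfAlg),
    (∀ i, z i = e + σ i + ∑ j, M.Aim i j • h • schrodinger (z j)) → ∀ k,
    sob k (e + ∑ j, M.bim j • h • schrodinger (z j)) ≤ R * sob k e + C * ∑ j, sob k (σ j) := by
  obtain ⟨C, hC0, hC⟩ := exists_update_bound hA
  refine ⟨C, hC0, fun R hR h e σ z hz k => ?_⟩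
  have hR0 : 0 ≤ R := (norm_nonneg _).trans (hR 0)
  -- The index `none` carries `e` with weight `R`, the indices `some j` carry `σ j` with weight `C`.
  have key := sob_le_of_hat_le (Finset.univ : Finset (Option (Fin s)))
    (fun o => o.elim R fun _ => C) (fun o _ => by cases o <;> simpa) (fun o => o.elim e σ)
    (e + ∑ j, M.bim j • h • schrodinger (z j)) ?_ k
  · simpa [Fintype.sum_option, Finset.mul_sum] using key
  have h1 : ∀ᵐ ξ, ∀ i, hat (z i) ξ = hat e ξ + hat (σ i) ξ + ∑ j, (M.Aim i j : ℂ) *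
      (Complex.I * ((-(4 * Real.pi ^ 2 * ξ ^ 2) * h : ℝ) : ℂ) * hat (z j) ξ) :=
    ae_all_iff.2 fun i => by
      filter_upwards [hat_add (e + σ i) (∑ j, M.Aim i j • h • schrodinger (z j)),
        hat_sum_schrodinger h (M.Aim i) z, hat_add e (σ i)] with ξ h1 h2 h3
      conv_lhs => rw [hz i]
      rw [h1, h2, h3]
  filter_upwards [h1, hat_add e (∑ j, M.bim j • h • schrodinger (z j)),
    hat_sum_schrodinger h M.bim z] with ξ h1 h2 h3
  rw [h2, h3]
  have := hC R hR _ (hat e ξ) (fun j => hat (σ j) ξ) (fun j => hat (z j) ξ) h1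
  simpa [Fintype.sum_option, Finset.mul_sum] using this

/-! ### Stability of nonlinear steps under perturbation -/

/-- A step of the method from `y` with stages `Y` to `y₁`, together with data `z`, `Z`, `z₁` that
satisfy the equations of a step up to the defects `ρ`, `ρ₁`. -/
structure PerturbedStep (M : ImExMethod s) (κ h : ℝ) (y : HInfAlg) (Y : Fin s → HInfAlg)
    (y₁ z : HInfAlg) (Z : Fin s → HInfAlg) (z₁ : HInfAlg) (ρ : Fin s → HInfAlg) (ρ₁ : HInfAlg) :
    Prop where
  step : M.IsStep (fun v => tri κ v v v) schrodinger h y Y y₁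
  stage : ∀ i, Z i = z + h • (∑ j, M.Aex i j • tri κ (Z j) (Z j) (Z j) +
    ∑ j, M.Aim i j • schrodinger (Z j)) + ρ i
  update : z₁ = z + h • (∑ j, M.bex j • tri κ (Z j) (Z j) (Z j) +
    ∑ j, M.bim j • schrodinger (Z j)) + ρ₁

/-- The size of the perturbation of the stages. -/
def perturbation (k : ℕ) (y z : HInfAlg) (ρ : Fin s → HInfAlg) : ℝ :=
  sob k (y - z) + ∑ j, sob k (ρ j)

lemma perturbation_nonneg (k : ℕ) (y z : HInfAlg) (ρ : Fin s → HInfAlg) :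
    0 ≤ perturbation k y z ρ :=
  add_nonneg (sob_nonneg _ _) (Finset.sum_nonneg fun _ _ => sob_nonneg _ _)

variable {κ h : ℝ} {y y₁ z z₁ ρ₁ : HInfAlg} {Y Z ρ : Fin s → HInfAlg}

/-- The nonlinear part of the difference of the stage equations. -/
def stageDefect (M : ImExMethod s) (κ h : ℝ) (Y Z ρ : Fin s → HInfAlg) (i : Fin s) : HInfAlg :=
  h • (∑ j, M.Aex i j • (tri κ (Y j) (Y j) (Y j) - tri κ (Z j) (Z j) (Z j))) - ρ i

/-- The nonlinear differences are treated as data of a linear implicit system, so the unbounded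
operator is handled entirely by the linear bounds. -/
lemma PerturbedStep.stage_sub (H : PerturbedStep M κ h y Y y₁ z Z z₁ ρ ρ₁) (i : Fin s) :
    Y i - Z i = (y - z) + stageDefect M κ h Y Z ρ i
      + ∑ j, M.Aim i j • h • schrodinger (Y j - Z j) := by
  conv_lhs => rw [H.step.1 i, H.stage i]
  simp only [stageDefect, map_sub, smul_sub, Finset.sum_sub_distrib, smul_add, Finset.smul_sum,
    smul_comm h]
  abel

lemma PerturbedStep.update_sub (H : PerturbedStep M κ h y Y y₁ z Z z₁ ρ ρ₁) :
    y₁ - z₁ = ((y - z) + ∑ j, M.bim j • h • schrodinger (Y j - Z j)) +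
      (h • (∑ j, M.bex j • (tri κ (Y j) (Y j) (Y j) - tri κ (Z j) (Z j) (Z j))) - ρ₁) := by
  rw [H.step.2, H.update]
  simp only [map_sub, smul_sub, Finset.sum_sub_distrib, smul_add, Finset.smul_sum, smul_comm h]
  abel

lemma sob_weighted_sum_le {k : ℕ} (h0 : 0 ≤ h) (c : Fin s → ℝ) (v : Fin s → HInfAlg) (w : HInfAlg) :
    sob k (h • (∑ j, c j • v j) - w) ≤ h * (∑ j, |c j| * sob k (v j)) + sob k w := by
  refine (sob_sub_le _ _ _).trans (add_le_add_left ?_ _)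
  rw [sob_real_smul, abs_of_nonneg h0]
  refine mul_le_mul_of_nonneg_left ((sob_sum_le _ _ _).trans_eq ?_) h0
  exact Finset.sum_congr rfl fun j _ => sob_real_smul _ _ _

/-- Lipschitz bound for the nonlinearity in terms of a bound on the difference. -/
lemma sob_tri_sub_tri_le_of_le {k : ℕ} (hk : 1 ≤ k) (κ : ℝ) {a b : HInfAlg} {B C δ : ℝ}
    (hC : 0 ≤ C) (hδ : 0 ≤ δ) (hδB : δ ≤ B) (hb : sob k b ≤ B) (hab : sob k (a - b) ≤ C * δ) :
    sob k (tri κ a a a - tri κ b b b) ≤ triConst k κ * (C * B + 2 * B) ^ 2 * C * δ := by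
  have hB : 0 ≤ B := hδ.trans hδB
  have ha : sob k a ≤ C * B + B := by
    have h1 := sob_add_le k (a - b) b
    rw [sub_add_cancel] at h1
    have h2 : C * δ ≤ C * B := mul_le_mul_of_nonneg_left hδB hC
    linarith
  refine (sob_tri_sub_tri_le hk κ a b).trans ?_
  have h0 := triConst_nonneg k κ
  have h1 : sob k a + sob k b ≤ C * B + 2 * B := by linarith
  have h2 : 0 ≤ sob k a + sob k b := add_nonneg (sob_nonneg _ _) (sob_nonneg _ _)
  have h3 := sob_nonneg k (a - b)
  rw [mul_assoc (triConst k κ * (C * B + 2 * B) ^ 2)]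
  gcongr

/-- The data of the stages up to `i` involve the nonlinearity only at stages before `i`, since the
explicit tableau is strictly lower triangular. Those are already controlled and lie in a fixed ball,
where the cubic term is Lipschitz. -/
lemma exists_perturbedStage_bound (hA : M.IsTypeI) {k : ℕ} (hk : 1 ≤ k) (κ B : ℝ) (i : Fin s) :
    ∃ C : ℝ, 0 ≤ C ∧ ∀ {h : ℝ} {y y₁ z z₁ ρ₁ : HInfAlg} {Y Z ρ : Fin s → HInfAlg},
      PerturbedStep M κ h y Y y₁ z Z z₁ ρ ρ₁ → 0 ≤ h → h ≤ 1 → (∀ j, sob k (Z j) ≤ B) →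
      perturbation k y z ρ ≤ B → sob k (Y i - Z i) ≤ C * perturbation k y z ρ := by
  obtain ⟨K, hK0, hK⟩ := exists_sob_stage_bound hA
  induction i using WellFoundedLT.induction with
  | ind i ih =>
  choose! C hC0 hC using ih
  set Λ : Fin s → ℝ := fun j => triConst k κ * (|C j| * B + 2 * B) ^ 2 * |C j| with hΛ
  have hΛ0 : ∀ j, 0 ≤ Λ j := fun j => by
    have := triConst_nonneg k κ
    positivity
  refine ⟨K * ∑ j ∈ Finset.Iic i, (1 + ∑ l, |M.Aex j l| * Λ l), mul_nonneg hK0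
    (Finset.sum_nonneg fun j _ => add_nonneg zero_le_one
      (Finset.sum_nonneg fun l _ => mul_nonneg (abs_nonneg _) (hΛ0 l))), ?_⟩
  intro h y y₁ z z₁ ρ₁ Y Z ρ H h0 h1 hZ hδ
  set δ := perturbation k y z ρ with hδdef
  have hδ0 : 0 ≤ δ := perturbation_nonneg _ _ _ _
  refine (hK h _ _ H.stage_sub i k).trans ?_
  rw [mul_assoc, Finset.sum_mul]
  refine mul_le_mul_of_nonneg_left (Finset.sum_le_sum fun j hj => ?_) hK0
  have hj' : j ≤ i := Finset.mem_Iic.1 hj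
  have h2 : h * (∑ l, |M.Aex j l| * sob k (tri κ (Y l) (Y l) (Y l) - tri κ (Z l) (Z l) (Z l))) ≤
      (∑ l, |M.Aex j l| * Λ l) * δ := by
    refine (mul_le_of_le_one_left (Finset.sum_nonneg fun l _ =>
      mul_nonneg (abs_nonneg _) (sob_nonneg _ _)) h1).trans ?_
    rw [Finset.sum_mul]
    refine Finset.sum_le_sum fun l _ => ?_
    rw [mul_assoc]
    rcases lt_or_ge l j with hl | hl
    · refine mul_le_mul_of_nonneg_left ?_ (abs_nonneg _)
      have hl' : l < i := hl.trans_le hj'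
      refine sob_tri_sub_tri_le_of_le hk κ (abs_nonneg _) hδ0 hδ (hZ l) ?_
      rw [abs_of_nonneg (hC0 l hl')]
      exact hC l hl' H h0 h1 hZ hδ
    · simp [M.explicit_strictLower j l hl]
  have h3 := sob_weighted_sum_le (k := k) h0 (M.Aex j)
    (fun l => tri κ (Y l) (Y l) (Y l) - tri κ (Z l) (Z l) (Z l)) (ρ j)
  have h4 : sob k (ρ j) ≤ ∑ j, sob k (ρ j) :=
    Finset.single_le_sum (fun _ _ => sob_nonneg _ _) (Finset.mem_univ j)
  have h5 := sob_add_le k (y - z) (stageDefect M κ h Y Z ρ j)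
  have h6 : δ = sob k (y - z) + ∑ j, sob k (ρ j) := rfl
  rw [stageDefect] at h5 ⊢
  linarith

/-- One step of the method is stable in `H^k`, with the amplification factor of its linear part. -/
theorem exists_perturbedStep_bound (hA : M.IsTypeI) {k : ℕ} (hk : 1 ≤ k) (κ B : ℝ) :
    ∃ C : ℝ, 0 ≤ C ∧ ∀ R : ℝ, (∀ y : ℝ, ‖M.stabilityFunction (Complex.I * y)‖ ≤ R) →
      ∀ {h : ℝ} {y y₁ z z₁ ρ₁ : HInfAlg} {Y Z ρ : Fin s → HInfAlg},
      PerturbedStep M κ h y Y y₁ z Z z₁ ρ ρ₁ → 0 ≤ h → h ≤ 1 → (∀ j, sob k (Z j) ≤ B) →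
      perturbation k y z ρ ≤ B →
      sob k (y₁ - z₁) ≤ (R + C * h) * sob k (y - z) + C * ((∑ j, sob k (ρ j)) + sob k ρ₁) := by
  choose C hC0 hC using fun i => exists_perturbedStage_bound hA hk κ B i
  obtain ⟨K, hK0, hK⟩ := exists_sob_update_bound hA
  set Λ : Fin s → ℝ := fun j => triConst k κ * (C j * B + 2 * B) ^ 2 * C j with hΛ
  have hΛ0 : ∀ j, 0 ≤ Λ j := fun j => by
    have := triConst_nonneg k κ
    have := hC0 j
    positivity
  set Γ : ℝ := K * ∑ i, ∑ j, |M.Aex i j| * Λ j + ∑ j, |M.bex j| * Λ j with hΓ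
  have hΓ0 : 0 ≤ Γ := add_nonneg (mul_nonneg hK0 (Finset.sum_nonneg fun i _ =>
      Finset.sum_nonneg fun j _ => mul_nonneg (abs_nonneg _) (hΛ0 j)))
    (Finset.sum_nonneg fun j _ => mul_nonneg (abs_nonneg _) (hΛ0 j))
  -- `Γ` accounts for the nonlinear terms, which carry a factor `h`, `K` for the stage defects and
  -- `1` for the update defect; `h ≤ 1` absorbs the mixed terms.
  refine ⟨Γ + K + 1, by positivity, ?_⟩
  intro R hR h y y₁ z z₁ ρ₁ Y Z ρ H h0 h1 hZ hδ
  set δ := perturbation k y z ρ with hδdef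
  have hδ0 : 0 ≤ δ := perturbation_nonneg _ _ _ _
  have hT : ∀ l, sob k (tri κ (Y l) (Y l) (Y l) - tri κ (Z l) (Z l) (Z l)) ≤ Λ l * δ := fun l =>
    sob_tri_sub_tri_le_of_le hk κ (hC0 l) hδ0 hδ (hZ l) (hC l H h0 h1 hZ hδ)
  have hs : ∀ c : Fin s → ℝ, h * (∑ l, |c l| * sob k (tri κ (Y l) (Y l) (Y l) -
      tri κ (Z l) (Z l) (Z l))) ≤ h * ((∑ l, |c l| * Λ l) * δ) := fun c => by
    refine mul_le_mul_of_nonneg_left ?_ h0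
    rw [Finset.sum_mul]
    refine Finset.sum_le_sum fun l _ => ?_
    rw [mul_assoc]
    exact mul_le_mul_of_nonneg_left (hT l) (abs_nonneg _)
  have h2 := hK R hR h (y - z) _ _ H.stage_sub k
  have h3 : ∑ j, sob k (stageDefect M κ h Y Z ρ j) ≤
      h * ((∑ i, ∑ j, |M.Aex i j| * Λ j) * δ) + ∑ j, sob k (ρ j) := by
    rw [Finset.sum_mul, Finset.mul_sum, ← Finset.sum_add_distrib]
    exact Finset.sum_le_sum fun j _ => (sob_weighted_sum_le h0 _ _ _).trans
      (add_le_add_left (hs (M.Aex j)) _)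
  have h4 := (sob_weighted_sum_le (k := k) h0 M.bex
    (fun l => tri κ (Y l) (Y l) (Y l) - tri κ (Z l) (Z l) (Z l)) ρ₁).trans
      (add_le_add_left (hs M.bex) _)
  rw [H.update_sub]
  refine (sob_add_le _ _ _).trans ?_
  have h5 : K * (∑ j, sob k (stageDefect M κ h Y Z ρ j)) ≤ _ := mul_le_mul_of_nonneg_left h3 hK0
  set a := sob k (y - z) with ha
  set b := ∑ j, sob k (ρ j) with hb
  have hδ' : δ = a + b := rfl
  have ha0 : 0 ≤ a := sob_nonneg _ _
  have hb0 : 0 ≤ b := Finset.sum_nonneg fun _ _ => sob_nonneg _ _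
  have hr0 : 0 ≤ sob k ρ₁ := sob_nonneg _ _
  have h6 : Γ * h * b ≤ Γ * b := by nlinarith [mul_nonneg hΓ0 hb0]
  have h7 : h * (K * ((∑ i, ∑ j, |M.Aex i j| * Λ j) * δ)) + h * ((∑ l, |M.bex l| * Λ l) * δ) =
      Γ * h * a + Γ * h * b := by
    rw [hΓ, hδ']
    ring
  have h8 : 0 ≤ K * (h * a) := by positivity
  have h9 : 0 ≤ Γ * sob k ρ₁ := by positivity
  have h10 : 0 ≤ K * sob k ρ₁ := by positivity
  have h11 : 0 ≤ h * a := by positivity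
  nlinarith

end Stability

/-! ### A mean value inequality in `H^∞` -/

section MeanValue

/-- The `L²` norm is determined by duality with Schwartz functions. -/
lemma l2_le_of_forall_schwartz {v : HInfAlg} {c : ℝ} (hc : 0 ≤ c)
    (h : ∀ φ : SchwartzMap ℝ ℂ, ‖∫ x, v.1 x * φ x‖ ≤ c * l2 φ) : l2 v ≤ c := by
  set f : Lp ℂ 2 (volume : Measure ℝ) := (memLp (star v)).toLp _ with hf
  have hnorm : ‖f‖ = l2 v := by
    rw [hf, Lp.norm_toLp, ← l2_star v]
    rfl
  have key : ∀ g : Lp ℂ 2 (volume : Measure ℝ), ‖inner ℂ f g‖ ≤ c * ‖g‖ := by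
    refine fun g => (SchwartzMap.denseRange_toLpCLM (E := ℝ) (F := ℂ) (p := 2)
      (μ := volume) ENNReal.ofNat_ne_top).induction_on g
      (isClosed_le (by fun_prop) (by fun_prop)) fun φ => ?_
    have h1 : inner ℂ f (SchwartzMap.toLpCLM ℝ ℂ 2 volume φ) = ∫ x, v.1 x * φ x := by
      rw [L2.inner_def]
      refine integral_congr_ae ?_
      filter_upwards [(memLp (star v)).coeFn_toLp, φ.coeFn_toLp 2 volume] with x h1 h2
      rw [SchwartzMap.toLpCLM_apply, h1, h2]
      change φ x * star (star (v.1 x)) = _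
      rw [star_star, mul_comm]
    have h2 : ‖SchwartzMap.toLpCLM ℝ ℂ 2 volume φ‖ = l2 φ := by
      rw [SchwartzMap.toLpCLM_apply, SchwartzMap.norm_toLp]
      rfl
    rw [h1, h2]
    exact h φ
  -- Density has extended the bound from Schwartz functions to all of `L²`; testing with `f` itself
  -- gives `‖v‖² ≤ c ‖v‖`.
  have h1 := key f
  rw [inner_self_eq_norm_sq_to_K, norm_pow, RCLike.norm_ofReal, abs_norm, hnorm] at h1
  by_contra! hcon
  nlinarith [l2_nonneg v]

variable {e w : ℝ → HInfAlg} {a : ℝ}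

/-- The mean value inequality for `s ↦ e s x - s w r x`, whose derivative is small uniformly in `x`
by the Sobolev embedding. Pointwise differentiability thus becomes uniform in `x`. -/
lemma norm_sub_sub_le_of_hasDerivWithinAt
    (hd : ∀ r ∈ Set.Icc 0 a, ∀ x, HasDerivWithinAt (fun r => (e r).1 x) ((w r).1 x) (Set.Icc 0 a) r)
    (hw : ∀ r ∈ Set.Icc 0 a, Tendsto (fun s => sob 1 (w s - w r)) (𝓝[Set.Icc 0 a] r) (𝓝 0))
    {r : ℝ} (hr : r ∈ Set.Icc 0 a) {ε : ℝ} (hε : 0 < ε) :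
    ∀ᶠ s in 𝓝[Set.Icc 0 a] r, ∀ x,
      ‖(e s).1 x - (e r).1 x - (s - r) • (w r).1 x‖ ≤ ε * ‖s - r‖ := by
  have h1 := (hw r hr).eventually (eventually_lt_nhds hε)
  obtain ⟨δ, hδ, hball⟩ := Metric.mem_nhdsWithin_iff.1 h1
  refine Metric.mem_nhdsWithin_iff.2 ⟨δ, hδ, fun s hs x => ?_⟩
  have hconv : Convex ℝ (Metric.ball r δ ∩ Set.Icc 0 a) := (convex_ball r δ).inter (convex_Icc 0 a)
  have h2 := hconv.norm_image_sub_le_of_norm_hasDerivWithin_le (C := ε)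
    (f := fun s => (e s).1 x - s • (w r).1 x) (f' := fun s => (w s).1 x - (w r).1 x)
    (x := r) (y := s) (fun σ hσ => ?_) (fun σ hσ => ?_) ⟨Metric.mem_ball_self hδ, hr⟩ hs
  · exact (congrArg norm (by module)).trans_le h2
  · have h3 := (hd σ hσ.2 x).sub ((hasDerivWithinAt_id σ (Set.Icc 0 a)).smul_const ((w r).1 x))
    rw [one_smul] at h3
    exact h3.mono Set.inter_subset_right
  · exact (norm_apply_le (w σ - w r) x).trans (le_of_lt (hball hσ))

lemma hasDerivWithinAt_integral_mul
    (hd : ∀ r ∈ Set.Icc 0 a, ∀ x, HasDerivWithinAt (fun r => (e r).1 x) ((w r).1 x) (Set.Icc 0 a) r)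
    (hw : ∀ r ∈ Set.Icc 0 a, Tendsto (fun s => sob 1 (w s - w r)) (𝓝[Set.Icc 0 a] r) (𝓝 0))
    {g : HInfAlg} (hg : Integrable g.1) {r : ℝ} (hr : r ∈ Set.Icc 0 a) :
    HasDerivWithinAt (fun r => ∫ x, (e r).1 x * g.1 x) (∫ x, (w r).1 x * g.1 x)
      (Set.Icc 0 a) r := by
  rw [hasDerivWithinAt_iff_isLittleO, Asymptotics.isLittleO_iff]
  intro ε hε
  have hI : 0 < 1 + ∫ x, ‖g.1 x‖ := by
    have : 0 ≤ ∫ x, ‖g.1 x‖ := integral_nonneg fun _ => norm_nonneg _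
    linarith
  filter_upwards [norm_sub_sub_le_of_hasDerivWithinAt hd hw hr (div_pos hε hI)] with s hs
  have h1 : (∫ x, (e s).1 x * g.1 x) - (∫ x, (e r).1 x * g.1 x) - (s - r) • ∫ x, (w r).1 x * g.1 x =
      ∫ x, ((e s).1 x - (e r).1 x - (s - r) • (w r).1 x) * g.1 x := by
    have h2 := (integrable_mul (e s) g).sub (integrable_mul (e r) g)
    rw [← integral_sub (integrable_mul _ _) (integrable_mul _ _), ← integral_smul]
    refine (integral_sub h2 ((integrable_mul (w r) g).smul (s - r))).symm.trans ?_
    refine integral_congr_ae (Eventually.of_forall fun x => ?_)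
    simp only [Complex.real_smul, Pi.smul_apply, Pi.sub_apply]
    ring
  rw [h1]
  calc ‖∫ x, ((e s).1 x - (e r).1 x - (s - r) • (w r).1 x) * g.1 x‖
      ≤ ∫ x, ε / (1 + ∫ x, ‖g.1 x‖) * ‖s - r‖ * ‖g.1 x‖ := by
        refine norm_integral_le_of_norm_le (hg.norm.const_mul _) (Eventually.of_forall fun x => ?_)
        rw [norm_mul]
        gcongr
        exact hs x
    _ = ε / (1 + ∫ x, ‖g.1 x‖) * (∫ x, ‖g.1 x‖) * ‖s - r‖ := by
        rw [integral_const_mul]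
        ring
    _ ≤ ε * ‖s - r‖ := by
        gcongr
        rw [div_mul_eq_mul_div, div_le_iff₀ hI]
        nlinarith

lemma integrable_D_iterate_schwartz (j : ℕ) (φ : SchwartzMap ℝ ℂ) :
    Integrable (D^[j] (ofSchwartz φ)).1 := by
  induction j generalizing φ with
  | zero => exact φ.integrable
  | succ j ih =>
    rw [Function.iterate_succ_apply]
    exact ih (SchwartzMap.derivCLM ℂ ℂ φ)

/-- By duality it suffices to pair with Schwartz functions, which gives scalar curves. The
derivatives are moved onto the test function to differentiate in time, and back to bound the result.
-/
lemma l2_D_iterate_sub_le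
    (hd : ∀ r ∈ Set.Icc 0 a, ∀ x, HasDerivWithinAt (fun r => (e r).1 x) ((w r).1 x) (Set.Icc 0 a) r)
    (hw : ∀ r ∈ Set.Icc 0 a, Tendsto (fun s => sob 1 (w s - w r)) (𝓝[Set.Icc 0 a] r) (𝓝 0))
    (ha : 0 ≤ a) {j : ℕ} {K : ℝ} (hK : ∀ r ∈ Set.Icc 0 a, l2 (D^[j] (w r)) ≤ K) :
    l2 (D^[j] (e a - e 0)) ≤ K * a := by
  have hK0 : 0 ≤ K := (l2_nonneg _).trans (hK 0 ⟨le_rfl, ha⟩)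
  refine l2_le_of_forall_schwartz (mul_nonneg hK0 ha) fun φ => ?_
  have hsw : ∀ v : HInfAlg, ‖∫ x, (D^[j] v).1 x * φ x‖ =
      ‖∫ x, v.1 x * (D^[j] (ofSchwartz φ)).1 x‖ := fun v => by
    rw [integral_mul_D_iterate, norm_mul, norm_pow, norm_neg, norm_one, one_pow, one_mul]
    rfl
  have h1 := (convex_Icc 0 a).norm_image_sub_le_of_norm_hasDerivWithin_le (C := K * l2 φ)
    (fun r hr => hasDerivWithinAt_integral_mul hd hw (integrable_D_iterate_schwartz j φ) hr)
    (fun r hr => ?_) (Set.left_mem_Icc.2 ha) (Set.right_mem_Icc.2 ha)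
  · rw [hsw]
    rw [sub_zero, Real.norm_of_nonneg ha, ← integral_sub (integrable_mul _ _) (integrable_mul _ _)]
      at h1
    refine le_trans (le_of_eq ?_) (h1.trans_eq (by ring))
    congr 1
    exact integral_congr_ae (Eventually.of_forall fun x => sub_mul _ _ _)
  · rw [← hsw]
    exact (norm_integral_mul_le (D^[j] (w r)) (ofSchwartz φ)).trans
      (mul_le_mul_of_nonneg_right (hK r hr) (l2_nonneg _))

/-- A mean value inequality in Sobolev norms for pointwise differentiable curves. -/
theorem sob_sub_le_of_hasDerivWithinAt
    (hd : ∀ r ∈ Set.Icc 0 a, ∀ x, HasDerivWithinAt (fun r => (e r).1 x) ((w r).1 x) (Set.Icc 0 a) r)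
    (hw : ∀ r ∈ Set.Icc 0 a, SobNull (𝓝[Set.Icc 0 a] r) fun s => w s - w r)
    (ha : 0 ≤ a) {k : ℕ} {K : ℝ} (hK : ∀ r ∈ Set.Icc 0 a, sob k (w r) ≤ K) :
    sob k (e a - e 0) ≤ (k + 1 : ℕ) * (K * a) := by
  have : ∀ j ∈ Finset.range (k + 1), l2 (D^[j] (e a - e 0)) ≤ K * a := fun j hj =>
    l2_D_iterate_sub_le hd (fun r hr => hw r hr 1) ha fun r hr =>
      (l2_D_iterate_le (by have := Finset.mem_range.1 hj; omega) _).trans (hK r hr)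
  refine (Finset.sum_le_card_nsmul _ _ _ this).trans_eq ?_
  simp

end MeanValue

/-! ### Curves solving NLS -/

section Solution

open Asymptotics

variable {κ T : ℝ}

/-- The right-hand side of NLS. -/
def nlsField (κ : ℝ) (v : HInfAlg) : HInfAlg := tri κ v v v + schrodinger v

/-- A solution of NLS on `[0, T]` as a curve in `H^∞`. -/
structure IsCurve (κ T : ℝ) (U : ℝ → HInfAlg) : Prop where
  cont : ∀ t ∈ Set.Icc 0 T, SobNull (𝓝[Set.Icc 0 T] t) fun r => U r - U t
  deriv : ∀ t ∈ Set.Icc 0 T, ∀ x,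
    HasDerivWithinAt (fun r => (U r).1 x) ((nlsField κ (U t)).1 x) (Set.Icc 0 T) t

lemma IsNLSSolution.exists_curve {u : ℝ → ℝ → ℂ} (hu : IsNLSSolution κ T u) :
    ∃ U : ℝ → HInfAlg, (∀ t ∈ Set.Icc 0 T, (U t).1 = u t) ∧ IsCurve κ T U := by
  have h : ∀ t, ∃ v : HInfAlg, t ∈ Set.Icc 0 T → v.1 = u t := fun t => by
    by_cases ht : t ∈ Set.Icc 0 T
    · exact ⟨⟨u t, hu.mem t ht⟩, fun _ => rfl⟩
    · exact ⟨0, fun h => absurd h ht⟩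
  choose U hU using h
  refine ⟨U, hU, fun t ht k => ?_, fun t ht x => ?_⟩
  · refine ((ENNReal.tendsto_toReal ENNReal.zero_ne_top).comp (hu.cont k t ht)).congr' ?_
    filter_upwards [self_mem_nhdsWithin] with r hr
    have h2 : u r - u t = (U r - U t : HInfAlg).1 := by
      rw [← hU r hr, ← hU t ht]; rfl
    rw [Function.comp_apply, h2, hNorm_coe, ENNReal.toReal_ofReal (sob_nonneg _ _)]
  · obtain ⟨ut, h1, h2⟩ := hu.eqn t ht x
    have h3 : (nlsField κ (U t)).1 x = ut := by
      have h4 : (nlsField κ (U t)).1 x = Complex.I * κ * (‖(U t).1 x‖ : ℂ) ^ 2 * (U t).1 x +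
          Complex.I * _root_.deriv (_root_.deriv (U t).1) x :=
        congrArg (· + (schrodinger (U t)).1 x) (congrFun (incl_tri κ (U t)) x)
      rw [h4, hU t ht]
      linear_combination Complex.I * h2 - ut * Complex.I_sq
    rw [h3]
    refine h1.congr (fun r hr => by rw [hU r hr]) (by rw [hU t ht])

variable {U : ℝ → HInfAlg}

lemma SobNull.schrodinger {ι : Type*} {l : Filter ι} {v : ι → HInfAlg} (hv : SobNull l v) :
    SobNull l (fun i => schrodinger (v i)) := hv.D.D.I_smul

lemma IsCurve.tendsto_nlsField (hU : IsCurve κ T U) {t : ℝ} (ht : t ∈ Set.Icc 0 T) :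
    SobNull (𝓝[Set.Icc 0 T] t) fun r => nlsField κ (U r) - nlsField κ (U t) := by
  refine ((SobNull.tri_sub_tri κ (hU.cont t ht)).add (hU.cont t ht).schrodinger).congr'
    (Eventually.of_forall fun r => ?_)
  simp only [nlsField, map_sub]
  abel

lemma IsCurve.exists_bound (hU : IsCurve κ T U) (k : ℕ) :
    ∃ B : ℝ, ∀ t ∈ Set.Icc 0 T, sob k (U t) ≤ B := by
  have hc : ContinuousOn (fun t => sob k (U t)) (Set.Icc 0 T) := fun t ht => by
    refine tendsto_iff_norm_sub_tendsto_zero.2 (squeeze_zero (fun _ => norm_nonneg _)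
      (fun r => ?_) (hU.cont t ht k))
    rw [Real.norm_eq_abs, abs_le]
    have h1 := sob_add_le k (U r - U t) (U t)
    have h2 := sob_add_le k (U t - U r) (U r)
    rw [sub_add_cancel] at h1 h2
    rw [sob_sub_comm] at h2
    constructor <;> linarith
  obtain ⟨B, hB⟩ := isCompact_Icc.exists_bound_of_continuousOn hc
  exact ⟨B, fun t ht => (le_abs_self _).trans (hB t ht)⟩

end Solution

/-! ### Polynomials in the step size with coefficients in `H^∞` -/

section Polynomial

open Asymptotics

variable {ι : Type*} {l : Filter ι} {p : ℕ} {E : Type*} [AddCommGroup E] [Module ℝ E]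

/-- Evaluation of a truncated power series. -/
def gradedEval (h : ℝ) (A : Fin (p + 1) → E) : E :=
  ∑ n : Fin (p + 1), h ^ (n : ℕ) • A n

/-- Evaluation of a truncated power series without constant term, divided by its variable. -/
def gradedShift (h : ℝ) (A : Fin (p + 1) → E) : E :=
  ∑ n : Fin (p + 1), h ^ ((n : ℕ) - 1) • A n

lemma gradedEval_add (h : ℝ) (A B : Fin (p + 1) → E) :
    gradedEval h (A + B) = gradedEval h A + gradedEval h B := by
  simp [gradedEval, smul_add, Finset.sum_add_distrib]

lemma gradedShift_add (h : ℝ) (A B : Fin (p + 1) → E) :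
    gradedShift h (A + B) = gradedShift h A + gradedShift h B := by
  simp [gradedShift, smul_add, Finset.sum_add_distrib]

lemma gradedShift_smul (h c : ℝ) (A : Fin (p + 1) → E) :
    gradedShift h (c • A) = c • gradedShift h A := by
  simp [gradedShift, Finset.smul_sum, smul_comm c]

lemma gradedShift_sum {J : Type*} (s : Finset J) (h : ℝ) (A : J → Fin (p + 1) → E) :
    gradedShift h (∑ j ∈ s, A j) = ∑ j ∈ s, gradedShift h (A j) := by
  simp only [gradedShift, Finset.sum_apply, Finset.smul_sum]
  exact Finset.sum_comm

lemma gradedEval_single (h : ℝ) (y : E) : gradedEval h (Pi.single (0 : Fin (p + 1)) y) = y := by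
  rw [gradedEval, Finset.sum_eq_single 0] <;> simp +contextual

lemma gradedEval_eq_smul_gradedShift (h : ℝ) {A : Fin (p + 1) → E} (hA : A 0 = 0) :
    gradedEval h A = h • gradedShift h A := by
  rw [gradedEval, gradedShift, Finset.smul_sum]
  refine Finset.sum_congr rfl fun n _ => ?_
  -- At `n = 0` the truncated exponent `n - 1` is wrong, but the coefficient vanishes.
  by_cases hn : n = 0
  · subst hn; simp [hA]
  · have : (n : ℕ) ≠ 0 := fun h => hn (Fin.ext h)
    rw [smul_smul, ← pow_succ', Nat.sub_add_cancel (by omega)]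

lemma gradedShift_ite (h : ℝ) (m : ℕ) (B : E) :
    gradedShift (p := p) h (fun n : Fin (p + 1) => if m + 1 = n then B else 0) =
      if m < p then h ^ m • B else 0 := by
  rw [gradedShift]
  split_ifs with hm
  · rw [Finset.sum_eq_single ⟨m + 1, by omega⟩]
    · simp
    · intro n _ hn
      rw [if_neg fun h => hn (Fin.ext h.symm), smul_zero]
    · simp
  · refine Finset.sum_eq_zero fun n _ => ?_
    rw [if_neg (by omega), smul_zero]

lemma map_gradedEval {F : Type*} [AddCommGroup F] [Module ℝ F] (L : E →ₗ[ℝ] F) (h : ℝ)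
    (A : Fin (p + 1) → E) : L (gradedEval h A) = ∑ n : Fin (p + 1), h ^ (n : ℕ) • L (A n) := by
  simp only [gradedEval, map_sum, map_smul]

/-- The graded field keeps exactly the monomials of degree below `p`, the shift by one using up the
last index. What truncation discards has degree at least `p`, hence is `O(h^p)`. -/
lemma tri_gradedEval_sub (T : E →ₗ[ℝ] E →ₗ[ℝ] E →ₗ[ℝ] E) (h : ℝ) (A : Fin (p + 1) → E) :
    T (gradedEval h A) (gradedEval h A) (gradedEval h A) - gradedShift h (gradedExplicit T A) =
      ∑ x : Fin (p + 1) × Fin (p + 1) × Fin (p + 1),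
        if (x.1 : ℕ) + x.2.1 + x.2.2 < p then 0 else
          h ^ ((x.1 : ℕ) + x.2.1 + x.2.2) • T (A x.1) (A x.2.1) (A x.2.2) := by
  have h1 : T (gradedEval h A) (gradedEval h A) (gradedEval h A) =
      ∑ x : Fin (p + 1) × Fin (p + 1) × Fin (p + 1),
        h ^ ((x.1 : ℕ) + x.2.1 + x.2.2) • T (A x.1) (A x.2.1) (A x.2.2) := by
    rw [map_gradedEval T, LinearMap.sum_apply, LinearMap.sum_apply, Fintype.sum_prod_type]
    refine Finset.sum_congr rfl fun a _ => ?_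
    rw [LinearMap.smul_apply, LinearMap.smul_apply, map_gradedEval (T (A a)), LinearMap.sum_apply,
      Finset.smul_sum, Fintype.sum_prod_type]
    refine Finset.sum_congr rfl fun b _ => ?_
    rw [LinearMap.smul_apply, map_gradedEval (T (A a) (A b)), Finset.smul_sum, Finset.smul_sum]
    refine Finset.sum_congr rfl fun c _ => ?_
    rw [smul_smul, smul_smul, pow_add, pow_add, mul_assoc]
  have h2 : gradedShift h (gradedExplicit T A) =
      ∑ x : Fin (p + 1) × Fin (p + 1) × Fin (p + 1),
        if (x.1 : ℕ) + x.2.1 + x.2.2 < p then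
          h ^ ((x.1 : ℕ) + x.2.1 + x.2.2) • T (A x.1) (A x.2.1) (A x.2.2) else 0 := by
    have : gradedExplicit T A = ∑ x : Fin (p + 1) × Fin (p + 1) × Fin (p + 1), fun n : Fin (p + 1) =>
        if (x.1 : ℕ) + x.2.1 + x.2.2 + 1 = n then T (A x.1) (A x.2.1) (A x.2.2) else 0 := by
      ext1 n
      simp [gradedExplicit, Finset.sum_apply]
    rw [this, gradedShift_sum]
    exact Finset.sum_congr rfl fun x _ => gradedShift_ite _ _ _
  rw [h1, h2, ← Finset.sum_sub_distrib]
  refine Finset.sum_congr rfl fun x _ => ?_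
  split_ifs <;> simp

lemma map_gradedEval_sub (L : E →ₗ[ℝ] E) (h : ℝ) (A : Fin (p + 1) → E) :
    L (gradedEval h A) - gradedShift h (gradedImplicit L A) =
      ∑ a : Fin (p + 1), if (a : ℕ) < p then 0 else h ^ (a : ℕ) • L (A a) := by
  have h2 : gradedShift h (gradedImplicit L A) =
      ∑ a : Fin (p + 1), if (a : ℕ) < p then h ^ (a : ℕ) • L (A a) else 0 := by
    have : gradedImplicit L A = ∑ a : Fin (p + 1), fun n : Fin (p + 1) =>
        if (a : ℕ) + 1 = n then L (A a) else 0 := by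
      ext1 n
      simp [gradedImplicit, Finset.sum_apply]
    rw [this, gradedShift_sum]
    exact Finset.sum_congr rfl fun x _ => gradedShift_ite _ _ _
  rw [h2, gradedEval, map_sum, ← Finset.sum_sub_distrib]
  refine Finset.sum_congr rfl fun x _ => ?_
  split_ifs <;> simp

variable {A : ι → Fin (p + 1) → HInfAlg} {h : ι → ℝ}

lemma SobO.gradedExplicit (κ : ℝ) {n : Fin (p + 1)}
    (hA : ∀ m < n, SobO l (fun i => A i m) fun _ => 1) :
    SobO l (fun i => NLSH.gradedExplicit (NLSH.tri κ) (A i) n) fun _ => 1 := by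
  refine SobO.sum fun x _ => ?_
  split_ifs with hx
  · have := (hA x.1 (Fin.lt_def.2 (by omega))).tri κ (hA x.2.1 (Fin.lt_def.2 (by omega)))
      (hA x.2.2 (Fin.lt_def.2 (by omega)))
    simpa using this
  · exact SobO.zero

lemma SobO.gradedImplicit {n : Fin (p + 1)}
    (hA : ∀ m < n, SobO l (fun i => A i m) fun _ => 1) :
    SobO l (fun i => NLSH.gradedImplicit NLSH.schrodinger (A i) n) fun _ => 1 := by
  refine SobO.sum fun x _ => ?_
  split_ifs with hx
  · exact (hA x (Fin.lt_def.2 (by omega))).schrodinger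
  · exact SobO.zero

lemma isBigO_pow_of_le (h1 : h =O[l] fun _ => (1 : ℝ)) {m n : ℕ} (hmn : m ≤ n) :
    (fun i => h i ^ n) =O[l] fun i => h i ^ m := by
  obtain ⟨j, rfl⟩ := Nat.exists_eq_add_of_le hmn
  simpa [pow_add] using (isBigO_refl (fun i => h i ^ m) l).mul (h1.pow j)

lemma SobO.pow_smul {v : ι → HInfAlg} (h1 : h =O[l] fun _ => (1 : ℝ)) {m n : ℕ} (hmn : m ≤ n)
    (hv : SobO l v fun _ => 1) : SobO l (fun i => h i ^ n • v i) fun i => h i ^ m := by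
  simpa using (SobO.smul (isBigO_pow_of_le h1 hmn) hv)

lemma SobO.gradedEval (h1 : h =O[l] fun _ => (1 : ℝ)) (hA : ∀ n, SobO l (fun i => A i n) fun _ => 1) :
    SobO l (fun i => NLSH.gradedEval (h i) (A i)) fun _ => 1 :=
  SobO.sum fun n _ => by simpa using SobO.pow_smul h1 (Nat.zero_le n) (hA n)

lemma SobO.tri_gradedEval_sub (κ : ℝ) (h1 : h =O[l] fun _ => (1 : ℝ))
    (hA : ∀ n, SobO l (fun i => A i n) fun _ => 1) :
    SobO l (fun i => NLSH.tri κ (NLSH.gradedEval (h i) (A i)) (NLSH.gradedEval (h i) (A i))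
      (NLSH.gradedEval (h i) (A i)) - gradedShift (h i) (NLSH.gradedExplicit (NLSH.tri κ) (A i)))
      fun i => h i ^ p := by
  refine SobO.congr (SobO.sum fun x _ => ?_) fun i =>
    (NLSH.tri_gradedEval_sub (NLSH.tri κ) (h i) (A i)).symm
  split_ifs with hx
  · exact SobO.zero
  · refine SobO.pow_smul h1 (not_lt.1 hx) ?_
    simpa using (hA x.1).tri κ (hA x.2.1) (hA x.2.2)

lemma SobO.schrodinger_gradedEval_sub (h1 : h =O[l] fun _ => (1 : ℝ))
    (hA : ∀ n, SobO l (fun i => A i n) fun _ => 1) :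
    SobO l (fun i => NLSH.schrodinger (NLSH.gradedEval (h i) (A i)) -
      gradedShift (h i) (NLSH.gradedImplicit NLSH.schrodinger (A i))) fun i => h i ^ p := by
  refine SobO.congr (SobO.sum fun x _ => ?_) fun i =>
    (map_gradedEval_sub NLSH.schrodinger (h i) (A i)).symm
  split_ifs with hx
  · exact SobO.zero
  · exact SobO.pow_smul h1 (not_lt.1 hx) (hA x).schrodinger

end Polynomial

/-! ### Consistency of the method for smooth solutions of NLS -/

section Consistency

open Asymptotics

/-- Over a principal filter, `O` is a bound on the whole set; this encodes uniformity in time and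
step size. -/
lemma SobO.exists_bound {ι : Type*} {S : Set ι} {v : ι → HInfAlg} {ρ : ι → ℝ}
    (hv : SobO (𝓟 S) v ρ) (k : ℕ) : ∃ C : ℝ, 0 ≤ C ∧ ∀ i ∈ S, sob k (v i) ≤ C * |ρ i| := by
  obtain ⟨C, hC⟩ := isBigO_principal.1 (hv k)
  refine ⟨max C 0, le_max_right _ _, fun i hi => ?_⟩
  have := hC i hi
  rw [Real.norm_of_nonneg (sob_nonneg _ _), Real.norm_eq_abs] at this
  exact this.trans (mul_le_mul_of_nonneg_right (le_max_left _ _) (abs_nonneg _))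

lemma sobO_of_bound {ι : Type*} {S : Set ι} {v : ι → HInfAlg} {ρ : ι → ℝ}
    (h : ∀ k, ∃ C : ℝ, ∀ i ∈ S, sob k (v i) ≤ C * |ρ i|) : SobO (𝓟 S) v ρ := fun k => by
  obtain ⟨C, hC⟩ := h k
  refine isBigO_principal.2 ⟨C, fun i hi => ?_⟩
  rw [Real.norm_of_nonneg (sob_nonneg _ _)]
  exact hC i hi

/-- Initial times and step sizes of the steps inside `[0, T]`. -/
def stepRegion (T : ℝ) : Set (ℝ × ℝ) := {z | 0 ≤ z.1 ∧ 0 ≤ z.2 ∧ z.2 ≤ 1 ∧ z.1 + z.2 ≤ T}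

variable {κ T : ℝ} {U : ℝ → HInfAlg} {p : ℕ} {d : ℝ → Fin (p + 1) → HInfAlg}

lemma isBigO_snd_stepRegion : (fun z : ℝ × ℝ => z.2) =O[𝓟 (stepRegion T)] fun _ => (1 : ℝ) := by
  refine isBigO_principal.2 ⟨1, fun z hz => ?_⟩
  rw [Real.norm_of_nonneg hz.2.1, norm_one, mul_one]
  exact hz.2.2.1

lemma IsCurve.sobO_fst (hU : IsCurve κ T U) :
    SobO (𝓟 (stepRegion T)) (fun z => U z.1) fun _ => 1 :=
  sobO_of_bound fun k => by
    obtain ⟨B, hB⟩ := hU.exists_bound k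
    refine ⟨B, fun z hz => ?_⟩
    rw [abs_one, mul_one]
    exact hB _ ⟨hz.1, by linarith [hz.2.1, hz.2.2.2]⟩

lemma IsCurve.sobO_add (hU : IsCurve κ T U) :
    SobO (𝓟 (stepRegion T)) (fun z => U (z.1 + z.2)) fun _ => 1 :=
  sobO_of_bound fun k => by
    obtain ⟨B, hB⟩ := hU.exists_bound k
    refine ⟨B, fun z hz => ?_⟩
    rw [abs_one, mul_one]
    exact hB _ ⟨add_nonneg hz.1 hz.2.1, hz.2.2.2⟩

/-- Each coefficient is obtained from lower ones at the cost of two derivatives, which the uniform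
bounds on `U` in every `H^k` can afford. -/
lemma sobO_taylor_coeff (hU : IsCurve κ T U) (hd0 : ∀ t, d t 0 = U t)
    (hd : ∀ t (n : Fin (p + 1)), ((n : ℕ) : ℝ) • d t n =
      gradedExplicit (tri κ) (d t) n + gradedImplicit schrodinger (d t) n) (n : Fin (p + 1)) :
    SobO (𝓟 (stepRegion T)) (fun z => d z.1 n) fun _ => 1 := by
  induction n using WellFoundedLT.induction with
  | ind n ih =>
  by_cases hn : n = 0
  · subst hn
    exact hU.sobO_fst.congr fun z => (hd0 z.1).symm
  · have h0 : ((n : ℕ) : ℝ) ≠ 0 := Nat.cast_ne_zero.2 fun h => hn (Fin.ext h)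
    refine (((SobO.gradedExplicit κ ih).add (SobO.gradedImplicit ih)).const_smul
      ((n : ℕ) : ℝ)⁻¹).congr fun z => ?_
    rw [← hd, smul_smul, inv_mul_cancel₀ h0, one_smul]

lemma sobNull_gradedShift_sub (B : Fin (p + 1) → HInfAlg) (r : ℝ) (S : Set ℝ) :
    SobNull (𝓝[S] r) fun s => gradedShift s B - gradedShift r B := by
  have h1 : SobNull (𝓝[S] r) fun s : ℝ =>
      ∑ n : Fin (p + 1), ((s ^ ((n : ℕ) - 1) - r ^ ((n : ℕ) - 1) : ℝ) : ℂ) • B n := by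
    refine SobNull.sum fun n _ => SobNull.smul_sobO ?_ (SobO.const _)
    have : Tendsto (fun s : ℝ => ((s ^ ((n : ℕ) - 1) - r ^ ((n : ℕ) - 1) : ℝ) : ℂ)) (𝓝 r)
        (𝓝 ((r ^ ((n : ℕ) - 1) - r ^ ((n : ℕ) - 1) : ℝ) : ℂ)) := Continuous.tendsto (by fun_prop) r
    rw [sub_self, Complex.ofReal_zero] at this
    exact this.mono_left nhdsWithin_le_nhds
  refine h1.congr' (Eventually.of_forall fun s => ?_)
  simp only [gradedShift, ← Finset.sum_sub_distrib, ← sub_smul, Complex.coe_smul]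

lemma hasDerivAt_gradedEval (A : Fin (p + 1) → HInfAlg) (r x : ℝ) :
    HasDerivAt (fun r => (gradedEval r A).1 x)
      ((gradedShift r fun n => ((n : ℕ) : ℝ) • A n).1 x) r := by
  set φ : HInfAlg →ₗ[ℝ] ℂ := LinearMap.proj x ∘ₗ incl
  have h1 : ∀ r, (gradedEval r A).1 x = ∑ n : Fin (p + 1), r ^ (n : ℕ) • φ (A n) :=
    fun r => map_gradedEval φ r A
  have h2 : (gradedShift r fun n => ((n : ℕ) : ℝ) • A n).1 x =
      ∑ n : Fin (p + 1), (((n : ℕ) : ℝ) * r ^ ((n : ℕ) - 1)) • φ (A n) := by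
    change φ _ = _
    simp only [gradedShift, map_sum, map_smul, smul_smul, mul_comm]
  rw [h2]
  simp only [h1]
  exact HasDerivAt.fun_sum fun n _ => (hasDerivAt_pow (n : ℕ) r).smul_const _

/-- The Taylor polynomial approximates the solution of NLS uniformly in time. -/
theorem sobO_taylor_remainder (hU : IsCurve κ T U) (hd0 : ∀ t, d t 0 = U t)
    (hd : ∀ t (n : Fin (p + 1)), ((n : ℕ) : ℝ) • d t n =
      gradedExplicit (tri κ) (d t) n + gradedImplicit schrodinger (d t) n) :
    SobO (𝓟 (stepRegion T)) (fun z => U (z.1 + z.2) - gradedEval z.2 (d z.1))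
      fun z => z.2 ^ (p + 1) := by
  have hdO := sobO_taylor_coeff hU hd0 hd
  have h1 := isBigO_snd_stepRegion (T := T)
  have hP := SobO.gradedEval h1 hdO
  set w : ℝ × ℝ → HInfAlg := fun z => nlsField κ (U (z.1 + z.2)) -
    gradedShift z.2 fun n => ((n : ℕ) : ℝ) • d z.1 n with hw
  have hsplit : ∀ z : ℝ × ℝ, w z = (tri κ (U (z.1 + z.2)) (U (z.1 + z.2)) (U (z.1 + z.2)) -
        tri κ (gradedEval z.2 (d z.1)) (gradedEval z.2 (d z.1)) (gradedEval z.2 (d z.1))) +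
      schrodinger (U (z.1 + z.2) - gradedEval z.2 (d z.1)) +
      ((tri κ (gradedEval z.2 (d z.1)) (gradedEval z.2 (d z.1)) (gradedEval z.2 (d z.1)) -
        gradedShift z.2 (gradedExplicit (tri κ) (d z.1))) +
      (schrodinger (gradedEval z.2 (d z.1)) -
        gradedShift z.2 (gradedImplicit schrodinger (d z.1)))) := fun z => by
    have h2 : (fun n : Fin (p + 1) => ((n : ℕ) : ℝ) • d z.1 n) =
        gradedExplicit (tri κ) (d z.1) + gradedImplicit schrodinger (d z.1) := funext (hd z.1)
    simp only [hw, h2, gradedShift_add, nlsField, map_sub]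
    abel
  -- Bootstrap: if the remainder is `O(h^m)` with `m ≤ p`, so is its time derivative `w`, by
  -- Lipschitz continuity and the `O(h^p)` truncation defect. As the remainder vanishes at step size
  -- zero, the mean value inequality gains one power.
  have key : ∀ m ≤ p + 1, SobO (𝓟 (stepRegion T))
      (fun z => U (z.1 + z.2) - gradedEval z.2 (d z.1)) fun z => z.2 ^ m := by
    intro m
    induction m with
    | zero =>
      intro _
      simpa using hU.sobO_add.sub hP
    | succ m ih =>
      intro hm
      have he := ih (by omega)
      have hwO : SobO (𝓟 (stepRegion T)) w fun z => z.2 ^ m := by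
        refine (((SobO.tri_sub_tri κ hU.sobO_add hP he).add he.schrodinger).add ?_).congr
          fun z => (hsplit z).symm
        exact ((SobO.tri_gradedEval_sub κ h1 hdO).add (SobO.schrodinger_gradedEval_sub h1 hdO)).trans
          (isBigO_pow_of_le h1 (by omega))
      refine sobO_of_bound fun k => ?_
      obtain ⟨C, hC0, hC⟩ := hwO.exists_bound k
      refine ⟨(k + 1 : ℕ) * C, fun z hz => ?_⟩
      obtain ⟨t, a⟩ := z
      obtain ⟨ht, ha, ha1, hta⟩ := hz
      simp only at ht ha ha1 hta
      have hmaps : Set.MapsTo (fun r => t + r) (Set.Icc 0 a) (Set.Icc 0 T) := fun r hr =>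
        ⟨add_nonneg ht hr.1, by linarith [hr.2]⟩
      have h2 := sob_sub_le_of_hasDerivWithinAt (k := k) (K := C * a ^ m) (a := a)
        (e := fun r => U (t + r) - gradedEval r (d t)) (w := fun r => w (t, r))
        (fun r hr x => ?_) (fun r hr => ?_) ha (fun r hr => ?_)
      · have h3 : U (t + 0) - gradedEval 0 (d t) = 0 := by
          have : gradedEval 0 (d t) = d t 0 := by
            rw [gradedEval, Finset.sum_eq_single 0]
            · simp
            · intro n _ hn
              rw [zero_pow fun h => hn (Fin.ext h), zero_smul]
            · simp
          rw [this, hd0, add_zero, sub_self]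
        rw [h3, sub_zero] at h2
        refine h2.trans_eq ?_
        rw [abs_of_nonneg (by positivity), pow_succ]
        ring
      · have h3 : HasDerivWithinAt (fun r => (U (t + r)).1 x) ((nlsField κ (U (t + r))).1 x)
            (Set.Icc 0 a) r := by
          have h4 := (hU.deriv (t + r) (hmaps hr) x).scomp r
            ((hasDerivWithinAt_id r (Set.Icc 0 a)).const_add t) hmaps
          rw [one_smul] at h4
          exact h4
        exact h3.sub (hasDerivAt_gradedEval (d t) r x).hasDerivWithinAt
      · have h3 : SobNull (𝓝[Set.Icc 0 a] r) fun s =>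
            nlsField κ (U (t + s)) - nlsField κ (U (t + r)) := fun k =>
          (hU.tendsto_nlsField (hmaps hr) k).comp ((by fun_prop : Continuous fun r : ℝ => t + r)
            |>.continuousWithinAt.tendsto_nhdsWithin hmaps)
        refine (h3.sub (sobNull_gradedShift_sub (fun n => ((n : ℕ) : ℝ) • d t n) r _)).congr'
          (Eventually.of_forall fun s => ?_)
        simp only [hw]
        abel
      · refine (hC (t, r) ⟨ht, hr.1, hr.2.trans ha1, by linarith [hr.2]⟩).trans ?_
        simp only
        rw [abs_of_nonneg (pow_nonneg hr.1 m)]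
        exact mul_le_mul_of_nonneg_left (pow_le_pow_left₀ hr.1 hr.2 m) hC0
  exact key (p + 1) le_rfl

variable {s : ℕ} {M : ImExMethod s}

/-- The expansions satisfy the equation exactly as truncated series. Evaluation leaves truncation
defects `O(h^p)` times the prefactor `h`. The rows `a`, `b` are arbitrary so as to cover both stages
and update. -/
lemma sobO_step_defect {ι : Type*} {l : Filter ι} (κ : ℝ) (a b : Fin s → ℝ) {h : ι → ℝ}
    {c : ι → Fin (p + 1) → HInfAlg} {y : ι → HInfAlg} {Y : ι → Fin s → Fin (p + 1) → HInfAlg}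
    (hc : ∀ i, c i = Pi.single 0 (y i) + (1 : ℝ) • (∑ j, a j • gradedExplicit (tri κ) (Y i j) +
      ∑ j, b j • gradedImplicit schrodinger (Y i j)))
    (h1 : h =O[l] fun _ => (1 : ℝ)) (hY : ∀ j n, SobO l (fun i => Y i j n) fun _ => 1) :
    SobO l (fun i => gradedEval (h i) (c i) - (y i + h i • (∑ j, a j • tri κ
      (gradedEval (h i) (Y i j)) (gradedEval (h i) (Y i j)) (gradedEval (h i) (Y i j)) +
        ∑ j, b j • schrodinger (gradedEval (h i) (Y i j))))) fun i => h i ^ (p + 1) := by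
  have h2 : SobO l (fun i => h i • (∑ j, (-a j) • (tri κ (gradedEval (h i) (Y i j))
        (gradedEval (h i) (Y i j)) (gradedEval (h i) (Y i j)) -
          gradedShift (h i) (gradedExplicit (tri κ) (Y i j))) +
      ∑ j, (-b j) • (schrodinger (gradedEval (h i) (Y i j)) -
          gradedShift (h i) (gradedImplicit schrodinger (Y i j))))) fun i => h i ^ (p + 1) := by
    have := SobO.smul (isBigO_refl h l) ((SobO.sum (s := Finset.univ) fun j _ =>
      SobO.const_smul (-a j) (SobO.tri_gradedEval_sub κ h1 (hY j))).add
      (SobO.sum (s := Finset.univ) fun j _ =>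
        SobO.const_smul (-b j) (SobO.schrodinger_gradedEval_sub h1 (hY j))))
    simpa only [← pow_succ'] using this
  refine h2.congr fun i => ?_
  rw [hc i, one_smul, gradedEval_add, gradedEval_single, gradedEval_eq_smul_gradedShift _ (by
    simp [gradedExplicit_zero, gradedImplicit_zero]), gradedShift_add, gradedShift_sum,
    gradedShift_sum]
  simp only [gradedShift_smul, smul_sub, neg_smul, Finset.sum_sub_distrib, Finset.sum_neg_distrib]
  module

/-- Along a solution of NLS the method of order `p` has defects of order `p + 1`. -/
theorem IsCurve.exists_perturbedStep (hM : M.HasOrder p) (hU : IsCurve κ T U) (k : ℕ) :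
    ∃ B : ℝ, 0 ≤ B ∧ ∀ t h, (t, h) ∈ stepRegion T → ∃ (Z ρ : Fin s → HInfAlg) (ρ₁ : HInfAlg),
      (∀ y Y y₁, M.IsStep (fun v => tri κ v v v) schrodinger h y Y y₁ →
        PerturbedStep M κ h y Y y₁ (U t) Z (U (t + h)) ρ ρ₁) ∧
      (∀ j, sob k (Z j) ≤ B) ∧ (∑ j, sob k (ρ j)) + sob k ρ₁ ≤ B * h ^ (p + 1) := by
  choose d hd0 hd using fun t => exists_graded_solution p (tri κ) schrodinger (U t)
  choose Y c hY using fun t => exists_isStep_graded M p (tri κ) schrodinger (U t)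
  -- The only use of the order hypothesis: the expansion of the update agrees with that of the exact
  -- solution.
  have hcd : ∀ t, c t = d t := fun t => eq_of_isStep_graded hM (hY t) (hd0 t) (hd t)
  have h1 := isBigO_snd_stepRegion (T := T)
  have hYO : ∀ n j, SobO (𝓟 (stepRegion T)) (fun z => Y z.1 j n) fun _ => 1 := by
    intro n
    induction n using WellFoundedLT.induction with
    | ind n ih =>
    intro j
    have h2 : SobO (𝓟 (stepRegion T)) (fun z : ℝ × ℝ =>
        (Pi.single 0 (U z.1) : Fin (p + 1) → HInfAlg) n) fun _ => 1 := by
      by_cases hn : n = 0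
      · subst hn
        simpa using hU.sobO_fst
      · simpa [hn] using SobO.zero
    refine (h2.add ((SobO.sum (s := Finset.univ) fun i _ => SobO.const_smul (M.Aex j i)
      (SobO.gradedExplicit κ fun m hm => ih m hm i)).add (SobO.sum (s := Finset.univ) fun i _ =>
        SobO.const_smul (M.Aim j i) (SobO.gradedImplicit fun m hm => ih m hm i)))).congr fun z => ?_
    conv_rhs => rw [congrFun ((hY z.1).1 j) n]
    simp only [Pi.add_apply, Pi.smul_apply, Finset.sum_apply, one_smul]
  set Z : ℝ × ℝ → Fin s → HInfAlg := fun z j => gradedEval z.2 (Y z.1 j) with hZ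
  have hρ := fun i => sobO_step_defect (l := 𝓟 (stepRegion T)) κ (M.Aex i) (M.Aim i)
    (h := fun z => z.2) (c := fun z => Y z.1 i) (y := fun z => U z.1) (Y := fun z => Y z.1)
    (fun z => (hY z.1).1 i) h1 (fun j n => hYO n j)
  have hρ₁ := (sobO_taylor_remainder hU hd0 hd).add
    (sobO_step_defect (l := 𝓟 (stepRegion T)) κ M.bex M.bim
    (h := fun z => z.2) (c := fun z => d z.1) (y := fun z => U z.1) (Y := fun z => Y z.1)
    (fun z => (hcd z.1).symm.trans (hY z.1).2) h1 (fun j n => hYO n j))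
  choose B₁ hB₁0 hB₁ using fun j => (SobO.gradedEval h1 fun n => hYO n j).exists_bound k
  choose B₂ hB₂0 hB₂ using fun j => (hρ j).exists_bound k
  obtain ⟨B₃, hB₃0, hB₃⟩ := hρ₁.exists_bound k
  have hs1 : 0 ≤ ∑ j, B₁ j := Finset.sum_nonneg fun j _ => hB₁0 j
  have hs2 : 0 ≤ ∑ j, B₂ j := Finset.sum_nonneg fun j _ => hB₂0 j
  refine ⟨∑ j, B₁ j + (∑ j, B₂ j + B₃), by positivity, fun t h hz => ?_⟩
  -- The defects are defined as residuals, so the perturbed equations are identities and only the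
  -- bounds need proof.
  refine ⟨Z (t, h), fun i => Z (t, h) i - (U t + h • (∑ j, M.Aex i j •
      tri κ (Z (t, h) j) (Z (t, h) j) (Z (t, h) j) + ∑ j, M.Aim i j • schrodinger (Z (t, h) j))),
    U (t + h) - (U t + h • (∑ j, M.bex j •
      tri κ (Z (t, h) j) (Z (t, h) j) (Z (t, h) j) + ∑ j, M.bim j • schrodinger (Z (t, h) j))),
    fun y Y y₁ H => ⟨H, fun i => (add_sub_cancel _ _).symm, (add_sub_cancel _ _).symm⟩,
    fun j => ?_, ?_⟩
  · have h2 := hB₁ j (t, h) hz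
    rw [abs_one, mul_one] at h2
    have h3 : B₁ j ≤ ∑ j, B₁ j := Finset.single_le_sum (fun j _ => hB₁0 j) (Finset.mem_univ j)
    exact h2.trans (by linarith)
  · have hh : 0 ≤ h ^ (p + 1) := pow_nonneg hz.2.1 _
    have h2 := Finset.sum_le_sum fun (j : Fin s) (_ : j ∈ Finset.univ) => hB₂ j (t, h) hz
    have h3 := hB₃ (t, h) hz
    simp only [abs_of_nonneg hh, ← Finset.sum_mul, sub_add_sub_cancel] at h2 h3
    refine (add_le_add h2 h3).trans ?_
    nlinarith [mul_nonneg hs1 hh]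

end Consistency

/-! ### Error bounds -/

section Error

variable {s : ℕ} {M : ImExMethod s} {κ T : ℝ} {U : ℝ → HInfAlg} {p k : ℕ}

/-- Propagation of the error by one step along a solution of NLS. -/
lemma IsCurve.exists_step_error (hA : M.IsTypeI) (hM : M.HasOrder p) (hU : IsCurve κ T U)
    (hk : 1 ≤ k) : ∃ C : ℝ, 0 ≤ C ∧
      ∀ R : ℝ, (∀ y : ℝ, ‖M.stabilityFunction (Complex.I * y)‖ ≤ R) →
      ∀ t h, (t, h) ∈ stepRegion T → ∀ y Y y₁,
        M.IsStep (fun v => tri κ v v v) schrodinger h y Y y₁ → sob k (y - U t) ≤ 1 →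
        sob k (y₁ - U (t + h)) ≤ (R + C * h) * sob k (y - U t) + C * h ^ (p + 1) := by
  obtain ⟨B, hB0, hB⟩ := hU.exists_perturbedStep hM k
  -- The radius `1 + B` allows for an error at most `1` plus defects at most `B`.
  obtain ⟨C, hC0, hC⟩ := exists_perturbedStep_bound hA hk κ (1 + B)
  refine ⟨C * (1 + B), by positivity, fun R hR t h hz y Y y₁ H hy => ?_⟩
  obtain ⟨Z, ρ, ρ₁, hstep, hZ, hρ⟩ := hB t h hz
  have h0 : 0 ≤ h := hz.2.1
  have h1 : h ≤ 1 := hz.2.2.1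
  have hp : B * h ^ (p + 1) ≤ B := mul_le_of_le_one_right hB0 (pow_le_one₀ h0 h1)
  have hρ₁ := sob_nonneg k ρ₁
  refine (hC R hR (hstep y Y y₁ H) h0 h1 (fun j => (hZ j).trans (by linarith)) ?_).trans ?_
  · rw [perturbation]
    linarith
  · have h2 := mul_le_mul_of_nonneg_left hρ hC0
    have h3 : 0 ≤ C * B * h * sob k (y - U t) :=
      mul_nonneg (by positivity) (sob_nonneg _ _)
    have h4 : 0 ≤ C * h ^ (p + 1) := by positivity
    nlinarith

/-- Error bound after a fixed number of steps. -/
theorem IsCurve.exists_fixed_error (hA : M.IsTypeI) (hM : M.HasOrder p) (hU : IsCurve κ T U)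
    (hk : 1 ≤ k) (n : ℕ) : ∃ C h₀ : ℝ, 0 ≤ C ∧ 0 < h₀ ∧ h₀ ≤ 1 ∧
      ∀ h : ℝ, 0 < h → h < h₀ → (n : ℝ) * h ≤ T → ∀ v : ℕ → HInfAlg, v 0 = U 0 →
        (∀ n, ∃ Y, M.IsStep (fun v => tri κ v v v) schrodinger h (v n) Y (v (n + 1))) →
        sob k (v n - U (n * h)) ≤ C * h ^ (p + 1) := by
  obtain ⟨R, hR0, hR⟩ := exists_stabilityFunction_bound hA
  obtain ⟨L, hL0, hL⟩ := hU.exists_step_error hA hM hk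
  induction n with
  | zero =>
    refine ⟨0, 1, le_rfl, one_pos, le_rfl, fun h _ _ _ v hv _ => ?_⟩
    rw [Nat.cast_zero, zero_mul, zero_mul, hv, sub_self, sob_zero]
  | succ n ih =>
    obtain ⟨C, h₀, hC0, hh₀, hh₁, hC⟩ := ih
    -- The restriction `h < 1/(C + 1)` keeps the error after `n` steps below `1`, as the one-step
    -- estimate requires.
    refine ⟨(R + L) * C + L, min h₀ (C + 1)⁻¹, by positivity, lt_min hh₀ (by positivity),
      (min_le_left _ _).trans hh₁, fun h hh hlt hT v hv hs => ?_⟩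
    rw [lt_min_iff] at hlt
    have hle1 : h ≤ 1 := (hlt.1.trans_le hh₁).le
    rw [Nat.cast_succ, add_mul, one_mul] at hT ⊢
    have h1 := hC h hh hlt.1 (by linarith) v hv hs
    have hpow : h ^ (p + 1) ≤ h := by
      rw [pow_succ]
      exact mul_le_of_le_one_left hh.le (pow_le_one₀ hh.le hle1)
    have h2 : sob k (v n - U (n * h)) ≤ 1 := by
      have h3 : h * (C + 1) ≤ 1 := by
        have := hlt.2.le
        rw [← one_div, le_div_iff₀ (by positivity)] at this
        exact this
      have h4 := mul_le_mul_of_nonneg_left hpow hC0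
      nlinarith
    obtain ⟨Y, hY⟩ := hs n
    refine (hL R hR (n * h) h ⟨by positivity, hh.le, hle1, hT⟩ _ _ _ hY h2).trans ?_
    have h5 : (R + L * h) * sob k (v n - U (n * h)) ≤ (R + L) * (C * h ^ (p + 1)) := by
      refine mul_le_mul ?_ h1 (sob_nonneg _ _) (by positivity)
      nlinarith
    linarith

/-- Error bound on the whole time interval for stable methods. -/
theorem IsCurve.exists_uniform_error (hA : M.IsTypeI) (hM : M.HasOrder p) (hp : 1 ≤ p)
    (hI : M.IsIStable) (hT : 0 < T) (hU : IsCurve κ T U) (hk : 1 ≤ k) :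
    ∃ C h₀ : ℝ, 0 < h₀ ∧ ∀ (n : ℕ) (h : ℝ), 0 < h → h < h₀ → (n : ℝ) * h ≤ T →
      ∀ v : ℕ → HInfAlg, v 0 = U 0 →
        (∀ n, ∃ Y, M.IsStep (fun v => tri κ v v v) schrodinger h (v n) Y (v (n + 1))) →
        sob k (v n - U (n * h)) ≤ C * h ^ p := by
  obtain ⟨L, hL0, hL⟩ := hU.exists_step_error hA hM hk
  set K : ℝ := T * L * Real.exp (L * T) with hK
  have hK0 : 0 ≤ K := by positivity
  refine ⟨K, (K + 1)⁻¹, by positivity, fun n h hh hlt hnT v hv hs => ?_⟩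
  have hle : h * (K + 1) ≤ 1 := by
    have := hlt.le
    rw [← one_div, le_div_iff₀ (by positivity)] at this
    exact this
  have hle1 : h ≤ 1 := by nlinarith
  have hpow : h ^ p ≤ h := by
    obtain ⟨q, rfl⟩ := Nat.exists_eq_add_of_le' hp
    rw [pow_succ]
    exact mul_le_of_le_one_left hh.le (pow_le_one₀ hh.le hle1)
  have hp0 : 0 ≤ h ^ p := by positivity
  have hmono : ∀ n : ℕ, (n : ℝ) * h ≤ T →
      (n * h) * L * Real.exp (L * (n * h)) * h ^ p ≤ K * h ^ p := fun n hn => by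
    rw [hK]
    gcongr
  -- Discrete Gronwall with `R = 1` and `1 + Lh ≤ exp (Lh)`. The choice of `h₀`, together with `h^p
  -- ≤ h` from `p ≥ 1`, keeps all errors below `1`.
  have key : ∀ n : ℕ, (n : ℝ) * h ≤ T →
      sob k (v n - U (n * h)) ≤ (n * h) * L * Real.exp (L * (n * h)) * h ^ p := by
    intro n
    induction n with
    | zero =>
      intro _
      rw [Nat.cast_zero, zero_mul, hv, sub_self, sob_zero]
      simp
    | succ n ih =>
      intro hn
      rw [Nat.cast_succ, add_mul, one_mul] at hn ⊢
      have h1 := ih (by linarith)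
      have h2 : sob k (v n - U (n * h)) ≤ 1 := by
        refine h1.trans ((hmono n (by linarith)).trans ?_)
        nlinarith [mul_le_mul_of_nonneg_left hpow hK0]
      obtain ⟨Y, hY⟩ := hs n
      refine (hL 1 hI (n * h) h ⟨by positivity, hh.le, hle1, hn⟩ _ _ _ hY h2).trans ?_
      have h3 : 1 + L * h ≤ Real.exp (L * h) := by
        rw [add_comm]
        exact Real.add_one_le_exp _
      have h4 : Real.exp (L * (n * h + h)) = Real.exp (L * h) * Real.exp (L * (n * h)) := by
        rw [← Real.exp_add]
        ring_nf
      have h5 : 1 ≤ Real.exp (L * (n * h + h)) := Real.one_le_exp (by positivity)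
      have h6 : (1 + L * h) * sob k (v n - U (n * h)) ≤
          Real.exp (L * h) * ((n * h) * L * Real.exp (L * (n * h)) * h ^ p) :=
        mul_le_mul h3 h1 (sob_nonneg _ _) (Real.exp_nonneg _)
      have h7 : L * h ^ (p + 1) ≤ h * L * Real.exp (L * (n * h + h)) * h ^ p := by
        have h8 : L * h ^ (p + 1) = h * L * h ^ p * 1 := by ring
        rw [h8]
        have := mul_le_mul_of_nonneg_left h5 (by positivity : 0 ≤ h * L * h ^ p)
        linarith
      refine (add_le_add h6 h7).trans_eq ?_
      rw [h4]
      ring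
  exact (key n hnT).trans (hmono n hnT)

/-! ### Passage to the stiff limit -/

lemma limsup_hNorm_sub_le {q : ℝ → HInfAlg} {v w : HInfAlg} {ε : ℝ}
    (hq : SobNull (𝓝[>] 0) fun τ => q τ - v) (hv : sob k (v - w) ≤ ε) {f : ℝ → ℝ → ℂ}
    (hf : ∀ τ > 0, f τ = (q τ).1) :
    limsup (fun τ => hNorm k (f τ - w.1)) (𝓝[>] 0) ≤ ENNReal.ofReal ε := by
  have h1 : Tendsto (fun τ => ENNReal.ofReal (sob k (q τ - v) + ε)) (𝓝[>] 0)
      (𝓝 (ENNReal.ofReal ε)) := by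
    simpa using ENNReal.tendsto_ofReal ((hq k).add_const ε)
  rw [← h1.limsup_eq]
  refine limsup_le_limsup ?_
  filter_upwards [self_mem_nhdsWithin] with τ hτ
  have h2 : f τ - w.1 = (q τ - w : HInfAlg).1 := by
    rw [hf τ hτ]; rfl
  rw [h2, hNorm_coe]
  refine ENNReal.ofReal_le_ofReal ?_
  have h3 := sob_add_le k (q τ - v) (v - w)
  rw [sub_add_sub_cancel] at h3
  linarith

variable {u : ℝ → ℝ → ℂ} {n : ℕ} {h ε : ℝ}

lemma exists_lift_initial (M : ImExMethod s) (κ h : ℝ) (u₀ : HInfAlg) : ∃ v : ℕ → HInfAlg,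
    v 0 = u₀ ∧ ∀ n, ∃ Y, M.IsStep (fun v => tri κ v v v) schrodinger h (v n) Y (v (n + 1)) := by
  obtain ⟨u, ⟨hu0, hu⟩, -⟩ := existsUnique_nlsTrajectory (M := M) κ h u₀.2
  obtain ⟨v, hv, hs⟩ := exists_lift_nls hu
  exact ⟨v, Subtype.ext ((hv 0).trans hu0), hs⟩

/-- In the limit only the error of the NLS trajectory with the same initial value remains. The index
`k + 1` ensures that the algebra property is available, and for `q₁` it pays for the derivative. -/
lemma stiffLimitErrorQ0_of_forall (hA : M.IsTypeI) (hh : 0 < h) (hT : ((n + 1 : ℕ) : ℝ) * h ≤ T)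
    (hUu : ∀ t ∈ Set.Icc 0 T, (U t).1 = u t)
    (H : ∀ v : ℕ → HInfAlg, v 0 = U 0 →
      (∀ n, ∃ Y, M.IsStep (fun v => tri κ v v v) schrodinger h (v n) Y (v (n + 1))) →
      sob (k + 1) (v (n + 1) - U ((n + 1 : ℕ) * h)) ≤ ε) : StiffLimitErrorQ0 M κ u k n h ε := by
  intro Q hQ
  have h0 : (0 : ℝ) ≤ ((n + 1 : ℕ) : ℝ) * h := by positivity
  obtain ⟨v, hv0, hs⟩ := exists_lift_initial M κ h (U 0)
  rw [← hUu 0 ⟨le_rfl, h0.trans hT⟩, ← hv0] at hQ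
  obtain ⟨q, hq, hq0, -⟩ := hQ.sobNull hA hh.ne' hs
  rw [← hUu _ ⟨h0, hT⟩]
  exact limsup_hNorm_sub_le (hq0 (n + 1)) ((sob_mono (Nat.le_succ k) _).trans (H v hv0 hs))
    fun τ hτ => by rw [← hq τ hτ]; rfl

lemma stiffLimitErrorQ1_of_forall (hA : M.IsTypeI) (hG : M.IsGSA) (hh : 0 < h)
    (hT : ((n + 1 : ℕ) : ℝ) * h ≤ T) (hUu : ∀ t ∈ Set.Icc 0 T, (U t).1 = u t)
    (H : ∀ v : ℕ → HInfAlg, v 0 = U 0 →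
      (∀ n, ∃ Y, M.IsStep (fun v => tri κ v v v) schrodinger h (v n) Y (v (n + 1))) →
      sob (k + 1) (v (n + 1) - U ((n + 1 : ℕ) * h)) ≤ ε) : StiffLimitErrorQ1 M κ u k n h ε := by
  intro Q hQ
  have h0 : (0 : ℝ) ≤ ((n + 1 : ℕ) : ℝ) * h := by positivity
  obtain ⟨v, hv0, hs⟩ := exists_lift_initial M κ h (U 0)
  rw [← hUu 0 ⟨le_rfl, h0.trans hT⟩, ← hv0] at hQ
  obtain ⟨q, hq, -, hq1⟩ := hQ.sobNull hA hh.ne' hs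
  rw [← hUu _ ⟨h0, hT⟩]
  refine limsup_hNorm_sub_le (w := D (U ((n + 1 : ℕ) * h))) (hq1 hG n) ?_
    fun τ hτ => by rw [← hq τ hτ]; rfl
  rw [← map_sub]
  exact (sob_D_le k _).trans (H v hv0 hs)

/-- Abstract in `bound` so as to serve both components. For fixed `n` the error is even
`O(h^(p+1))`, and one power is given away. -/
lemma order_of_stiffLimit {bound : ℕ → ℝ → ℝ → Prop} (hA : M.IsTypeI) (hp : 1 ≤ p)
    (hM : M.HasOrder p) (hT : 0 < T) (hU : IsCurve κ T U)
    (H : ∀ (n : ℕ) (h ε : ℝ), 0 < h → ((n + 1 : ℕ) : ℝ) * h ≤ T →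
      (∀ v : ℕ → HInfAlg, v 0 = U 0 →
        (∀ n, ∃ Y, M.IsStep (fun v => tri κ v v v) schrodinger h (v n) Y (v (n + 1))) →
        sob (k + 1) (v (n + 1) - U ((n + 1 : ℕ) * h)) ≤ ε) → bound n h ε) :
    FixedStepOrder p T bound ∧ (M.IsIStable → UniformOrder p T bound) := by
  refine ⟨fun n => ?_, fun hI => ?_⟩
  · obtain ⟨C, h₀, hC0, hh₀, hh₁, hC⟩ :=
      hU.exists_fixed_error hA hM (Nat.le_add_left 1 k) (n + 1)
    refine ⟨C, h₀, hh₀, fun h hh hlt hnT => H n h _ hh hnT fun v hv hs => ?_⟩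
    refine (hC h hh hlt hnT v hv hs).trans (mul_le_mul_of_nonneg_left ?_ hC0)
    exact pow_le_pow_of_le_one hh.le (hlt.trans_le hh₁).le (Nat.le_succ p)
  · obtain ⟨C, h₀, hh₀, hC⟩ := hU.exists_uniform_error hA hM hp hI hT (Nat.le_add_left 1 k)
    exact ⟨C, h₀, hh₀, fun n h hh hlt hnT => H n h _ hh hnT (hC (n + 1) h hh hlt hnT)⟩

end Error

end NLSH

end

/-! ### The main theorem -/

theorem mainTheorem5 {s : ℕ} (M : NLSH.ImExMethod s) (hA : M.IsTypeI) (κ : ℝ) :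
    -- both schemes are well defined for every step size and every relaxation parameter
    (∀ h : ℝ, 0 < h → ∀ u₀ ∈ NLSH.HInf,
      ∃! u : ℕ → ℝ → ℂ, u 0 = u₀ ∧ NLSH.IsNLSTrajectory M κ h u) ∧
    (∀ h : ℝ, 0 < h → ∀ τ : ℝ, 0 < τ → ∀ Q₀ ∈ NLSH.HInf ×ˢ NLSH.HInf,
      ∃! Q : ℕ → NLSH.State, Q 0 = Q₀ ∧ NLSH.IsNLSHTrajectory M κ τ h Q) ∧
    -- asymptotic preservation and asymptotic accuracy for the first component
    NLSH.IsAPq0 M κ ∧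
    (∀ p : ℕ, 1 ≤ p → M.HasOrder p →
      ∀ (T : ℝ) (u : ℝ → ℝ → ℂ), 0 < T → NLSH.IsNLSSolution κ T u → ∀ k : ℕ,
        NLSH.FixedStepOrder p T (NLSH.StiffLimitErrorQ0 M κ u k) ∧
        (M.IsIStable → NLSH.UniformOrder p T (NLSH.StiffLimitErrorQ0 M κ u k))) ∧
    -- the same for the auxiliary component, for globally stiffly accurate methods
    (M.IsGSA →
      NLSH.IsAPq1 M κ ∧
      ∀ p : ℕ, 1 ≤ p → M.HasOrder p →
        ∀ (T : ℝ) (u : ℝ → ℝ → ℂ), 0 < T → NLSH.IsNLSSolution κ T u → ∀ k : ℕ,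
          NLSH.FixedStepOrder p T (NLSH.StiffLimitErrorQ1 M κ u k) ∧
          (M.IsIStable → NLSH.UniformOrder p T (NLSH.StiffLimitErrorQ1 M κ u k))) := by
  refine ⟨fun h _ u₀ hu₀ => NLSH.existsUnique_nlsTrajectory κ h hu₀,
    fun h _ τ hτ Q₀ hQ₀ => NLSH.existsUnique_nlshTrajectory κ h hτ hQ₀, NLSH.isAPq0 hA κ,
    fun p hp hM T u hT hu k => ?_, fun hG => ⟨NLSH.isAPq1 hA hG κ, fun p hp hM T u hT hu k => ?_⟩⟩
  · obtain ⟨U, hUu, hU⟩ := hu.exists_curve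
    exact NLSH.order_of_stiffLimit hA hp hM hT hU fun n h ε hh hnT H =>
      NLSH.stiffLimitErrorQ0_of_forall hA hh hnT hUu H
  · obtain ⟨U, hUu, hU⟩ := hu.exists_curve
    exact NLSH.order_of_stiffLimit hA hp hM hT hU fun n h ε hh hnT H =>
      NLSH.stiffLimitErrorQ1_of_forall hA hG hh hnT hUu H
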